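/- Let $p\ge 3$, $q\ge 3$, $r\ge 2$ be integers and let $d(p,q,r)$ be the bicyclic graph obtained from the path $P_r$ on $r$ vertices by identifying its two different end vertices with a vertex of the cycle $C_p$ and a vertex of the cycle $C_q$, respectively (so $d(p,q,r)$ has $p+q+r-2$ vertices). For a finite simple graph $G$ let $L(G)=D(G)-A(G)$ be its Laplacian matrix, where $D(G)$ is the diagonal matrix of vertex degrees and $A(G)$ the adjacency matrix, and let $\pi(L(G);x)=\operatorname{per}(xI-L(G))$ be its Laplacian permanental polynomial. Then $d(p,q,r)$ is determined by its Laplacian permanental polynomial: every finite simple graph $G$ (connected or not) with $\pi(L(G);x)=\pi(L(d(p,q,r));x)$ is isomorphic to $d(p,q,r)$. -/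

import Mathlib

open Polynomial

/-- The Laplacian permanental polynomial `per(xI - L(G))` of a finite simple graph `G`, where
`L(G) = D(G) - A(G)`. -/
noncomputable def lapPermPoly {V : Type*} [Fintype V] [DecidableEq V] (G : SimpleGraph V)
    [DecidableRel G.Adj] : ℤ[X] :=
  (Matrix.scalar V (X : ℤ[X]) - (G.lapMatrix ℤ).map (C : ℤ → ℤ[X])).permanent

/-- The map `Fin k → ℕ`, `i ↦ a + i`, which places `k` vertices on `a, a + 1, ..., a + k - 1`. -/
def blockEmb (a k : ℕ) : Fin k ↪ ℕ :=
  Fin.valEmbedding.trans (addLeftEmbedding a)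

/-- The bicyclic graph `d(p, q, r)` (meant for `p, q ≥ 3` and `r ≥ 2`), obtained from the path `P_r`
with `r` vertices by identifying one of its end vertices with a vertex of the cycle `C_p` and its
other end vertex with a vertex of the cycle `C_q`.  It has `p + q + r - 2` vertices: the cycle `C_p`
occupies `0, ..., p - 1`, the path `P_r` occupies `p - 1, ..., p + r - 2`, and the cycle `C_q`
occupies `p + r - 2, ..., p + q + r - 3`, so that `P_r` shares exactly its first vertex with `C_p`
and exactly its last vertex with `C_q`. -/
def bicyclicD (p q r : ℕ) : SimpleGraph (Fin (p + q + r - 2)) :=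
  ((SimpleGraph.cycleGraph p).map (blockEmb 0 p) ⊔
    (SimpleGraph.pathGraph r).map (blockEmb (p - 1) r) ⊔
    (SimpleGraph.cycleGraph q).map (blockEmb (p + r - 2) q)).comap Fin.val

/-!
The Laplacian permanental polynomial of a graph determines the number of vertices and the sums of
the degrees and of their squares (`moments_eq_of_lapPermPoly_eq`). For a graph with the polynomial
of `d(p, q, r)` these force two vertices of degree three and all others of degree two. In such a
graph a longest path through a vertex of degree three is the spine of a whole component: its two
ends are joined to vertices of the path by chords, and the degrees leave no room for further edges
(`exists_isChordPath`). The component is a dumbbell or a theta graph, depending on whether the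
chords overlap, and what remains is a union of cycles.

With `x = 1 / w - w + 2` a vertex of degree two has weight `y = 1 / w - w` in `per (x - L)`, and the
permanent of a path obeys the recursion `f (m + 2) = y * f (m + 1) + f m` with the solutions
`w⁻¹ ^ m` and `(-w) ^ m`. Attaching paths one after the other to the two vertices of degree three
(`permanent_earMatrix`) yields closed formulas, polynomial in `w` after normalization:
`dumbbellVal`, `thetaVal`, and a factor `cycleVal` for each isolated cycle. The theorem becomes a
statement on the factorization of these polynomials in `ℤ[X]`: with equal numbers of vertices, a
polynomial `dumbbellVal` times factors `cycleVal` is `dumbbellVal` with the same parameters and no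
further factors (`dumbbell_unique`), and `thetaVal` times factors `cycleVal` is never `dumbbellVal`
(`dumbbell_ne_theta`).

Both are proved by comparing the lowest coefficients behind the shortest cycle length `μ`. Cycles
contribute to the coefficient of `X ^ k` for their length `k`, the paths between the vertices of
degree three from `X ^ (2 * r)` on. The latter would be in the way if `r` is small; but modulo two
all polynomials are squares, and the equation between the square roots, which are products of
`1 + X ^ k`, shows that the path lengths agree or exceed `μ`. The coefficient of `X ^ μ` then counts
the cycles of length `μ`. To distinguish a loop at a vertex of degree three from an isolated cycle,
the coefficients up to `X ^ (μ + 3)` are needed (`dumbbell_compare`). For theta graphs with two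
equal paths two coincidences survive this comparison, and they are excluded by evaluation at `1` and
by cancelling a common factor (`dumbbell_ne_theta_consecutive`, `dumbbell_ne_theta_twin`).
-/

/-! ### Permanents: expansion, block sums, and paths attached to a core -/

section Permanent

open Matrix Equiv

variable {α β R : Type*} [DecidableEq α] [DecidableEq β] [CommRing R]

theorem permanent_submatrix_equiv [Fintype α] [Fintype β] (e : α ≃ β) (M : Matrix β β R) :
    (M.submatrix e e).permanent = M.permanent := by
  unfold Matrix.permanent
  refine Fintype.sum_equiv (Equiv.permCongr e) _ _ fun σ => ?_
  exact Fintype.prod_equiv e _ _ fun i => by simp [Equiv.permCongr_apply]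

theorem permanent_updateRow_add [Fintype α] (M : Matrix α α R) (a : α) (f g : α → R) :
    (M.updateRow a (f + g)).permanent =
      (M.updateRow a f).permanent + (M.updateRow a g).permanent := by
  unfold Matrix.permanent
  rw [← Finset.sum_add_distrib]
  refine Finset.sum_congr rfl fun σ _ => ?_
  rw [← Finset.mul_prod_erase _ _ (Finset.mem_univ (σ.symm a)),
    ← Finset.mul_prod_erase _ (fun i => M.updateRow a f (σ i) i) (Finset.mem_univ (σ.symm a)),
    ← Finset.mul_prod_erase _ (fun i => M.updateRow a g (σ i) i) (Finset.mem_univ (σ.symm a))]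
  have key : ∀ h : α → R, ∏ i ∈ Finset.univ.erase (σ.symm a), M.updateRow a h (σ i) i =
      ∏ i ∈ Finset.univ.erase (σ.symm a), M (σ i) i := fun h =>
    Finset.prod_congr rfl fun i hi => by
      rw [updateRow_ne]
      rintro rfl
      simp at hi
  rw [key, key, key]
  simp [add_mul]

/-- Expansion of a permanent along the row and the column of a distinguished index. -/
theorem permanent_option [Fintype α] (M : Matrix (Option α) (Option α) R) :
    M.permanent = M none none * (M.submatrix some some).permanent +
      ∑ a, M (some a) none *
        ((M.submatrix some some).updateRow a fun b => M none (some b)).permanent := by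
  conv_lhs => unfold Matrix.permanent
  rw [← Equiv.Perm.decomposeOption.symm.sum_comp, Fintype.sum_prod_type, Fintype.sum_option]
  congr 1
  · unfold Matrix.permanent
    rw [Finset.mul_sum]
    refine Finset.sum_congr rfl fun σ _ => ?_
    rw [Fintype.prod_option]
    simp
  · refine Finset.sum_congr rfl fun a _ => ?_
    unfold Matrix.permanent
    rw [Finset.mul_sum]
    refine Finset.sum_congr rfl fun σ _ => ?_
    rw [Fintype.prod_option]
    simp only [Perm.decomposeOption_symm_apply, Perm.coe_mul, Function.comp_apply,
      optionCongr_apply, Option.map_none, swap_apply_left, Option.map_some]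
    congr 1
    refine Finset.prod_congr rfl fun b _ => ?_
    by_cases h : σ b = a
    · simp [h]
    · have : swap none (some a) (some (σ b)) = some (σ b) :=
        swap_apply_of_ne_of_ne (by simp) (by simpa using h)
      simp [this, updateRow_ne h]

theorem permanent_fromBlocks_zero [Fintype α] [Fintype β] (A : Matrix α α R) (D : Matrix β β R) :
    (Matrix.fromBlocks A 0 0 D).permanent = A.permanent * D.permanent := by
  classical
  unfold Matrix.permanent
  refine Eq.trans (Finset.sum_subset (Finset.subset_univ
    ((Equiv.Perm.sumCongrHom α β).range : Set (Perm (α ⊕ β))).toFinset) ?_).symm ?_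
  · rintro σ - hσn
    have h1 : ¬∀ x, ∃ y, Sum.inl y = σ (Sum.inl x) := by
      rw [Set.mem_toFinset] at hσn
      simpa only [Set.MapsTo, Set.mem_range, forall_exists_index, forall_apply_eq_imp_iff] using
        mt Equiv.Perm.mem_sumCongrHom_range_of_perm_mapsTo_inl hσn
    obtain ⟨a, ha⟩ := not_forall.mp h1
    rcases hx : σ (Sum.inl a) with a2 | b
    · exact absurd hx.symm ((not_exists.mp ha) a2)
    · exact Finset.prod_eq_zero (Finset.mem_univ (Sum.inl a)) (by rw [hx]; simp)
  · simp_rw [Finset.sum_mul_sum, ← Finset.sum_product', Finset.univ_product_univ]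
    symm
    refine Finset.sum_nbij (fun σ => σ.fst.sumCongr σ.snd) ?_ ?_ ?_ ?_
    · intro σ _
      rw [Set.mem_toFinset]
      exact ⟨σ, rfl⟩
    · intro σ₁ _ σ₂ _ h
      have h2 : ∀ x, Perm.sumCongr σ₁.fst σ₁.snd x = Perm.sumCongr σ₂.fst σ₂.snd x :=
        DFunLike.congr_fun h
      simp only [Sum.map_inr, Sum.map_inl, Perm.sumCongr_apply, Sum.forall, Sum.inl.injEq,
        Sum.inr.injEq] at h2
      ext x
      · exact h2.left x
      · exact h2.right x
    · intro σ hσ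
      rw [Finset.mem_coe, Set.mem_toFinset] at hσ
      obtain ⟨σ₁₂, hσ₁₂⟩ := hσ
      use σ₁₂
      rw [← hσ₁₂]
      simp
    · rintro ⟨σ₁, σ₂⟩ -
      rw [Fintype.prod_sum_type]
      simp

theorem add_single_eq_updateRow (M : Matrix α α R) (a b : α) :
    M + Matrix.single a b 1 = M.updateRow a (M a + Pi.single b 1) := by
  ext i j
  by_cases hi : i = a
  · subst hi
    simp [Matrix.single_apply, Pi.single_apply, eq_comm]
  · simp [updateRow_ne hi, Ne.symm hi]

theorem permanent_updateRow_single [Fintype α] (M : Matrix α α R) (a b : α) :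
    (M.updateRow a (Pi.single b 1)).permanent =
      (M + Matrix.single a b 1).permanent - M.permanent := by
  rw [add_single_eq_updateRow, permanent_updateRow_add]
  simp

/-- The second differences of the permanent in the entries `(s, s), (t, t)` and
`(s, t), (t, s)` agree: both are the permanent with the rows and columns `s` and `t` deleted. -/
theorem permanent_second_difference [Fintype α] (M : Matrix α α R) {s t : α} (h : s ≠ t) :
    (M + single s t 1 + single t s 1).permanent - (M + single s t 1).permanent
        - (M + single t s 1).permanent =
      (M + single s s 1 + single t t 1).permanent - (M + single s s 1).permanent
        - (M + single t t 1).permanent := by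
  have key : ∀ b c : α, (M + single s b 1 + single t c 1).permanent -
      (M + single s b 1).permanent - (M + single t c 1).permanent =
      ((M.updateRow s (Pi.single b 1)).updateRow t (Pi.single c 1)).permanent - M.permanent := by
    intro b c
    have h1 := permanent_updateRow_single (M + single s b 1) t c
    have h2 := permanent_updateRow_single M t c
    have h3 : (M + single s b 1).updateRow t (Pi.single c 1) =
        (M.updateRow t (Pi.single c 1)).updateRow s (M s + Pi.single b 1) := by
      rw [add_single_eq_updateRow, updateRow_comm _ h]
    have h4 : (M.updateRow t (Pi.single c 1)).updateRow s (M s) =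
        M.updateRow t (Pi.single c 1) := by
      ext i j
      by_cases hi : i = s
      · subst hi
        simp [updateRow_ne h]
      · simp [updateRow_ne hi]
    rw [h3, permanent_updateRow_add, h4, h2, updateRow_comm _ h.symm] at h1
    linear_combination -h1
  rw [key, key, ← permanent_permute_cols (swap s t)]
  congr 2
  ext i j
  by_cases hs : i = s
  · subst hs
    simp [updateRow_ne h]
  · by_cases ht : i = t
    · subst ht
      simp [updateRow_ne h]
    · simp [swap_apply_of_ne_of_ne hs ht, updateRow_ne hs, updateRow_ne ht]

/-- The Fibonacci polynomials `F_{k-1}(y)`, starting from `F_{-1} = 1`: `fibPoly y (m + 2)` is the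
permanent of the `m × m` tridiagonal matrix with diagonal entries `y` and off-diagonal entries
`1`. -/
def fibPoly (y : R) : ℕ → R
  | 0 => 1
  | 1 => 0
  | k + 2 => y * fibPoly y (k + 1) + fibPoly y k

/-- The matrix obtained from `N` by joining the indices `s` and `t` by a path with `m` new interior
vertices, each of weight `y`. For `m = 0` the path is an edge between `s` and `t`. -/
def earMatrix (N : Matrix α α R) (s t : α) (y : R) (m : ℕ) : Matrix (α ⊕ Fin m) (α ⊕ Fin m) R :=
  Matrix.of fun i j => match i, j with
    | .inl a, .inl b => N a b + if m = 0 ∧ (a = s ∧ b = t ∨ a = t ∧ b = s) then 1 else 0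
    | .inl a, .inr k => if a = s ∧ k.val = 0 ∨ a = t ∧ k.val + 1 = m then 1 else 0
    | .inr k, .inl a => if a = s ∧ k.val = 0 ∨ a = t ∧ k.val + 1 = m then 1 else 0
    | .inr k, .inr l =>
      if k.val = l.val then y else if k.val + 1 = l.val ∨ l.val + 1 = k.val then 1 else 0

theorem earMatrix_add_single (N : Matrix α α R) (s t a b : α) (y : R) (m : ℕ) :
    earMatrix N s t y m + single (Sum.inl a) (Sum.inl b) 1 =
      earMatrix (N + single a b 1) s t y m := by
  ext (i | i) (j | j) <;> simp [earMatrix, single_apply]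
  ring

/-- The matrix `N` with one more index `none` of weight `η`, whose row and column are `f`, `g`. -/
def borderMatrix (N : Matrix α α R) (η : R) (f g : α → R) : Matrix (Option α) (Option α) R :=
  Matrix.of fun i j => match i, j with
    | none, none => η
    | none, some b => f b
    | some a, none => g a
    | some a, some b => N a b

theorem permanent_borderMatrix [Fintype α] (N : Matrix α α R) (η : R) (f g : α → R) :
    (borderMatrix N η f g).permanent =
      η * N.permanent + ∑ a, g a * (N.updateRow a f).permanent := by
  rw [permanent_option]
  rfl

/-- The equivalence which makes the first interior vertex of a path part of the core. -/
def earEquiv (α : Type*) (m : ℕ) : Option α ⊕ Fin m ≃ α ⊕ Fin (m + 1) where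
  toFun
    | .inl none => .inr 0
    | .inl (some a) => .inl a
    | .inr k => .inr k.succ
  invFun
    | .inl a => .inl (some a)
    | .inr k => Fin.cases (.inl none) (fun k => .inr k) k
  left_inv := by rintro ((_ | a) | k) <;> simp
  right_inv := by
    rintro (a | k)
    · simp
    · refine Fin.cases ?_ (fun k => ?_) k <;> simp

theorem earMatrix_succ (N : Matrix α α R) (s t : α) (y : R) (m : ℕ) (h : s ≠ t ∨ m ≠ 0) :
    (earMatrix N s t y (m + 1)).submatrix (earEquiv α m) (earEquiv α m) =
      earMatrix (borderMatrix N y (Pi.single s 1) (Pi.single s 1)) none (some t) y m := by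
  ext ((_ | a) | k) ((_ | b) | l)
  · simp [earMatrix, borderMatrix, earEquiv]
  · simp [earMatrix, borderMatrix, earEquiv, Pi.single_apply]
    rcases eq_or_ne b s with rfl | hb <;> rcases eq_or_ne b t with rfl | hb' <;>
      simp_all [eq_comm]
  · simp [earMatrix, borderMatrix, earEquiv, eq_comm]
  · simp [earMatrix, borderMatrix, earEquiv, Pi.single_apply]
    rcases eq_or_ne a s with rfl | hb <;> rcases eq_or_ne a t with rfl | hb' <;>
      simp_all [eq_comm]
  · simp [earMatrix, borderMatrix, earEquiv]
  · simp [earMatrix, borderMatrix, earEquiv]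
  · simp [earMatrix, borderMatrix, earEquiv, eq_comm]
  · simp [earMatrix, borderMatrix, earEquiv]
  · simp [earMatrix, borderMatrix, earEquiv]

theorem permanent_borderMatrix_single [Fintype α] (N : Matrix α α R) (η : R) (s : α) :
    (borderMatrix N η (Pi.single s 1) (Pi.single s 1)).permanent =
      (η - 1) * N.permanent + (N + single s s 1).permanent := by
  rw [permanent_borderMatrix]
  simp only [Pi.single_apply, ite_mul, one_mul, zero_mul, Finset.sum_ite_eq', Finset.mem_univ,
    if_true, permanent_updateRow_single]
  ring

/-- The permanent of `earMatrix N s t y m`, in terms of permanents of perturbations of `N`. The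
differences select the permutations of the core which avoid row and column `s`, row and column `t`,
both of them, or the row of one and the column of the other. -/
def earValue [Fintype α] (N : Matrix α α R) (s t : α) (y : R) (m : ℕ) : R :=
  fibPoly y (m + 2) * N.permanent
    + fibPoly y (m + 1) *
      ((N + single s s 1).permanent + (N + single t t 1).permanent - 2 * N.permanent)
    + fibPoly y m * ((N + single s s 1 + single t t 1).permanent
      - (N + single s s 1).permanent - (N + single t t 1).permanent + N.permanent)
    + ((N + single s t 1).permanent + (N + single t s 1).permanent - 2 * N.permanent)

theorem earValue_borderMatrix [Fintype α] (N : Matrix α α R) (s t : α) (y : R) (m : ℕ) :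
    earValue (borderMatrix N y (Pi.single s 1) (Pi.single s 1)) none (some t) y m =
      earValue N s t y (m + 1) := by
  set e : α → R := Pi.single s 1 with he
  have h1 : borderMatrix N y e e + single none none 1 = borderMatrix N (y + 1) e e := by
    ext (_ | a) (_ | b) <;> simp [borderMatrix]
  have h2 : ∀ η, borderMatrix N η e e + single (some t) (some t) 1 =
      borderMatrix (N + single t t 1) η e e := by
    intro η
    ext (_ | a) (_ | b) <;> simp [borderMatrix, single_apply]
  have h3 : borderMatrix N y e e + single none (some t) 1 =
      borderMatrix N y (e + Pi.single t 1) e := by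
    ext (_ | a) (_ | b) <;> simp [borderMatrix, single_apply, Pi.single_apply, eq_comm]
  have h4 : borderMatrix N y e e + single (some t) none 1 =
      borderMatrix N y e (e + Pi.single t 1) := by
    ext (_ | a) (_ | b) <;> simp [borderMatrix, single_apply, Pi.single_apply, eq_comm]
  have h5 : (borderMatrix N y (e + Pi.single t 1) e).permanent =
      (y - 2) * N.permanent + (N + single s s 1).permanent + (N + single s t 1).permanent := by
    rw [permanent_borderMatrix]
    simp only [he, Pi.single_apply, ite_mul, one_mul, zero_mul, Finset.sum_ite_eq',
      Finset.mem_univ, if_true, permanent_updateRow_add, permanent_updateRow_single]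
    ring
  have h6 : (borderMatrix N y e (e + Pi.single t 1)).permanent =
      (y - 2) * N.permanent + (N + single s s 1).permanent + (N + single t s 1).permanent := by
    rw [permanent_borderMatrix]
    simp only [he, Pi.add_apply, add_mul, Finset.sum_add_distrib, Pi.single_apply, ite_mul,
      one_mul, zero_mul, Finset.sum_ite_eq', Finset.mem_univ, if_true]
    rw [permanent_updateRow_single, permanent_updateRow_single]
    ring
  unfold earValue
  rw [h1, h2, h2, h3, h4, h5, h6, he]
  simp only [permanent_borderMatrix_single]
  rw [show N + single t t 1 + single s s 1 = N + single s s 1 + single t t (1 : R) by abel]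
  simp only [fibPoly]
  ring

theorem permanent_earMatrix [Fintype α] (N : Matrix α α R) {s t : α} (h : s ≠ t) (y : R) (m : ℕ) :
    (earMatrix N s t y m).permanent = earValue N s t y m := by
  induction m generalizing α with
  | zero =>
    have h0 : (earMatrix N s t y 0).submatrix (Equiv.sumEmpty α (Fin 0)).symm
        (Equiv.sumEmpty α (Fin 0)).symm = N + single s t 1 + single t s 1 := by
      ext a b
      simp only [earMatrix, submatrix_apply, sumEmpty_symm_apply, of_apply, true_and,
        Matrix.add_apply, single_apply, add_assoc, add_right_inj]
      rcases eq_or_ne s a with rfl | ha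
      · simp [h, h.symm, eq_comm]
      · rcases eq_or_ne t a with rfl | ha'
        · simp [ha, ha.symm, eq_comm]
        · simp [ha, ha', ha.symm, ha'.symm]
    rw [← permanent_submatrix_equiv (Equiv.sumEmpty α (Fin 0)).symm, h0]
    have := permanent_second_difference N h
    simp only [earValue, fibPoly]
    linear_combination this
  | succ m ih =>
    rw [← permanent_submatrix_equiv (earEquiv α m), earMatrix_succ _ _ _ _ _ (Or.inl h),
      ih _ (by simp), earValue_borderMatrix]

/-- For `s = t` the path closes up to a cycle through `s`; two interior vertices are needed for the
graph to be simple. -/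
theorem permanent_earMatrix_self [Fintype α] (N : Matrix α α R) (s : α) (y : R) (m : ℕ) :
    (earMatrix N s s y (m + 2)).permanent = fibPoly y (m + 4) * N.permanent
      + 2 * (fibPoly y (m + 3) + 1) * ((N + single s s 1).permanent - N.permanent) := by
  rw [← permanent_submatrix_equiv (earEquiv α (m + 1)), earMatrix_succ _ _ _ _ _ (Or.inr (by simp)),
    permanent_earMatrix _ (by simp), earValue_borderMatrix]
  have h2 : (N + single s s 1 + single s s 1).permanent =
      2 * (N + single s s 1).permanent - N.permanent := by
    have h1 := permanent_updateRow_single N s s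
    have h3 : (N + single s s 1 + single s s 1).permanent =
        (N + single s s 1).permanent + (N.updateRow s (Pi.single s 1)).permanent := by
      rw [add_single_eq_updateRow (N + single s s 1), permanent_updateRow_add]
      congr 2
      · simp
      · rw [add_single_eq_updateRow, updateRow_idem]
    rw [h3, h1]
    ring
  simp only [earValue, h2]
  ring

theorem permanent_fin_two (M : Matrix (Fin 2) (Fin 2) R) :
    M.permanent = M 0 0 * M 1 1 + M 0 1 * M 1 0 := by
  have : (Finset.univ : Finset (Perm (Fin 2))) = {1, swap 0 1} := by decide
  rw [Matrix.permanent, this, Finset.sum_pair (by decide)]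
  simp [mul_comm]

end Permanent

/-! ### Permanents of cycles, dumbbells and theta graphs -/

section Values

open Matrix

variable {R : Type*} [CommRing R]

/-- The contribution of a loop of length `p` to the permanent of a dumbbell: as a function of the
length `r` of its path, the permanent is a combination of `w⁻¹ ^ r` and `(-w) ^ r`, and `loopVal`
is the factor in the coefficient of the first, normalized to a polynomial with constant term `1`. -/
def loopVal (w : R) (p : ℕ) : R :=
  1 - w + 2 * w ^ 2 + 2 * (1 + w ^ 2) * w ^ p + (-1) ^ p * (1 + w) * w ^ (2 * p)

/-- The factor of a loop of length `p` in the coefficient of `(-w) ^ r` in the permanent of a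
dumbbell with a path of length `r`, with the normalization of `loopVal`. -/
def loopVal' (w : R) (p : ℕ) : R :=
  -(1 - w) + 2 * (1 + w ^ 2) * w ^ (p - 1) + (-1) ^ p * (2 + w + w ^ 2) * w ^ (2 * p - 1)

/-- The permanent of the dumbbell `d(p, q, r)` with weights `1 / w - w` at the vertices of degree
two and `1 / w - w - 1` at those of degree three, times
`w ^ (p + q + r - 2) * (1 + w ^ 2) ^ 3`. -/
def dumbbellVal (w : R) (p q r : ℕ) : R :=
  loopVal w p * loopVal w q + (-1) ^ r * w ^ (2 * r) * (loopVal' w p * loopVal' w q)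

/-- The permanent of the cycle of length `k` with weights `1 / w - w`, times `w ^ k`. -/
def cycleVal (w : R) (k : ℕ) : R := 1 + 2 * w ^ k + (-1) ^ k * w ^ (2 * k)

/-- The permanent of the theta graph whose three paths have `a`, `b` and `c` edges, with weights
`1 / w - w` at the vertices of degree two and `1 / w - w - 1` at those of degree three, times
`w ^ (a + b + c - 1) * (1 + w ^ 2) ^ 3`. -/
def thetaVal (w : R) (a b c : ℕ) : R :=
  (1 - w + 2 * w ^ 2) ^ 2
    - w ^ 2 * (1 - w) ^ 2 *
      ((-1) ^ a * w ^ (2 * a) + (-1) ^ b * w ^ (2 * b) + (-1) ^ c * w ^ (2 * c))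
    + (1 + w) ^ 2 * ((-1) ^ a * w ^ (2 * a) * ((-1) ^ b * w ^ (2 * b))
      + (-1) ^ b * w ^ (2 * b) * ((-1) ^ c * w ^ (2 * c))
      + (-1) ^ a * w ^ (2 * a) * ((-1) ^ c * w ^ (2 * c)))
    - (2 + w + w ^ 2) ^ 2 *
      ((-1) ^ a * w ^ (2 * a) * ((-1) ^ b * w ^ (2 * b)) * ((-1) ^ c * w ^ (2 * c)))
    + 2 * (1 + w ^ 2) ^ 2 * (w ^ (a + b) * (1 - (-1) ^ c * w ^ (2 * c))
      + w ^ (b + c) * (1 - (-1) ^ a * w ^ (2 * a)) + w ^ (a + c) * (1 - (-1) ^ b * w ^ (2 * b)))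

theorem fibPoly_eq (w : ℝ) (hw : w ≠ 0) (k : ℕ) :
    fibPoly (1 / w - w) k = (w ^ 2 + (-1) ^ k * w ^ (2 * k)) / (w ^ k * (1 + w ^ 2)) := by
  have h1 : 1 + w ^ 2 ≠ 0 := by positivity
  induction k using Nat.twoStepInduction with
  | zero => simp [fibPoly]; field_simp; ring
  | one => simp [fibPoly]
  | more k ih1 ih2 =>
    rw [fibPoly, ih1, ih2]
    have h2 : w ^ k ≠ 0 := pow_ne_zero _ hw
    rw [pow_mul' w 2 k, pow_mul' w 2 (k + 1), pow_mul' w 2 (k + 2)]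
    simp only [pow_succ]
    field_simp
    ring

/-- The matrix of a dumbbell or theta graph before its paths are attached. -/
def coreMatrix (z : R) : Matrix (Fin 2) (Fin 2) R := diagonal fun _ => z

/-- A single cycle is a path attached at both ends to one vertex. -/
theorem permanent_cycle_fib (y : R) (m : ℕ) :
    (earMatrix (diagonal fun _ : Unit => y) () () y (m + 2)).permanent =
      y * fibPoly y (m + 4) + 2 * fibPoly y (m + 3) + 2 := by
  rw [permanent_earMatrix_self]
  simp only [permanent_unique, PUnit.default_eq_unit, diagonal_apply_eq, Matrix.add_apply,
    single_apply_same]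
  ring

theorem permanent_dumbbell_fib (y z : R) (p q r : ℕ) :
    (earMatrix (earMatrix (earMatrix (coreMatrix z) 0 1 y r) (.inl 0) (.inl 0) y (p + 2))
      (.inl (.inl 1)) (.inl (.inl 1)) y (q + 2)).permanent =
    (z * fibPoly y (p + 4) + 2 * fibPoly y (p + 3) + 2) *
        (z * fibPoly y (q + 4) + 2 * fibPoly y (q + 3) + 2) * fibPoly y (r + 2)
      + ((z * fibPoly y (p + 4) + 2 * fibPoly y (p + 3) + 2) * fibPoly y (q + 4)
        + (z * fibPoly y (q + 4) + 2 * fibPoly y (q + 3) + 2) * fibPoly y (p + 4))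
        * fibPoly y (r + 1)
      + fibPoly y (p + 4) * fibPoly y (q + 4) * fibPoly y r := by
  have h01 : (0 : Fin 2) ≠ 1 := by decide
  simp only [permanent_earMatrix_self, earMatrix_add_single, permanent_earMatrix _ h01, earValue]
  generalize fibPoly y (p + 4) = p4
  generalize fibPoly y (p + 3) = p3
  generalize fibPoly y (q + 4) = q4
  generalize fibPoly y (q + 3) = q3
  generalize fibPoly y (r + 2) = r2
  generalize fibPoly y (r + 1) = r1
  generalize fibPoly y r = r0
  simp only [permanent_fin_two, coreMatrix, Matrix.add_apply, single_apply, diagonal_apply]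
  simp
  ring

theorem permanent_theta_fib (y z : R) (a b c : ℕ) :
    (earMatrix (earMatrix (earMatrix (coreMatrix z) 0 1 y a) (.inl 0) (.inl 1) y b)
      (.inl (.inl 0)) (.inl (.inl 1)) y c).permanent =
    z ^ 2 * fibPoly y (a + 2) * fibPoly y (b + 2) * fibPoly y (c + 2)
      + 2 * z * (fibPoly y (a + 1) * fibPoly y (b + 2) * fibPoly y (c + 2)
        + fibPoly y (a + 2) * fibPoly y (b + 1) * fibPoly y (c + 2)
        + fibPoly y (a + 2) * fibPoly y (b + 2) * fibPoly y (c + 1))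
      + 2 * (fibPoly y (a + 1) * fibPoly y (b + 1) * fibPoly y (c + 2)
        + fibPoly y (a + 1) * fibPoly y (b + 2) * fibPoly y (c + 1)
        + fibPoly y (a + 2) * fibPoly y (b + 1) * fibPoly y (c + 1))
      + (fibPoly y a * fibPoly y (b + 2) * fibPoly y (c + 2)
        + fibPoly y (a + 2) * fibPoly y b * fibPoly y (c + 2)
        + fibPoly y (a + 2) * fibPoly y (b + 2) * fibPoly y c)
      + 2 * (fibPoly y (a + 2) + fibPoly y (b + 2) + fibPoly y (c + 2)) := by
  have h01 : (0 : Fin 2) ≠ 1 := by decide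
  rw [permanent_earMatrix _ (by simp)]
  unfold earValue
  simp only [earMatrix_add_single]
  simp only [permanent_earMatrix _ (show (Sum.inl 0 : Fin 2 ⊕ Fin a) ≠ Sum.inl 1 by simp)]
  unfold earValue
  simp only [earMatrix_add_single, permanent_earMatrix _ h01, earValue]
  generalize fibPoly y (a + 2) = a2
  generalize fibPoly y (a + 1) = a1
  generalize fibPoly y a = a0
  generalize fibPoly y (b + 2) = b2
  generalize fibPoly y (b + 1) = b1
  generalize fibPoly y b = b0
  generalize fibPoly y (c + 2) = c2
  generalize fibPoly y (c + 1) = c1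
  generalize fibPoly y c = c0
  simp only [permanent_fin_two, coreMatrix, Matrix.add_apply, single_apply, diagonal_apply]
  simp
  ring

theorem permanent_cycle (w : ℝ) (hw : w ≠ 0) (m : ℕ) :
    w ^ (m + 3) * (earMatrix (diagonal fun _ : Unit => 1 / w - w) () () (1 / w - w)
      (m + 2)).permanent = cycleVal w (m + 3) := by
  have h1 : 1 + w ^ 2 ≠ 0 := by positivity
  have h2 : w ^ m ≠ 0 := pow_ne_zero _ hw
  rw [permanent_cycle_fib, fibPoly_eq w hw, fibPoly_eq w hw, cycleVal]
  simp only [mul_add, pow_add, pow_mul' w 2]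
  generalize w ^ m = x at *
  generalize (-1 : ℝ) ^ m = e at *
  field_simp
  ring

theorem permanent_dumbbell (w : ℝ) (hw : w ≠ 0) (p q r : ℕ) :
    w ^ (p + q + r + 6) * (1 + w ^ 2) ^ 3 *
      (earMatrix (earMatrix (earMatrix (coreMatrix (1 / w - w - 1))
        0 1 (1 / w - w) r) (.inl 0) (.inl 0) (1 / w - w) (p + 2))
        (.inl (.inl 1)) (.inl (.inl 1)) (1 / w - w) (q + 2)).permanent =
      dumbbellVal w (p + 3) (q + 3) (r + 2) := by
  have h1 : 1 + w ^ 2 ≠ 0 := by positivity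
  have hp : w ^ p ≠ 0 := pow_ne_zero _ hw
  have hq : w ^ q ≠ 0 := pow_ne_zero _ hw
  have hr : w ^ r ≠ 0 := pow_ne_zero _ hw
  rw [permanent_dumbbell_fib]
  simp only [fibPoly_eq w hw]
  unfold dumbbellVal loopVal loopVal'
  simp only [show p + 3 - 1 = p + 2 by omega, show q + 3 - 1 = q + 2 by omega,
    show 2 * (p + 3) - 1 = 2 * p + 5 by omega, show 2 * (q + 3) - 1 = 2 * q + 5 by omega]
  simp only [mul_add, pow_add, pow_mul' w 2]
  generalize w ^ p = P at *
  generalize w ^ q = Q at *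
  generalize w ^ r = S at *
  generalize (-1 : ℝ) ^ p = e1 at *
  generalize (-1 : ℝ) ^ q = e2 at *
  generalize (-1 : ℝ) ^ r = e3 at *
  field_simp
  ring

theorem permanent_theta (w : ℝ) (hw : w ≠ 0) (a b c : ℕ) :
    w ^ (a + b + c + 2) * (1 + w ^ 2) ^ 3 *
      (earMatrix (earMatrix (earMatrix (coreMatrix (1 / w - w - 1))
        0 1 (1 / w - w) a) (.inl 0) (.inl 1) (1 / w - w) b)
        (.inl (.inl 0)) (.inl (.inl 1)) (1 / w - w) c).permanent =
      thetaVal w (a + 1) (b + 1) (c + 1) := by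
  have h1 : 1 + w ^ 2 ≠ 0 := by positivity
  have hp : w ^ a ≠ 0 := pow_ne_zero _ hw
  have hq : w ^ b ≠ 0 := pow_ne_zero _ hw
  have hr : w ^ c ≠ 0 := pow_ne_zero _ hw
  rw [permanent_theta_fib]
  simp only [fibPoly_eq w hw]
  unfold thetaVal
  simp only [mul_add, pow_add, pow_mul' w 2]
  generalize w ^ a = P at *
  generalize w ^ b = Q at *
  generalize w ^ c = S at *
  generalize (-1 : ℝ) ^ a = e1 at *
  generalize (-1 : ℝ) ^ b = e2 at *
  generalize (-1 : ℝ) ^ c = e3 at *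
  field_simp
  ring

end Values

/-! ### The first coefficients of `per (1 + X M)` -/

section Coefficients

open Matrix

theorem map_permanent {α R S : Type*} [Fintype α] [DecidableEq α] [CommRing R] [CommRing S]
    (φ : R →+* S) (M : Matrix α α R) : φ M.permanent = (M.map φ).permanent := by
  simp [Matrix.permanent, map_sum, map_prod]

variable {α β R : Type*} [Fintype α] [DecidableEq α] [Fintype β] [DecidableEq β] [CommRing R]

theorem permanent_updateRow_one (a : α) (f : α → R) :
    ((1 : Matrix α α R).updateRow a f).permanent = f a := by
  unfold Matrix.permanent
  rw [Finset.sum_eq_single 1]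
  · rw [← Finset.mul_prod_erase _ _ (Finset.mem_univ a), Finset.prod_eq_one]
    · simp
    · intro i hi
      simp [updateRow_ne (Finset.ne_of_mem_erase hi)]
  · intro σ _ hσ
    obtain ⟨i, hi⟩ : ∃ i, σ i ≠ i := by
      by_contra! h
      exact hσ (Equiv.ext h)
    -- A nontrivial permutation moves two points, and only one of them is sent to `a`.
    obtain ⟨j, hj, hja⟩ : ∃ j, σ j ≠ j ∧ σ j ≠ a := by
      by_cases h : σ i = a
      · refine ⟨σ i, fun h' => hi (σ.injective h'), fun h' => hi ?_⟩
        rw [← h] at h'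
        exact σ.injective h'
      · exact ⟨i, hi, h⟩
    exact Finset.prod_eq_zero (Finset.mem_univ j) (by simp [updateRow_ne hja, hj])
  · simp

/-- The polynomial `per (1 + X M)`. -/
noncomputable def onePlusPermanent (M : Matrix α α R) : R[X] :=
  (1 + (X : R[X]) • M.map C).permanent

theorem onePlusPermanent_submatrix (e : α ≃ β) (M : Matrix β β R) :
    onePlusPermanent (M.submatrix e e) = onePlusPermanent M := by
  unfold onePlusPermanent
  rw [← permanent_submatrix_equiv e]
  congr 1
  ext1 i j
  simp [one_apply]

/-- Removing one index changes `per (1 + X M)` by the factor of its diagonal entry, up to a term of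
order two. -/
theorem onePlusPermanent_option (M : Matrix (Option α) (Option α) R) :
    onePlusPermanent M = (1 + X * C (M none none)) * onePlusPermanent (M.submatrix some some) +
      X * (X * ∑ a, C (M (some a) none) *
        ((1 + (X : R[X]) • (M.submatrix some some).map C).updateRow a
          fun b => C (M none (some b))).permanent) := by
  set A : Matrix (Option α) (Option α) R[X] := 1 + (X : R[X]) • M.map C with hA
  set B : Matrix α α R[X] := 1 + (X : R[X]) • (M.submatrix some some).map C with hB
  have h1 : A.submatrix some some = B := by
    ext1 i j
    simp [hA, hB, one_apply]
  have h2 : (fun b => A none (some b)) = (X : R[X]) • fun b => C (M none (some b)) := by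
    ext1 b
    simp [hA]
  have h3 : A none none = 1 + X * C (M none none) := by simp [hA]
  have h4 : ∀ a, A (some a) none = X * C (M (some a) none) := fun a => by simp [hA]
  have h5 : onePlusPermanent M = A.permanent := rfl
  have h6 : onePlusPermanent (M.submatrix some some) = B.permanent := rfl
  rw [h5, h6, permanent_option, h1, h2, h3]
  simp only [h4, permanent_updateRow_smul, Finset.mul_sum]
  refine congrArg _ (Finset.sum_congr rfl fun a _ => ?_)
  ring

theorem coeff_onePlusPermanent_fin (n : ℕ) (M : Matrix (Fin n) (Fin n) R) :
    (onePlusPermanent M).coeff 0 = 1 ∧ (onePlusPermanent M).coeff 1 = ∑ i, M i i ∧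
      2 * (onePlusPermanent M).coeff 2 =
        (∑ i, M i i) ^ 2 + ∑ i, ∑ j, M i j * M j i - 2 * ∑ i, M i i ^ 2 := by
  induction n with
  | zero => simp [onePlusPermanent, permanent_isEmpty, coeff_one]
  | succ n ih =>
    set N : Matrix (Option (Fin n)) (Option (Fin n)) R :=
      M.submatrix (finSuccEquiv n).symm (finSuccEquiv n).symm with hN
    obtain ⟨h0, h1, h2⟩ := ih (N.submatrix some some)
    have hM : onePlusPermanent M = onePlusPermanent N := by
      rw [hN, onePlusPermanent_submatrix]
    have hq : ∀ q : R[X], (X * (X * q)).coeff 2 = q.coeff 0 := fun q => by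
      rw [coeff_X_mul, coeff_X_mul]
    have hq1 : ∀ q : R[X], (X * (X * q)).coeff 1 = 0 := fun q => by
      rw [coeff_X_mul, mul_coeff_zero, coeff_X_zero, zero_mul]
    have hl1 : ∀ (m : R) (q : R[X]), ((1 + X * C m) * q).coeff 1 = q.coeff 1 + m * q.coeff 0 :=
      fun m q => by rw [add_mul, one_mul, coeff_add, mul_assoc, coeff_X_mul, coeff_C_mul]
    have hl2 : ∀ (m : R) (q : R[X]), ((1 + X * C m) * q).coeff 2 = q.coeff 2 + m * q.coeff 1 :=
      fun m q => by rw [add_mul, one_mul, coeff_add, mul_assoc, coeff_X_mul, coeff_C_mul]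
    have hc : ∀ a, (((1 + (X : R[X]) • (N.submatrix some some).map C).updateRow a
        fun b => C (N none (some b))).permanent).coeff 0 = N none (some a) := by
      intro a
      have h := map_permanent (constantCoeff (R := R))
        ((1 + (X : R[X]) • (N.submatrix some some).map C).updateRow a fun b => C (N none (some b)))
      rw [constantCoeff_apply] at h
      rw [h, ← permanent_updateRow_one a fun b => N none (some b)]
      congr 1
      ext i j
      by_cases hi : i = a
      · subst hi
        simp
      · simp [updateRow_ne hi, one_apply]
        split_ifs <;> simp
    have s1 : ∑ i, M i i = N none none + ∑ a, N (some a) (some a) := by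
      rw [← Equiv.sum_comp (finSuccEquiv n).symm, Fintype.sum_option]
      rfl
    have s2 : ∑ i, M i i ^ 2 = N none none ^ 2 + ∑ a, N (some a) (some a) ^ 2 := by
      rw [← Equiv.sum_comp (finSuccEquiv n).symm, Fintype.sum_option]
      rfl
    have s3 : ∑ i, ∑ j, M i j * M j i = N none none ^ 2 + 2 * ∑ a, N (some a) none * N none (some a)
        + ∑ a, ∑ b, N (some a) (some b) * N (some b) (some a) := by
      have : ∑ i, ∑ j, M i j * M j i = ∑ i, ∑ j, N i j * N j i := by
        rw [← Equiv.sum_comp (finSuccEquiv n).symm]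
        refine Finset.sum_congr rfl fun i _ => ?_
        rw [← Equiv.sum_comp (finSuccEquiv n).symm]
        rfl
      rw [this, Fintype.sum_option, Fintype.sum_option]
      simp only [Fintype.sum_option, Finset.sum_add_distrib]
      simp only [mul_comm (N none (some _))]
      ring
    simp only [submatrix_apply] at h1 h2
    rw [hM, onePlusPermanent_option, s1, s2, s3]
    refine ⟨?_, ?_, ?_⟩
    · rw [coeff_add, mul_coeff_zero, mul_coeff_zero, h0]
      simp
    · rw [coeff_add, hq1, hl1, h0, h1]
      ring
    · rw [coeff_add, hq, hl2, h1, finsetSum_coeff]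
      simp only [coeff_C_mul, hc]
      linear_combination h2

theorem coeff_onePlusPermanent (M : Matrix α α R) :
    (onePlusPermanent M).coeff 0 = 1 ∧ (onePlusPermanent M).coeff 1 = ∑ i, M i i ∧
      2 * (onePlusPermanent M).coeff 2 =
        (∑ i, M i i) ^ 2 + ∑ i, ∑ j, M i j * M j i - 2 * ∑ i, M i i ^ 2 := by
  have h := coeff_onePlusPermanent_fin _
    (M.submatrix (Fintype.equivFin α).symm (Fintype.equivFin α).symm)
  rw [onePlusPermanent_submatrix] at h
  simp only [submatrix_apply] at h
  have s3 : ∑ i, ∑ j, M i j * M j i = ∑ i, ∑ j, M ((Fintype.equivFin α).symm i)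
      ((Fintype.equivFin α).symm j) * M ((Fintype.equivFin α).symm j)
      ((Fintype.equivFin α).symm i) := by
    rw [← Equiv.sum_comp (Fintype.equivFin α).symm]
    exact Finset.sum_congr rfl fun i _ => (Equiv.sum_comp (Fintype.equivFin α).symm _).symm
  rw [Equiv.sum_comp (Fintype.equivFin α).symm fun i => M i i,
    Equiv.sum_comp (Fintype.equivFin α).symm fun i => M i i ^ 2, ← s3] at h
  exact h

end Coefficients

/-! ### Invariants of the Laplacian permanental polynomial -/

section Invariants

open Matrix SimpleGraph

variable {V : Type*} [Fintype V] [DecidableEq V] (G : SimpleGraph V) [DecidableRel G.Adj]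

theorem eval₂_lapPermPoly {K : Type*} [CommRing K] (x : K) :
    (lapPermPoly G).eval₂ (Int.castRingHom K) x =
      (diagonal (fun v => x - (G.degree v : K)) + G.adjMatrix K).permanent := by
  unfold lapPermPoly
  rw [← coe_eval₂RingHom, map_permanent]
  congr 1
  ext i j
  rcases eq_or_ne i j with rfl | h
  · simp [lapMatrix, degMatrix]
  · by_cases hij : G.Adj i j <;> simp [lapMatrix, degMatrix, h, adjMatrix_apply, hij]

/-- `per (1 - t L)` is the polynomial with the coefficients of `lapPermPoly G` in reversed order. -/
theorem eval_onePlusPermanent_lapMatrix (t : ℝ) (ht : t ≠ 0) :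
    (onePlusPermanent (-G.lapMatrix ℤ)).eval₂ (Int.castRingHom ℝ) t =
      t ^ Fintype.card V * (lapPermPoly G).eval₂ (Int.castRingHom ℝ) (1 / t) := by
  rw [eval₂_lapPermPoly, ← permanent_smul]
  unfold onePlusPermanent
  rw [← coe_eval₂RingHom, map_permanent]
  congr 1
  ext i j
  rcases eq_or_ne i j with rfl | h
  · simp [lapMatrix, degMatrix]
    field_simp
    ring
  · by_cases hij : G.Adj i j <;> simp [lapMatrix, degMatrix, h, adjMatrix_apply, hij]

theorem lapMatrix_moments (F : SimpleGraph V) [DecidableRel F.Adj] :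
    ∑ i, (-F.lapMatrix ℤ) i i = -∑ v, (F.degree v : ℤ) ∧
      ∑ i, ((-F.lapMatrix ℤ) i i) ^ 2 = ∑ v, (F.degree v : ℤ) ^ 2 ∧
      ∑ i, ∑ j, (-F.lapMatrix ℤ) i j * (-F.lapMatrix ℤ) j i =
        ∑ v, (F.degree v : ℤ) ^ 2 + ∑ v, (F.degree v : ℤ) := by
  have hd : ∀ i, (F.lapMatrix ℤ) i i = F.degree i := fun i => by simp [lapMatrix, degMatrix]
  refine ⟨by simp [hd], by simp [hd], ?_⟩
  rw [← Finset.sum_add_distrib]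
  refine Finset.sum_congr rfl fun i _ => ?_
  have : ∀ j, (-F.lapMatrix ℤ) i j * (-F.lapMatrix ℤ) j i =
      (if i = j then (F.degree i : ℤ) ^ 2 else 0) + F.adjMatrix ℤ i j := by
    intro j
    rcases eq_or_ne i j with rfl | hne
    · simp [hd, sq]
    · by_cases hij : F.Adj i j <;>
        simp [lapMatrix, degMatrix, hne, hne.symm, adjMatrix_apply, hij, F.adj_comm j i]
  simp only [this, Finset.sum_add_distrib, Finset.sum_ite_eq, Finset.mem_univ, if_true]
  simp [adjMatrix_apply]
  rw [← F.card_neighborFinset_eq_degree, F.neighborFinset_eq_filter]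

theorem eq_of_eval₂_eq {P Q : ℤ[X]}
    (h : ∀ t : ℝ, t ≠ 0 → P.eval₂ (Int.castRingHom ℝ) t = Q.eval₂ (Int.castRingHom ℝ) t) :
    P = Q := by
  have hinj : Function.Injective (Polynomial.map (Int.castRingHom ℝ)) :=
    map_injective _ Int.cast_injective
  apply hinj
  apply eq_of_infinite_eval_eq
  refine Set.Infinite.mono (s := {0}ᶜ) ?_ (Set.finite_singleton (0 : ℝ)).infinite_compl
  intro t ht
  simpa [eval_map] using h t ht

variable {W : Type*} [Fintype W] [DecidableEq W] (H : SimpleGraph W) [DecidableRel H.Adj]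

/-- The number of vertices and the first two moments of the degree sequence can be read off the
Laplacian permanental polynomial. -/
theorem moments_eq_of_lapPermPoly_eq (h : lapPermPoly G = lapPermPoly H) :
    Fintype.card V = Fintype.card W ∧ ∑ v, (G.degree v : ℤ) = ∑ v, (H.degree v : ℤ) ∧
      ∑ v, (G.degree v : ℤ) ^ 2 = ∑ v, (H.degree v : ℤ) ^ 2 := by
  set S := onePlusPermanent (-G.lapMatrix ℤ) with hS
  set T := onePlusPermanent (-H.lapMatrix ℤ) with hT
  obtain ⟨g0, g1, g2⟩ := coeff_onePlusPermanent (-G.lapMatrix ℤ)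
  obtain ⟨h0, h1, h2⟩ := coeff_onePlusPermanent (-H.lapMatrix ℤ)
  rw [← hS] at g0 g1 g2
  rw [← hT] at h0 h1 h2
  have key : X ^ Fintype.card W * S = X ^ Fintype.card V * T := by
    refine eq_of_eval₂_eq fun t ht => ?_
    rw [eval₂_mul, eval₂_mul, hS, hT, eval_onePlusPermanent_lapMatrix G t ht,
      eval_onePlusPermanent_lapMatrix H t ht, h]
    simp
    ring
  -- `S` and `T` have constant coefficient `1`, so the powers of `X` in `key` agree.
  have hcard : Fintype.card V = Fintype.card W := by
    have c1 := congrArg (fun P => P.coeff (Fintype.card W)) key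
    have c2 := congrArg (fun P => P.coeff (Fintype.card V)) key
    simp only [coeff_X_pow_mul'] at c1 c2
    simp [g0, h0] at c1 c2
    rcases lt_trichotomy (Fintype.card V) (Fintype.card W) with hlt | heq | hlt
    · simp [hlt.not_ge] at c2
    · exact heq
    · simp [hlt.not_ge] at c1
  have hST : S = T := by
    rw [hcard] at key
    exact mul_left_cancel₀ (pow_ne_zero _ X_ne_zero) key
  obtain ⟨a1, a2, a3⟩ := lapMatrix_moments G
  obtain ⟨b1, b2, b3⟩ := lapMatrix_moments H
  rw [a1] at g1 g2
  rw [b1] at h1 h2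
  rw [a2, a3] at g2
  rw [b2, b3] at h2
  rw [hST] at g1 g2
  have e1 : ∑ v, (G.degree v : ℤ) = ∑ v, (H.degree v : ℤ) := by linarith
  refine ⟨hcard, e1, ?_⟩
  rw [e1] at g2
  linarith

end Invariants

/-! ### Reduction modulo two -/

section ModTwo

/-- The polynomial `1 + X ^ k` over the field with two elements. -/
noncomputable def binom2 (k : ℕ) : (ZMod 2)[X] := 1 + X ^ k

/-- A square root modulo two of the polynomial of a theta graph, up to the factor `1 + X`. -/
noncomputable def theta2 (a b c : ℕ) : (ZMod 2)[X] :=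
  1 + X ^ (a + 1) + X ^ (b + 1) + X ^ (c + 1) + X ^ (a + b) + X ^ (a + c) + X ^ (b + c)
    + X ^ (a + b + c + 1)

theorem two_eq_zero_poly : (2 : (ZMod 2)[X]) = 0 := CharTwo.two_eq_zero

theorem neg_one_pow_poly (k : ℕ) : (-1 : (ZMod 2)[X]) ^ k = 1 := by
  rw [CharTwo.neg_eq, one_pow]

theorem cycleVal_mod_two (k : ℕ) : cycleVal (X : (ZMod 2)[X]) k = binom2 k ^ 2 := by
  have h2 := two_eq_zero_poly
  rw [cycleVal, neg_one_pow_poly, binom2, pow_mul']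
  ring

theorem dumbbellVal_mod_two {p q : ℕ} (r : ℕ) (hp : 1 ≤ p) (hq : 1 ≤ q) :
    dumbbellVal (X : (ZMod 2)[X]) p q r =
      ((1 + X) * (binom2 p * binom2 q * binom2 r)) ^ 2 := by
  have h2 := two_eq_zero_poly
  have key : ∀ k, 1 ≤ k → loopVal (X : (ZMod 2)[X]) k = (1 + X) * binom2 k ^ 2 ∧
      loopVal' (X : (ZMod 2)[X]) k = (1 + X) * binom2 k ^ 2 := by
    intro k hk
    obtain ⟨k, rfl⟩ := Nat.exists_eq_add_of_le' hk
    rw [loopVal, loopVal', neg_one_pow_poly, binom2, show k + 1 - 1 = k by omega,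
      show 2 * (k + 1) - 1 = 2 * k + 1 by omega]
    constructor
    · linear_combination (X ^ 2 - X + (1 + X ^ 2) * X ^ (k + 1) - (1 + X) * X ^ (k + 1)) * h2
    · linear_combination (-1 + (1 + X ^ 2) * X ^ k + X ^ (2 * k + 1) - (1 + X) * X ^ (k + 1)) * h2
  rw [dumbbellVal, (key p hp).1, (key p hp).2, (key q hq).1, (key q hq).2, neg_one_pow_poly]
  simp only [binom2]
  linear_combination (-(1 + X) ^ 2 * (1 + X ^ p) ^ 2 * (1 + X ^ q) ^ 2 * X ^ r) * h2

theorem thetaVal_mod_two (a b c : ℕ) :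
    thetaVal (X : (ZMod 2)[X]) a b c = ((1 + X) * theta2 a b c) ^ 2 := by
  rw [mul_pow, theta2]
  simp only [CharTwo.add_sq, thetaVal, neg_one_pow_poly, CharTwo.sub_eq_add, two_eq_zero_poly]
  ring

theorem map_dumbbellVal {R S : Type*} [CommRing R] [CommRing S] (φ : R →+* S) (w : R)
    (p q r : ℕ) : φ (dumbbellVal w p q r) = dumbbellVal (φ w) p q r := by
  simp [dumbbellVal, loopVal, loopVal', map_ofNat]

theorem map_thetaVal {R S : Type*} [CommRing R] [CommRing S] (φ : R →+* S) (w : R)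
    (a b c : ℕ) : φ (thetaVal w a b c) = thetaVal (φ w) a b c := by
  simp [thetaVal, map_ofNat]

theorem map_prod_cycleVal {R S : Type*} [CommRing R] [CommRing S] (φ : R →+* S) (w : R)
    (K : Multiset ℕ) : φ (K.map (cycleVal w)).prod = (K.map (cycleVal (φ w))).prod := by
  rw [map_multiset_prod, Multiset.map_map]
  congr 2
  ext k
  simp [cycleVal, map_ofNat]

theorem prod_cycleVal_mod_two (K : Multiset ℕ) :
    (K.map (cycleVal (X : (ZMod 2)[X]))).prod = (K.map binom2).prod ^ 2 := by
  rw [← Multiset.prod_map_pow]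
  simp only [cycleVal_mod_two]

theorem one_add_X_ne_zero : (1 + X : (ZMod 2)[X]) ≠ 0 := by
  intro h
  simpa using congrArg (fun P => P.coeff 0) h

theorem eq_of_sq_eq_sq {P Q : (ZMod 2)[X]} (h : ((1 + X) * P) ^ 2 = ((1 + X) * Q) ^ 2) :
    P = Q := by
  have h1 : (1 + X) * P = (1 + X) * Q := by
    rcases sq_eq_sq_iff_eq_or_eq_neg.mp h with h | h
    · exact h
    · rwa [CharTwo.neg_eq] at h
  exact mul_left_cancel₀ one_add_X_ne_zero h1

theorem dumbbell_mod_two {p q r p' q' r' : ℕ} {K : Multiset ℕ} (hp : 1 ≤ p) (hq : 1 ≤ q)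
    (hp' : 1 ≤ p') (hq' : 1 ≤ q')
    (h : dumbbellVal (X : ℤ[X]) p q r =
      dumbbellVal X p' q' r' * (K.map (cycleVal X)).prod) :
    binom2 p * binom2 q * binom2 r = binom2 p' * binom2 q' * binom2 r' * (K.map binom2).prod := by
  have h' := congrArg (mapRingHom (Int.castRingHom (ZMod 2))) h
  rw [map_mul, map_dumbbellVal, map_dumbbellVal, map_prod_cycleVal, coe_mapRingHom, map_X,
    dumbbellVal_mod_two _ hp hq, dumbbellVal_mod_two _ hp' hq', prod_cycleVal_mod_two,
    ← mul_pow] at h'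
  apply eq_of_sq_eq_sq
  rw [h']
  ring

theorem theta_mod_two {p q r a b c : ℕ} {K : Multiset ℕ} (hp : 1 ≤ p) (hq : 1 ≤ q)
    (h : dumbbellVal (X : ℤ[X]) p q r = thetaVal X a b c * (K.map (cycleVal X)).prod) :
    binom2 p * binom2 q * binom2 r = theta2 a b c * (K.map binom2).prod := by
  have h' := congrArg (mapRingHom (Int.castRingHom (ZMod 2))) h
  rw [map_mul, map_dumbbellVal, map_thetaVal, map_prod_cycleVal, coe_mapRingHom, map_X,
    dumbbellVal_mod_two _ hp hq, thetaVal_mod_two, prod_cycleVal_mod_two, ← mul_pow] at h'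
  apply eq_of_sq_eq_sq
  rw [h']
  ring

theorem binom2_ne_zero {k : ℕ} (hk : 1 ≤ k) : binom2 k ≠ 0 := by
  intro h
  have := congrArg (fun P => P.coeff 0) h
  simp [binom2, coeff_X_pow, show ¬ 0 = k by omega] at this

theorem dvd_mul_sub_one {R : Type*} [CommRing R] {d a b : R} (ha : d ∣ a - 1) (hb : d ∣ b - 1) :
    d ∣ a * b - 1 := by
  have : a * b - 1 = a * (b - 1) + (a - 1) := by ring
  rw [this]
  exact dvd_add (Dvd.dvd.mul_left hb a) ha

theorem dvd_binom2_sub_one {ν k : ℕ} (h : ν ≤ k) : (X : (ZMod 2)[X]) ^ ν ∣ binom2 k - 1 := by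
  rw [binom2, add_sub_cancel_left]
  exact pow_dvd_pow _ h

theorem dvd_prod_binom2_sub_one {ν : ℕ} {K : Multiset ℕ} (h : ∀ k ∈ K, ν ≤ k) :
    (X : (ZMod 2)[X]) ^ ν ∣ (K.map binom2).prod - 1 := by
  induction K using Multiset.induction_on with
  | empty => simp
  | cons k K ih =>
    rw [Multiset.map_cons, Multiset.prod_cons]
    exact dvd_mul_sub_one (dvd_binom2_sub_one (h k (by simp)))
      (ih fun j hj => h j (by simp [hj]))

theorem coeff_eq_of_dvd_sub {R : Type*} [CommRing R] {ν i : ℕ} {P Q : R[X]} (h : X ^ ν ∣ P - Q)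
    (hi : i < ν) : P.coeff i = Q.coeff i := by
  obtain ⟨Z, hZ⟩ := h
  have := congrArg (fun P => P.coeff i) hZ
  simp only [coeff_sub, coeff_X_pow_mul', if_neg hi.not_ge] at this
  exact sub_eq_zero.mp this

/-- Two factors `1 + X ^ r`, `1 + X ^ r'` of products which otherwise agree with `1` modulo `X ^ ν`
must coincide, unless they are also invisible modulo `X ^ ν`. -/
theorem eq_or_le_of_binom2_mul_eq {r r' ν : ℕ} (hr : 1 ≤ r) (hr' : 1 ≤ r') {U V : (ZMod 2)[X]}
    (hU : X ^ ν ∣ U - 1) (hV : X ^ ν ∣ V - 1) (h : binom2 r * U = binom2 r' * V) :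
    r = r' ∨ ν ≤ r ∧ ν ≤ r' := by
  have key : X ^ ν ∣ binom2 r - binom2 r' := by
    have : binom2 r - binom2 r' = binom2 r' * (V - 1) - binom2 r * (U - 1) := by
      linear_combination h
    rw [this]
    exact dvd_sub (Dvd.dvd.mul_left hV _) (Dvd.dvd.mul_left hU _)
  by_contra! hcon
  have hmin : min r r' < ν := by
    rcases le_or_gt ν r with h1 | h1
    · exact lt_of_le_of_lt (min_le_right _ _) (hcon.2 h1)
    · exact lt_of_le_of_lt (min_le_left _ _) h1
  have hc := coeff_eq_of_dvd_sub key hmin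
  simp only [binom2, coeff_add, coeff_one, coeff_X_pow] at hc
  rcases lt_or_gt_of_ne hcon.1 with h1 | h1
  · rw [min_eq_left h1.le] at hc
    simp [show r ≠ 0 by omega, hcon.1] at hc
  · rw [min_eq_right h1.le] at hc
    simp [show r' ≠ 0 by omega, Ne.symm hcon.1] at hc

end ModTwo

/-! ### Expansions in the girth -/

section Expansions

/-- The sum of `X ^ (k - μ)` over the lengths `k` in `K`: the number of cycles of each length,
counted from `μ` on. -/
noncomputable def lengthPoly (μ : ℕ) (K : Multiset ℕ) : ℤ[X] := (K.map fun k => X ^ (k - μ)).sum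

theorem coeff_lengthPoly {μ : ℕ} {K : Multiset ℕ} (hK : ∀ k ∈ K, μ ≤ k) (i : ℕ) :
    (lengthPoly μ K).coeff i = K.count (μ + i) := by
  induction K using Multiset.induction_on with
  | empty => simp [lengthPoly]
  | cons k K ih =>
    have hk := hK k (by simp)
    have ih := ih fun j hj => hK j (by simp [hj])
    rw [lengthPoly] at ih ⊢
    rw [Multiset.map_cons, Multiset.sum_cons, coeff_add, ih, coeff_X_pow, Multiset.count_cons]
    by_cases h : μ + i = k
    · subst h
      simp [add_comm]
    · simp [h, show ¬ i = k - μ by omega]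

/-- Up to second order in `X ^ μ`, the product over isolated cycles of length at least `μ`. -/
theorem prod_cycleVal_expand {μ : ℕ} (hμ : 1 ≤ μ) {K : Multiset ℕ} (hK : ∀ k ∈ K, μ ≤ k) :
    ∃ ρ : ℤ[X], (K.map (cycleVal X)).prod = 1 + 2 * X ^ μ * lengthPoly μ K + X ^ (2 * μ) * ρ ∧
      ρ.coeff 0 = (-1) ^ μ * K.count μ + 2 * (K.count μ : ℤ) * (K.count μ - 1) := by
  induction K using Multiset.induction_on with
  | empty => exact ⟨0, by simp [lengthPoly], by simp⟩
  | cons k K ih =>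
    have hk := hK k (by simp)
    have hK' : ∀ j ∈ K, μ ≤ j := fun j hj => hK j (by simp [hj])
    obtain ⟨ρ, h1, h2⟩ := ih hK'
    have hκ := coeff_lengthPoly hK' 0
    obtain ⟨d, rfl⟩ := Nat.exists_eq_add_of_le hk
    set κ := lengthPoly μ K with hκ'
    have hl : lengthPoly μ ((μ + d) ::ₘ K) = X ^ d + κ := by
      simp [hκ', lengthPoly]
    refine ⟨ρ + (-1) ^ (μ + d) * X ^ (2 * d) + 4 * X ^ d * κ + X ^ μ * (2 * X ^ d * ρ +
      2 * (-1) ^ (μ + d) * X ^ (2 * d) * κ + (-1) ^ (μ + d) * X ^ μ * X ^ (2 * d) * ρ), ?_, ?_⟩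
    · rw [Multiset.map_cons, Multiset.prod_cons, h1, hl, cycleVal]
      ring
    · have hs : ((-1 : ℤ[X]) ^ (μ + d)).coeff 0 = (-1) ^ (μ + d) := by
        rw [coeff_zero_eq_eval_zero]
        simp
      simp only [coeff_add, mul_coeff_zero, h2, hκ, hs, coeff_X_pow, coeff_ofNat_zero, add_zero]
      rcases Nat.eq_zero_or_pos d with rfl | hd
      · simp [show ¬ 0 = μ by omega]
        ring
      · simp [show ¬ 0 = μ by omega, show ¬ 0 = d by omega, show ¬ d = 0 by omega]

theorem coeff_zero_neg_one_pow (k : ℕ) : ((-1 : ℤ[X]) ^ k).coeff 0 = (-1) ^ k := by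
  rw [coeff_zero_eq_eval_zero]
  simp

/-- Up to second order in `X ^ μ`, the polynomial of a dumbbell whose cycles have length at least
`μ`. The constant coefficient of the second order term matters only for `μ = 3`. -/
theorem dumbbellVal_expand {μ p q r : ℕ} (hμ : 1 ≤ μ) (hp : μ ≤ p) (hq : μ ≤ q) (hr : 2 ≤ r) :
    ∃ Q : ℤ[X], dumbbellVal X p q r = (1 - X + 2 * X ^ 2) ^ 2
        + X ^ μ * (2 * ((1 - X + 2 * X ^ 2) * (1 + X ^ 2) * (X ^ (p - μ) + X ^ (q - μ))))
        + (-1) ^ r * X ^ (2 * r) * (1 - X) ^ 2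
        + X ^ (μ + 3) * (2 * (-((-1) ^ r * X ^ (2 * r - 4) * (1 - X) * (1 + X ^ 2) *
          (X ^ (p - μ) + X ^ (q - μ)))))
        + X ^ (2 * μ) * Q ∧
      Q.coeff 0 = 4 * (if p = μ then 1 else 0) * (if q = μ then 1 else 0)
        + (-1) ^ μ * ((if p = μ then 1 else 0) + (if q = μ then 1 else 0)) := by
  obtain ⟨μ, rfl⟩ := Nat.exists_eq_add_of_le' hμ
  obtain ⟨p, rfl⟩ := Nat.exists_eq_add_of_le hp
  obtain ⟨q, rfl⟩ := Nat.exists_eq_add_of_le hq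
  obtain ⟨r, rfl⟩ := Nat.exists_eq_add_of_le' hr
  refine ⟨4 * (1 + X ^ 2) ^ 2 * X ^ p * X ^ q
    + (1 - X + 2 * X ^ 2) * (1 + X) * ((-1) ^ (μ + 1 + p) * X ^ (2 * p)
      + (-1) ^ (μ + 1 + q) * X ^ (2 * q))
    + X ^ (μ + 1) * (2 * (1 + X ^ 2) * (1 + X) * ((-1) ^ (μ + 1 + q) * X ^ p * X ^ (2 * q)
      + (-1) ^ (μ + 1 + p) * X ^ q * X ^ (2 * p)))
    + X ^ (2 * (μ + 1)) * ((1 + X) ^ 2 * ((-1) ^ (μ + 1 + p) * (-1) ^ (μ + 1 + q)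
      * X ^ (2 * p) * X ^ (2 * q)))
    + X ^ 2 * ((-1) ^ r * X ^ (2 * r) * (4 * (1 + X ^ 2) ^ 2 * X ^ p * X ^ q
      - X * (1 - X) * (2 + X + X ^ 2) * ((-1) ^ (μ + 1 + p) * X ^ (2 * p)
        + (-1) ^ (μ + 1 + q) * X ^ (2 * q))
      + X ^ (μ + 1) * (2 * (1 + X ^ 2) * (2 + X + X ^ 2) * ((-1) ^ (μ + 1 + q) * X ^ p * X ^ (2 * q)
        + (-1) ^ (μ + 1 + p) * X ^ q * X ^ (2 * p)))
      + X ^ (2 * (μ + 1)) * ((2 + X + X ^ 2) ^ 2 * ((-1) ^ (μ + 1 + p) * (-1) ^ (μ + 1 + q)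
        * X ^ (2 * p) * X ^ (2 * q))))), ?_, ?_⟩
  · simp only [dumbbellVal, loopVal, loopVal', show μ + 1 + p - 1 = μ + p by omega,
      show μ + 1 + q - 1 = μ + q by omega, show 2 * (μ + 1 + p) - 1 = 2 * μ + 2 * p + 1 by omega,
      show 2 * (μ + 1 + q) - 1 = 2 * μ + 2 * q + 1 by omega, show 2 * (r + 2) - 4 = 2 * r by omega,
      show μ + 1 + p - (μ + 1) = p by omega, show μ + 1 + q - (μ + 1) = q by omega]
    ring
  · simp only [coeff_add, mul_coeff_zero, coeff_X_pow, coeff_ofNat_zero, coeff_zero_neg_one_pow,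
      coeff_sub, coeff_one_zero, coeff_X_zero]
    rcases Nat.eq_zero_or_pos p with rfl | hp <;> rcases Nat.eq_zero_or_pos q with rfl | hq
    · simp [coeff_zero_eq_eval_zero]
      ring
    · simp [hq.ne, hq.ne']
    · simp [hp.ne, hp.ne']
    · simp [hp.ne, hp.ne', hq.ne, hq.ne']

theorem thetaVal_expand {a b c : ℕ} (hab : a ≤ b) (hbc : b ≤ c) :
    ∃ Q : ℤ[X], thetaVal X a b c = (1 - X + 2 * X ^ 2) ^ 2
      + 2 * (1 + X ^ 2) ^ 2 * (X ^ (a + b) + X ^ (a + c) + X ^ (b + c))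
      - X ^ 2 * (1 - X) ^ 2 *
        ((-1) ^ a * X ^ (2 * a) + (-1) ^ b * X ^ (2 * b) + (-1) ^ c * X ^ (2 * c))
      + X ^ (2 * (a + b)) * Q := by
  obtain ⟨j, rfl⟩ := Nat.exists_eq_add_of_le hab
  obtain ⟨k, rfl⟩ := Nat.exists_eq_add_of_le hbc
  refine ⟨(1 + X) ^ 2 * ((-1) ^ a * (-1) ^ (a + j)
      + (-1) ^ (a + j) * (-1) ^ (a + j + k) * X ^ (2 * j) * X ^ (2 * k)
      + (-1) ^ a * (-1) ^ (a + j + k) * X ^ (2 * k))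
    - (2 + X + X ^ 2) ^ 2 * ((-1) ^ a * (-1) ^ (a + j) * (-1) ^ (a + j + k) *
      X ^ (2 * (a + j + k)))
    - 2 * (1 + X ^ 2) ^ 2 * ((-1) ^ (a + j + k) * X ^ (j + 2 * k) + (-1) ^ a * X ^ k
      + (-1) ^ (a + j) * X ^ (j + k)), ?_⟩
  rw [thetaVal]
  ring

end Expansions

/-! ### Comparison of the lowest coefficients -/

section Comparison

theorem coeff_cubic_mul (T : ℤ[X]) :
    let P := (1 - X + 2 * X ^ 2) * (1 + X ^ 2) * T
    P.coeff 0 = T.coeff 0 ∧ P.coeff 1 = T.coeff 1 - T.coeff 0 ∧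
      P.coeff 2 = T.coeff 2 - T.coeff 1 + 3 * T.coeff 0 ∧
      P.coeff 3 = T.coeff 3 - T.coeff 2 + 3 * T.coeff 1 - T.coeff 0 := by
  intro P
  have : P = T - X ^ 1 * T + 3 * (X ^ 2 * T) - X ^ 3 * T + 2 * (X ^ 4 * T) := by
    simp only [P]
    ring
  rw [this]
  simp only [coeff_add, coeff_sub, coeff_ofNat_mul, coeff_X_pow_mul']
  norm_num

theorem coeff_square_mul (T : ℤ[X]) :
    let P := (1 - X + 2 * X ^ 2) ^ 2 * T
    P.coeff 0 = T.coeff 0 ∧ P.coeff 1 = T.coeff 1 - 2 * T.coeff 0 ∧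
      P.coeff 2 = T.coeff 2 - 2 * T.coeff 1 + 5 * T.coeff 0 ∧
      P.coeff 3 = T.coeff 3 - 2 * T.coeff 2 + 5 * T.coeff 1 - 4 * T.coeff 0 := by
  intro P
  have : P = T - 2 * (X ^ 1 * T) + 5 * (X ^ 2 * T) - 4 * (X ^ 3 * T) + 4 * (X ^ 4 * T) := by
    simp only [P]
    ring
  rw [this]
  simp only [coeff_add, coeff_sub, coeff_ofNat_mul, coeff_X_pow_mul']
  norm_num

theorem coeff_even_mul (T : ℤ[X]) :
    let P := (1 + X ^ 2) ^ 2 * T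
    P.coeff 0 = T.coeff 0 ∧ P.coeff 1 = T.coeff 1 ∧ P.coeff 2 = T.coeff 2 + 2 * T.coeff 0 ∧
      P.coeff 3 = T.coeff 3 + 2 * T.coeff 1 := by
  intro P
  have : P = T + 2 * (X ^ 2 * T) + X ^ 4 * T := by
    simp only [P]
    ring
  rw [this]
  simp only [coeff_add, coeff_ofNat_mul, coeff_X_pow_mul']
  norm_num

theorem coeff_eq_zero_of_dvd {R : Type*} [CommRing R] {ν i : ℕ} {P : R[X]} (h : X ^ ν ∣ P)
    (hi : i < ν) : P.coeff i = 0 := by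
  rw [← sub_zero P] at h
  simpa using coeff_eq_of_dvd_sub h hi

/-- Comparison of a dumbbell with a graph whose polynomial `H` has the shape common to dumbbells
and theta graphs, together with isolated cycles of lengths `K`. All cycles have length at least `μ`,
and the equation is divided by `X ^ μ`: the term `h` counts the cycles of `H`, and `E` is the
difference of the contributions of the paths between the two vertices of degree three. The terms
`D` and `W` are the products of path and cycle contributions; they occur three orders above the
girth. The terms of order `2 * μ` vanish at order four if their constant coefficients cancel, which
matters only for `μ = 3`. -/
theorem dumbbell_compare {μ p q r : ℕ} {K : Multiset ℕ} (hμ : 3 ≤ μ) (hp : μ ≤ p) (hq : μ ≤ q)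
    (hr : 2 ≤ r) (hK : ∀ k ∈ K, μ ≤ k) {H h P W Q E : ℤ[X]} (hP : X ^ 4 ∣ P)
    (hH : H = (1 - X + 2 * X ^ 2) ^ 2 + X ^ μ * (2 * h) + P + X ^ (μ + 3) * (2 * W)
      + X ^ (2 * μ) * Q)
    (hE : (-1) ^ r * X ^ (2 * r) * (1 - X) ^ 2 - P = X ^ μ * E)
    (heq : dumbbellVal X p q r = H * (K.map (cycleVal X)).prod) :
    ∃ D : ℤ[X], D.coeff 0 =
        -(if r = 2 then (if p = μ then 1 else 0) + (if q = μ then 1 else 0) else 0) ∧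
      X ^ 3 ∣ 2 * ((1 - X + 2 * X ^ 2) * (1 + X ^ 2) * (X ^ (p - μ) + X ^ (q - μ)) - h
        - (1 - X + 2 * X ^ 2) ^ 2 * lengthPoly μ K) + E + X ^ 3 * (2 * (D - W)) ∧
      (4 * (if p = μ then 1 else 0) * (if q = μ then 1 else 0)
        + (-1) ^ μ * ((if p = μ then 1 else 0) + (if q = μ then 1 else 0)) - Q.coeff 0
        - ((-1) ^ μ * K.count μ + 2 * (K.count μ : ℤ) * (K.count μ - 1))
        - 4 * h.coeff 0 * K.count μ = 0 →
      X ^ 4 ∣ 2 * ((1 - X + 2 * X ^ 2) * (1 + X ^ 2) * (X ^ (p - μ) + X ^ (q - μ)) - h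
        - (1 - X + 2 * X ^ 2) ^ 2 * lengthPoly μ K) + E + X ^ 3 * (2 * (D - W))) := by
  obtain ⟨ρ, hC, hρ⟩ := prod_cycleVal_expand (by omega : 1 ≤ μ) hK
  obtain ⟨Qd, hd, hQd⟩ := dumbbellVal_expand (by omega : 1 ≤ μ) hp hq hr
  have hκ := coeff_lengthPoly hK 0
  rw [add_zero] at hκ
  obtain ⟨P', rfl⟩ := hP
  set κ := lengthPoly μ K
  set T : ℤ[X] := X ^ (p - μ) + X ^ (q - μ) with hT
  have hT0 : T.coeff 0 = (if p = μ then 1 else 0) + (if q = μ then 1 else 0) := by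
    simp only [hT, coeff_add, coeff_X_pow, show (0 = p - μ) = (p = μ) by
      apply propext; omega, show (0 = q - μ) = (q = μ) by apply propext; omega]
  set D : ℤ[X] := -((-1) ^ r * X ^ (2 * r - 4) * (1 - X) * (1 + X ^ 2) * T) with hD
  set s : ℤ[X] := 1 - X + 2 * X ^ 2 with hs
  set F := 2 * (s * (1 + X ^ 2) * T - h - s ^ 2 * κ) + E + X ^ 3 * (2 * (D - W)) with hF
  have hs0 : s.coeff 0 = 1 := by simp [hs, coeff_zero_eq_eval_zero]
  set Q' := Qd - Q - 4 * h * κ - s ^ 2 * ρ - X * (4 * X ^ 2 * W * κ + X ^ 3 * P' * ρ +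
    2 * X ^ (μ + 2) * W * ρ) - X ^ μ * (2 * κ * Q + 2 * h * ρ + X ^ μ * Q * ρ) with hQ'
  have key : X ^ μ * (F + X ^ μ * Q' - X ^ 4 * (2 * κ * P')) = 0 := by
    rw [hd, hH, hC] at heq
    rw [hF, hQ']
    linear_combination heq - hE
  have hF' : F = X ^ 4 * (2 * κ * P') - X ^ μ * Q' := by
    have := (mul_eq_zero.mp key).resolve_left (pow_ne_zero _ X_ne_zero)
    linear_combination this
  refine ⟨D, ?_, ?_, ?_⟩
  · rw [← hT0, hD]
    simp only [coeff_neg, mul_coeff_zero, coeff_zero_neg_one_pow, coeff_X_pow]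
    split_ifs with h1 h2 h2
    · subst h2
      simp [coeff_zero_eq_eval_zero]
    · omega
    · omega
    · simp
  · change X ^ 3 ∣ F
    rw [hF']
    exact dvd_sub (Dvd.dvd.mul_right (pow_dvd_pow _ (by norm_num)) _)
      (Dvd.dvd.mul_right (pow_dvd_pow _ hμ) _)
  · intro h0
    have h1 : Q'.coeff 0 = 0 := by
      rw [hQ']
      simp only [coeff_sub, mul_coeff_zero, coeff_X_zero, coeff_X_pow, hQd, hρ, hκ,
        show ¬ 0 = μ by omega, if_false, zero_mul, sub_zero, coeff_ofNat_zero, pow_two, hs0]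
      linear_combination h0
    obtain ⟨Q'', hQ''⟩ := X_dvd_iff.mpr h1
    change X ^ 4 ∣ F
    rw [hF', hQ'']
    refine dvd_sub (Dvd.intro _ rfl) ?_
    rw [← mul_assoc, ← pow_succ]
    exact Dvd.dvd.mul_right (pow_dvd_pow _ (by omega)) _

/-- The lowest coefficients of the difference in `dumbbell_compare`. -/
theorem coeff_compare (T h κ E G : ℤ[X]) :
    let F := 2 * ((1 - X + 2 * X ^ 2) * (1 + X ^ 2) * T - h - (1 - X + 2 * X ^ 2) ^ 2 * κ) + E
      + X ^ 3 * (2 * G)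
    F.coeff 0 = 2 * (T.coeff 0 - h.coeff 0 - κ.coeff 0) + E.coeff 0 ∧
      F.coeff 1 = 2 * (T.coeff 1 - T.coeff 0 - h.coeff 1 - κ.coeff 1 + 2 * κ.coeff 0)
        + E.coeff 1 ∧
      F.coeff 2 = 2 * (T.coeff 2 - T.coeff 1 + 3 * T.coeff 0 - h.coeff 2 - κ.coeff 2
        + 2 * κ.coeff 1 - 5 * κ.coeff 0) + E.coeff 2 ∧
      F.coeff 3 = 2 * (T.coeff 3 - T.coeff 2 + 3 * T.coeff 1 - T.coeff 0 - h.coeff 3 - κ.coeff 3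
        + 2 * κ.coeff 2 - 5 * κ.coeff 1 + 4 * κ.coeff 0) + E.coeff 3 + 2 * G.coeff 0 := by
  intro F
  obtain ⟨t0, t1, t2, t3⟩ := coeff_cubic_mul T
  obtain ⟨k0, k1, k2, k3⟩ := coeff_square_mul κ
  simp only [F, coeff_add, coeff_sub, coeff_ofNat_mul, coeff_X_pow_mul', t0, t1, t2, t3, k0, k1,
    k2, k3]
  norm_num
  refine ⟨?_, ?_, ?_⟩ <;> ring

theorem coeff_loops {μ p q : ℕ} (hp : μ ≤ p) (hq : μ ≤ q) (i : ℕ) :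
    (X ^ (p - μ) + X ^ (q - μ) : ℤ[X]).coeff i =
      (if p = μ + i then 1 else 0) + (if q = μ + i then 1 else 0) := by
  simp only [coeff_add, coeff_X_pow, show (i = p - μ) = (p = μ + i) by
    apply propext; omega, show (i = q - μ) = (q = μ + i) by apply propext; omega]

/-- The contributions of two paths are equal or divisible by a high power of `X`. -/
theorem path_difference {μ ν r r' : ℕ} (hμν : μ ≤ ν) (h : r = r' ∨ ν ≤ r ∧ ν ≤ r') :
    ∃ E : ℤ[X], (-1) ^ r * X ^ (2 * r) * (1 - X) ^ 2 - (-1) ^ r' * X ^ (2 * r') * (1 - X) ^ 2 =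
      X ^ μ * E ∧ X ^ (2 * ν - μ) ∣ E := by
  rcases h with rfl | ⟨h1, h2⟩
  · exact ⟨0, by ring, dvd_zero _⟩
  · obtain ⟨a, rfl⟩ := Nat.exists_eq_add_of_le h1
    obtain ⟨b, rfl⟩ := Nat.exists_eq_add_of_le h2
    refine ⟨X ^ (2 * ν - μ) * (((-1) ^ (ν + a) * X ^ (2 * a) - (-1) ^ (ν + b) * X ^ (2 * b)) *
      (1 - X) ^ 2), ?_, Dvd.intro _ rfl⟩
    rw [← mul_assoc, ← pow_add, show μ + (2 * ν - μ) = 2 * ν by omega]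
    ring

theorem exists_min_of_ne_zero (S : Multiset ℕ) (hS : S ≠ 0) : ∃ μ ∈ S, ∀ k ∈ S, μ ≤ k := by
  obtain ⟨μ, h1, h2⟩ := Finset.exists_min_image S.toFinset id
    (by simpa [Finset.nonempty_iff_ne_empty] using hS)
  exact ⟨μ, by simpa using h1, fun k hk => h2 k (by simpa using hk)⟩

end Comparison

/-! ### Dumbbells -/

section Dumbbells

/-- The loops of length `μ` of a dumbbell are not matched by isolated cycles if all other cycles
are longer: the contributions of loops and of isolated cycles are told apart by the coefficients of
orders up to `μ + 3`. -/
theorem dumbbell_shortest_loops_ne_cycles {μ q r p' q' r' : ℕ} {K : Multiset ℕ} (hμ : 3 ≤ μ)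
    (hq : μ ≤ q) (hr : 2 ≤ r) (hp' : μ < p') (hq' : μ < q') (hr' : 2 ≤ r') (hK : ∀ k ∈ K, μ ≤ k)
    (hc : K.count μ = 1 + if q = μ then 1 else 0)
    (hpath : r = r' ∨ μ + 1 ≤ r ∧ μ + 1 ≤ r')
    (h : dumbbellVal (X : ℤ[X]) μ q r = dumbbellVal X p' q' r' * (K.map (cycleVal X)).prod) :
    False := by
  obtain ⟨Q', hd', hQ'⟩ := dumbbellVal_expand (by omega : 1 ≤ μ) hp'.le hq'.le hr'
  obtain ⟨E, hE, hEd⟩ := path_difference (by omega : μ ≤ μ + 1) hpath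
  obtain ⟨D, hD, -, h4⟩ := dumbbell_compare hμ le_rfl hq hr hK
    (P := (-1) ^ r' * X ^ (2 * r') * (1 - X) ^ 2)
    (by
      rw [mul_assoc]
      exact Dvd.dvd.mul_left (Dvd.dvd.mul_right (pow_dvd_pow _ (by omega)) _) _) hd' hE h
  have hE4 : X ^ 4 ∣ E := dvd_trans (pow_dvd_pow _ (by omega)) hEd
  obtain ⟨a0, a1, a2, a3⟩ := coeff_cubic_mul (X ^ (p' - μ) + X ^ (q' - μ))
  have h4 := h4 (by
    rw [hQ', a0, coeff_loops hp'.le hq'.le, hc]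
    simp only [add_zero, hp'.ne', hq'.ne', if_false, if_true]
    split_ifs <;> push_cast <;> ring)
  obtain ⟨c0, c1, c2, c3⟩ := coeff_compare (X ^ (μ - μ) + X ^ (q - μ))
    ((1 - X + 2 * X ^ 2) * (1 + X ^ 2) * (X ^ (p' - μ) + X ^ (q' - μ))) (lengthPoly μ K) E
    (D - -((-1) ^ r' * X ^ (2 * r' - 4) * (1 - X) * (1 + X ^ 2) * (X ^ (p' - μ) + X ^ (q' - μ))))
  have hW : (-((-1) ^ r' * X ^ (2 * r' - 4) * (1 - X) * (1 + X ^ 2) *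
      (X ^ (p' - μ) + X ^ (q' - μ))) : ℤ[X]).coeff 0 = 0 := by
    rw [coeff_neg, mul_coeff_zero _ (X ^ (p' - μ) + X ^ (q' - μ) : ℤ[X]), coeff_loops hp'.le hq'.le]
    simp [hp'.ne', hq'.ne']
  rw [coeff_eq_zero_of_dvd h4 (by norm_num)] at c0 c1 c2 c3
  rw [coeff_sub, hW, hD] at c3
  rw [a1] at c1
  rw [a2] at c2
  rw [a3] at c3
  have e0 := coeff_eq_zero_of_dvd hE4 (show 0 < 4 by norm_num)
  have e1 := coeff_eq_zero_of_dvd hE4 (show 1 < 4 by norm_num)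
  have e2 := coeff_eq_zero_of_dvd hE4 (show 2 < 4 by norm_num)
  have e3 := coeff_eq_zero_of_dvd hE4 (show 3 < 4 by norm_num)
  simp only [coeff_loops le_rfl hq, coeff_loops hp'.le hq'.le, coeff_lengthPoly hK, e0, e1, e2, e3,
    add_zero, hc, hp'.ne', hq'.ne', if_true, if_false, left_eq_add, one_ne_zero,
    OfNat.ofNat_ne_zero, zero_add, sub_zero] at c0 c1 c2 c3
  push_cast at c1 c2 c3
  have hq23 : (if q = μ + 2 then (1 : ℤ) else 0) + (if q = μ + 3 then 1 else 0) ≤ 1 := by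
    split_ifs <;> omega
  have hq0 : (0 : ℤ) ≤ if q = μ then 1 else 0 := by positivity
  have hp2 : (0 : ℤ) ≤ if p' = μ + 2 then 1 else 0 := by positivity
  have hp3 : (0 : ℤ) ≤ if p' = μ + 3 then 1 else 0 := by positivity
  have hq2 : (0 : ℤ) ≤ if q' = μ + 2 then 1 else 0 := by positivity
  have hq3 : (0 : ℤ) ≤ if q' = μ + 3 then 1 else 0 := by positivity
  have hr2 : (0 : ℤ) ≤ if r = 2 then 1 + (if q = μ then 1 else 0) else 0 := by positivity
  -- Let `T i = [q = μ + i] - [p' = μ + i] - [q' = μ + i]`, and let `κ i` be the number of isolated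
  -- cycles of length `μ + i`. Half of the combination `c3 + 2 * c2 - c1` of the equations is
  -- `T 3 + T 2 - 2 * κ 0 - κ 3 + D.coeff 0 = 0`, where `T 3 + T 2` is at most `1`, `κ 0` is
  -- positive and `D.coeff 0` is at most `0`.
  linarith

/-- Dumbbells with the same loops do not differ by isolated cycles. The cycles, of shortest length
`ν`, change the coefficient of `X ^ ν` by an even positive number, while the shorter path `r'`
changes that of `X ^ (2 * r')` by `1` or `-1`; neither can vanish or be cancelled by the other. -/
theorem no_cycles_of_loops_eq {p q r r' : ℕ} {K : Multiset ℕ} (hp : 3 ≤ p) (hq : 3 ≤ q)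
    (hK : ∀ k ∈ K, 3 ≤ k) (hsum : r = r' + K.sum) (hr' : 1 ≤ r')
    (h : dumbbellVal (X : ℤ[X]) p q r = dumbbellVal X p q r' * (K.map (cycleVal X)).prod) :
    K = 0 := by
  by_contra hK0
  obtain ⟨ν, hν, hmin⟩ := exists_min_of_ne_zero K hK0
  have hν3 := hK ν hν
  have hsumν : ν ≤ K.sum := Multiset.single_le_sum (fun _ _ => Nat.zero_le _) ν hν
  obtain ⟨ρ, hC, -⟩ := prod_cycleVal_expand (by omega : 1 ≤ ν) hmin
  have hκ := coeff_lengthPoly hmin 0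
  rw [add_zero] at hκ
  have hpos : 0 < K.count ν := Multiset.count_pos.mpr hν
  set κ := lengthPoly ν K
  have hL : ∀ k, 3 ≤ k → (loopVal (X : ℤ[X]) k).eval 0 = 1 ∧ (loopVal' (X : ℤ[X]) k).eval 0 =
      -1 := by
    intro k hk
    simp [loopVal, loopVal', show k ≠ 0 by omega, show 2 * k - 1 ≠ 0 by omega,
      show k - 1 ≠ 0 by omega]
  rw [coeff_zero_eq_eval_zero] at hκ
  simp only [dumbbellVal, hC] at h
  rcases lt_or_ge ν (2 * r') with hlt | hge
  · obtain ⟨a, ha⟩ := Nat.exists_eq_add_of_lt hlt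
    obtain ⟨b, hb⟩ := Nat.exists_eq_add_of_lt (show ν < 2 * r by omega)
    obtain ⟨c, hc⟩ := Nat.exists_eq_add_of_lt (show 0 < ν by omega)
    rw [ha, hb] at h
    have key : X ^ ν * (-(loopVal (X : ℤ[X]) p * loopVal X q * (2 * κ + X ^ ν * ρ))
        + loopVal' X p * loopVal' X q * ((-1) ^ r * X ^ (b + 1) - (-1) ^ r' * X ^ (a + 1) *
          (1 + 2 * X ^ ν * κ + X ^ (2 * ν) * ρ))) = 0 := by
      linear_combination h
    have := congrArg (eval 0) ((mul_eq_zero.mp key).resolve_left (pow_ne_zero _ X_ne_zero))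
    simp [hL p hp, hL q hq, hκ, show ν ≠ 0 by omega] at this
    exact this hν
  · obtain ⟨a, ha⟩ := Nat.exists_eq_add_of_le hge
    obtain ⟨b, hb⟩ := Nat.exists_eq_add_of_lt (show r' < r by omega)
    rw [show 2 * r = 2 * r' + 2 * (b + 1) by omega, show X ^ ν = (X : ℤ[X]) ^ (2 * r') * X ^ a by
      rw [← pow_add, ← ha], show X ^ (2 * ν) = (X : ℤ[X]) ^ (2 * r') * X ^ (ν + a) by
      rw [← pow_add]; congr 1; omega] at h
    have key : X ^ (2 * r') * (-(loopVal (X : ℤ[X]) p * loopVal X q *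
          (2 * X ^ a * κ + X ^ (ν + a) * ρ))
        + loopVal' X p * loopVal' X q * ((-1) ^ r * X ^ (2 * (b + 1)) - (-1) ^ r' *
          (1 + 2 * (X ^ (2 * r') * X ^ a) * κ + (X ^ (2 * r') * X ^ (ν + a)) * ρ))) = 0 := by
      linear_combination h
    have := congrArg (eval 0) ((mul_eq_zero.mp key).resolve_left (pow_ne_zero _ X_ne_zero))
    simp [hL p hp, hL q hq, hκ, show ν ≠ 0 by omega, show r' ≠ 0 by omega] at this
    rcases neg_one_pow_eq_or ℤ r' with h1 | h1 <;> rw [h1] at this <;>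
      rw [mul_assoc] at this <;> omega

theorem loopVal_coeff_zero {R : Type*} [CommRing R] {k : ℕ} (hk : 1 ≤ k) :
    (loopVal (X : R[X]) k).coeff 0 = 1 := by
  rw [coeff_zero_eq_eval_zero]
  simp [loopVal, show k ≠ 0 by omega]

/-- If both paths have length at least `ν`, a common loop of two dumbbells can be cancelled up to
order `2 * ν`. -/
theorem dvd_loop_difference {p q r q' r' ν : ℕ} {C : ℤ[X]} (hp : 1 ≤ p) (hr : ν ≤ r) (hr' : ν ≤ r')
    (h : dumbbellVal (X : ℤ[X]) p q r = dumbbellVal X p q' r' * C) :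
    X ^ (2 * ν) ∣ loopVal X q - loopVal X q' * C := by
  refine prime_X.pow_dvd_of_dvd_mul_left (a := loopVal X p) _ ?_ ?_
  · rw [X_dvd_iff, loopVal_coeff_zero hp]
    norm_num
  · have : loopVal X p * (loopVal X q - loopVal X q' * C) =
        X ^ (2 * r') * ((-1) ^ r' * (loopVal' X p * loopVal' X q') * C) -
          X ^ (2 * r) * ((-1) ^ r * (loopVal' X p * loopVal' X q)) := by
      rw [dumbbellVal, dumbbellVal] at h
      linear_combination h
    rw [this]
    exact dvd_sub (Dvd.dvd.mul_right (pow_dvd_pow _ (by omega)) _)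
      (Dvd.dvd.mul_right (pow_dvd_pow _ (by omega)) _)

theorem dvd_of_X_pow_mul_dvd {m n : ℕ} {A B : ℤ[X]}
    (h : X ^ (m + n) ∣ X ^ m * A + X ^ (m + n) * B) : X ^ n ∣ A := by
  have h1 : X ^ (m + n) ∣ (X : ℤ[X]) ^ m * A := (dvd_add_left (Dvd.intro _ rfl)).mp h
  rw [pow_add] at h1
  exact (mul_dvd_mul_iff_left (pow_ne_zero _ X_ne_zero)).mp h1

/-- One loop of the shortest length cannot be replaced by a single isolated cycle. -/
theorem loop_ne_cycle {μ q' : ℕ} {K : Multiset ℕ} (hμ : 3 ≤ μ) (hq' : μ < q') (hK : ∀ k ∈ K, μ ≤ k)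
    (hc : K.count μ = 1)
    (h : X ^ (2 * (μ + 1)) ∣ loopVal (X : ℤ[X]) μ - loopVal X q' * (K.map (cycleVal X)).prod) :
    False := by
  obtain ⟨ρ, hC, hρ⟩ := prod_cycleVal_expand (by omega : 1 ≤ μ) hK
  have hκ := fun i => coeff_lengthPoly hK i
  set κ := lengthPoly μ K
  rw [hc] at hρ
  obtain ⟨b, rfl⟩ := Nat.exists_eq_add_of_lt hq'
  obtain ⟨ρ', hρ'⟩ : X ∣ ρ - (-1) ^ μ := by
    rw [X_dvd_iff, coeff_sub, hρ, coeff_zero_neg_one_pow]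
    push_cast
    ring
  obtain rfl : ρ = (-1) ^ μ + X * ρ' := by linear_combination hρ'
  obtain ⟨m, rfl⟩ := Nat.exists_eq_add_of_le' (show 1 ≤ μ by omega)
  have h1 : X ^ (m + 1 + (m + 1 + 1)) ∣ X ^ (m + 1) *
      (2 * ((1 + X ^ 2) * (1 - X ^ (b + 1)) - (1 - X + 2 * X ^ 2) * κ)) +
      X ^ (m + 1 + (m + 1 + 1)) * ((-1) ^ (m + 1) * (2 - 2 * X) - (1 - X + 2 * X ^ 2) * ρ'
        - (-1) ^ (m + 1 + b + 1) * (1 + X) * X ^ (2 * b + 1) * (K.map (cycleVal X)).prod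
        - 2 * (1 + X ^ 2) * X ^ b * (2 * κ + X ^ (m + 1) * ((-1) ^ (m + 1) + X * ρ'))) := by
    refine dvd_trans (pow_dvd_pow _ (by omega)) (dvd_trans h (Eq.dvd ?_))
    rw [hC]
    simp only [loopVal]
    ring
  have h2 := dvd_of_X_pow_mul_dvd h1
  obtain ⟨c0, c1, c2, c3⟩ : 1 - κ.coeff 0 = 0 ∧
      -(if b = 0 then 1 else 0) - (κ.coeff 1 - κ.coeff 0) = 0 ∧
      1 - (if b = 1 then 1 else 0) - (κ.coeff 2 - κ.coeff 1 + 2 * κ.coeff 0) = 0 ∧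
      -(if b = 2 then 1 else 0) - (if b = 0 then 1 else 0) -
        (κ.coeff 3 - κ.coeff 2 + 2 * κ.coeff 1) = 0 := by
    have e : ∀ i < 4, ((1 + X ^ 2) * (1 - X ^ (b + 1)) - (1 - X + 2 * X ^ 2) * κ).coeff i = 0 := by
      intro i hi
      have := coeff_eq_zero_of_dvd h2 (show i < m + 1 + 1 by omega)
      rw [coeff_ofNat_mul] at this
      omega
    have hE : (1 + X ^ 2) * (1 - X ^ (b + 1)) - (1 - X + 2 * X ^ 2) * κ =
        1 + X ^ 2 - X ^ (b + 1) - X ^ (b + 3) - κ + X ^ 1 * κ - 2 * (X ^ 2 * κ) := by ring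
    rw [hE] at e
    have e0 := e 0 (by norm_num)
    have e1 := e 1 (by norm_num)
    have e2 := e 2 (by norm_num)
    have e3 := e 3 (by norm_num)
    simp only [coeff_add, coeff_sub, coeff_ofNat_mul, coeff_X_pow_mul', coeff_X_pow, coeff_one]
      at e0 e1 e2 e3
    norm_num at e0 e1 e2 e3
    simp only [show (2 = b + 1) = (b = 1) by grind, show (3 = b + 1) = (b = 2) by grind] at e2 e3
    refine ⟨e0, ?_, ?_, ?_⟩ <;> linarith
  rw [hκ] at c0 c1 c2 c3
  simp only [hκ] at c1 c2 c3
  -- The numbers `κ i` of cycles of length `μ + i` satisfy `κ 2 = -[b = 0] - [b = 1]`, hence `b ≥ 2`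
  -- and `κ 1 = 1`, and then `κ 3 = -2 - [b = 2]`, which is negative.
  split_ifs at c1 c2 c3 <;> omega

theorem loop_difference_expand {μ q q' : ℕ} {K : Multiset ℕ} (hμ : 1 ≤ μ) (hq : μ ≤ q)
    (hq' : μ ≤ q') (hK : ∀ k ∈ K, μ ≤ k) :
    ∃ Z : ℤ[X], loopVal X q - loopVal X q' * (K.map (cycleVal X)).prod =
      X ^ μ * (2 * ((1 + X ^ 2) * (X ^ (q - μ) - X ^ (q' - μ))
        - (1 - X + 2 * X ^ 2) * lengthPoly μ K)) + X ^ (μ + μ) * Z := by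
  obtain ⟨ρ, hC, -⟩ := prod_cycleVal_expand hμ hK
  obtain ⟨a, rfl⟩ := Nat.exists_eq_add_of_le hq
  obtain ⟨b, rfl⟩ := Nat.exists_eq_add_of_le hq'
  refine ⟨(-1) ^ (μ + a) * (1 + X) * X ^ (2 * a) - (1 - X + 2 * X ^ 2) * ρ -
    2 * (1 + X ^ 2) * X ^ b * (2 * lengthPoly μ K + X ^ μ * ρ) -
    (-1) ^ (μ + b) * (1 + X) * X ^ (2 * b) *
      (1 + 2 * X ^ μ * lengthPoly μ K + X ^ (2 * μ) * ρ), ?_⟩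
  rw [hC, Nat.add_sub_cancel_left, Nat.add_sub_cancel_left]
  simp only [loopVal]
  ring

/-- Up to order `μ` the difference of two loops sees the number of cycles of length `μ`. -/
theorem count_eq_of_dvd_loop_difference {μ q q' : ℕ} {K : Multiset ℕ} (hμ : 1 ≤ μ) (hq : μ ≤ q)
    (hq' : μ ≤ q') (hK : ∀ k ∈ K, μ ≤ k)
    (h : X ^ (μ + 1) ∣ loopVal (X : ℤ[X]) q - loopVal X q' * (K.map (cycleVal X)).prod) :
    (if q = μ then 1 else 0) = (if q' = μ then 1 else 0) + K.count μ := by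
  obtain ⟨Z, hZ⟩ := loop_difference_expand hμ hq hq' hK
  obtain ⟨n, rfl⟩ := Nat.exists_eq_add_of_le' hμ
  have h2 : X ^ (n + 1 + 1) ∣ X ^ (n + 1) * (2 * ((1 + X ^ 2) * (X ^ (q - (n + 1)) -
      X ^ (q' - (n + 1))) - (1 - X + 2 * X ^ 2) * lengthPoly (n + 1) K)) +
      X ^ (n + 1 + 1) * (X ^ n * Z) := by
    rw [hZ] at h
    convert h using 2
    ring
  have h3 := dvd_of_X_pow_mul_dvd h2
  have h4 := coeff_eq_zero_of_dvd h3 zero_lt_one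
  have hκ := coeff_lengthPoly hK 0
  rw [coeff_ofNat_mul, coeff_sub, mul_coeff_zero, mul_coeff_zero, hκ, coeff_sub, coeff_X_pow,
    coeff_X_pow] at h4
  simp only [show (0 = q - (n + 1)) = (q = n + 1) by apply propext; omega,
    show (0 = q' - (n + 1)) = (q' = n + 1) by apply propext; omega] at h4
  simp [coeff_zero_eq_eval_zero] at h4
  rw [← Nat.cast_inj (R := ℤ)]
  push_cast
  linarith

/-- Dumbbells which share one loop, with isolated cycles on one side: all lengths agree. -/
theorem dumbbell_eq_of_loop_eq {p q r q' r' : ℕ} {K : Multiset ℕ} (hp : 3 ≤ p) (hq : 3 ≤ q)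
    (hq' : 3 ≤ q') (hr : 2 ≤ r) (hr' : 2 ≤ r') (hK : ∀ k ∈ K, 3 ≤ k)
    (hsum : q + r = q' + r' + K.sum)
    (h : dumbbellVal (X : ℤ[X]) p q r = dumbbellVal X p q' r' * (K.map (cycleVal X)).prod) :
    q = q' ∧ r = r' ∧ K = 0 := by
  by_cases hqq : q = q'
  · subst hqq
    obtain rfl := no_cycles_of_loops_eq hp hq hK (by omega) (by omega) h
    exact ⟨rfl, by simpa using hsum, rfl⟩
  exfalso
  obtain ⟨μ, hμ, hmin⟩ := exists_min_of_ne_zero (q ::ₘ q' ::ₘ K) (by simp)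
  have hμq : μ ≤ q := hmin q (by simp)
  have hμq' : μ ≤ q' := hmin q' (by simp)
  have hμK : ∀ k ∈ K, μ ≤ k := fun k hk => hmin k (by simp [hk])
  have hμ3 : 3 ≤ μ := by
    simp only [Multiset.mem_cons] at hμ
    rcases hμ with rfl | rfl | hμ
    exacts [hq, hq', hK μ hμ]
  by_cases hrr : r = r'
  -- Equal paths contribute equally up to order `μ`, so cycles of length `μ` are counted by the
  -- loops; but `q` exceeds `q'` by the lengths of the isolated cycles.
  · subst hrr
    obtain ⟨ρ, hC, -⟩ := prod_cycleVal_expand (by omega : 1 ≤ μ) hμK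
    obtain ⟨a, rfl⟩ := Nat.exists_eq_add_of_le hμq
    obtain ⟨b, rfl⟩ := Nat.exists_eq_add_of_le hμq'
    obtain ⟨n, rfl⟩ := Nat.exists_eq_add_of_le' (show 1 ≤ μ by omega)
    obtain ⟨t, rfl⟩ := Nat.exists_eq_add_of_le' hr
    have h1 : X ^ (n + 1 + 1) ∣ loopVal (X : ℤ[X]) (n + 1 + a) -
        loopVal X (n + 1 + b) * (K.map (cycleVal X)).prod := by
      refine prime_X.pow_dvd_of_dvd_mul_left (a := loopVal X p) _ ?_ ?_
      · rw [X_dvd_iff, loopVal_coeff_zero (by omega)]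
        norm_num
      · refine Dvd.intro (-((-1) ^ (t + 2) * X ^ (2 * t + 2) * loopVal' X p *
          (2 * (1 + X ^ 2) * X ^ a + (-1) ^ (n + 1 + a) * (2 + X + X ^ 2) * X ^ (n + 1 + 2 * a) -
          (2 * (1 + X ^ 2) * X ^ b + (-1) ^ (n + 1 + b) * (2 + X + X ^ 2) * X ^ (n + 1 + 2 * b)) *
            (K.map (cycleVal X)).prod +
          (1 - X) * (2 * X * lengthPoly (n + 1) K + X ^ (n + 2) * ρ)))) ?_
        rw [dumbbellVal, dumbbellVal] at h
        simp only [loopVal', show n + 1 + a - 1 = n + a by omega,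
          show n + 1 + b - 1 = n + b by omega,
          show 2 * (n + 1 + a) - 1 = 2 * n + 1 + 2 * a by omega,
          show 2 * (n + 1 + b) - 1 = 2 * n + 1 + 2 * b by omega] at h ⊢
        generalize loopVal (X : ℤ[X]) p = xp at *
        generalize loopVal (X : ℤ[X]) (n + 1 + a) = xa at *
        generalize loopVal (X : ℤ[X]) (n + 1 + b) = xb at *
        generalize ((-(1 - X) + 2 * (1 + X ^ 2) * X ^ (p - 1) + (-1) ^ p * (2 + X + X ^ 2) *
          X ^ (2 * p - 1) : ℤ[X])) = yp at *
        rw [hC] at h ⊢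
        linear_combination -h
    have h2 := count_eq_of_dvd_loop_difference (by omega) hμq hμq' hμK h1
    by_cases hK0 : K = 0
    · subst hK0
      simp at hsum
      omega
    obtain ⟨k, hk⟩ := Multiset.exists_mem_of_ne_zero hK0
    have hks : k ≤ K.sum := Multiset.single_le_sum (fun _ _ => Nat.zero_le _) k hk
    have hk3 := hμK k hk
    rw [if_neg (by omega)] at h2
    have h3 : K.count (n + 1) = 0 := by omega
    rw [Multiset.count_eq_zero] at h3
    simp only [Multiset.mem_cons, h3, or_false] at hμ
    rcases hμ with h4 | h4
    · omega
    · rw [if_pos h4.symm] at h2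
      omega
  -- Different path lengths are at least `μ`, by reduction modulo two.
  · have hmod := dumbbell_mod_two (by omega) (by omega) (by omega) (by omega) h
    have hb := mul_left_cancel₀ (binom2_ne_zero (by omega : 1 ≤ p))
      (show binom2 p * (binom2 r * binom2 q) =
        binom2 p * (binom2 r' * (binom2 q' * (K.map binom2).prod)) by
        linear_combination hmod)
    obtain ⟨hr1, hr2⟩ := (eq_or_le_of_binom2_mul_eq (by omega) (by omega)
      (dvd_binom2_sub_one hμq) (dvd_mul_sub_one (dvd_binom2_sub_one hμq')
        (dvd_prod_binom2_sub_one hμK)) hb).resolve_left hrr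
    have h1 := dvd_loop_difference (by omega) hr1 hr2 h
    have h2 := count_eq_of_dvd_loop_difference (by omega) hμq hμq' hμK
      (dvd_trans (pow_dvd_pow _ (by omega)) h1)
    have hqμ : q = μ := by
      by_contra hne
      rw [if_neg hne] at h2
      simp only [Multiset.mem_cons, Ne.symm hne, false_or] at hμ
      rcases hμ with h3 | h3
      · rw [if_pos h3.symm] at h2
        omega
      · have := Multiset.count_pos.mpr h3
        omega
    subst hqμ
    rw [if_pos rfl, if_neg (Ne.symm hqq), zero_add] at h2
    have hmem : q ∈ K := Multiset.count_pos.mp (by omega)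
    obtain ⟨K', rfl⟩ := Multiset.exists_cons_of_mem hmem
    have hcount : K'.count q = 0 := by
      rw [Multiset.count_cons_self] at h2
      omega
    have hK' : ∀ k ∈ K', q + 1 ≤ k := by
      intro k hk
      have h3 := hμK k (by simp [hk])
      have h4 : k ≠ q := by
        rintro rfl
        exact Multiset.count_eq_zero.mp hcount hk
      omega
    have hb' := mul_left_cancel₀ (binom2_ne_zero (by omega : 1 ≤ q))
      (show binom2 q * (binom2 r * 1) =
        binom2 q * (binom2 r' * (binom2 q' * (K'.map binom2).prod)) by
        rw [Multiset.map_cons, Multiset.prod_cons] at hb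
        linear_combination hb)
    obtain ⟨hr1, hr2⟩ := (eq_or_le_of_binom2_mul_eq (ν := q + 1) (by omega) (by omega)
      (by simp) (dvd_mul_sub_one (dvd_binom2_sub_one (by omega))
        (dvd_prod_binom2_sub_one hK')) hb').resolve_left hrr
    exact loop_ne_cycle hμ3 (by omega) hμK h2.symm (dvd_loop_difference (by omega) hr1 hr2 h)

theorem dumbbellVal_swap {R : Type*} [CommRing R] (w : R) (p q r : ℕ) :
    dumbbellVal w p q r = dumbbellVal w q p r := by
  simp only [dumbbellVal]
  ring

/-- If the polynomial of a dumbbell is the polynomial of a dumbbell together with isolated cycles on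
the same number of vertices, then the dumbbells agree and there are no isolated cycles. -/
theorem dumbbell_unique {p q r p' q' r' : ℕ} {K : Multiset ℕ} (hp : 3 ≤ p) (hq : 3 ≤ q)
    (hr : 2 ≤ r) (hp' : 3 ≤ p') (hq' : 3 ≤ q') (hr' : 2 ≤ r') (hK : ∀ k ∈ K, 3 ≤ k)
    (hsum : p + q + r = p' + q' + r' + K.sum)
    (h : dumbbellVal (X : ℤ[X]) p q r = dumbbellVal X p' q' r' * (K.map (cycleVal X)).prod) :
    (p = p' ∧ q = q' ∨ p = q' ∧ q = p') ∧ r = r' ∧ K = 0 := by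
  wlog hpq : p ≤ q generalizing p q
  · have := this hq hp (by omega) (by rw [dumbbellVal_swap, h]) (by omega)
    tauto
  wlog hpq' : p' ≤ q' generalizing p' q'
  · have := this hq' hp' (by omega) (by rw [h, dumbbellVal_swap]) (by omega)
    tauto
  suffices hpp : p = p' by
    subst hpp
    obtain ⟨h1, h2, h3⟩ := dumbbell_eq_of_loop_eq hp hq hq' hr hr' hK (by omega) h
    exact ⟨Or.inl ⟨rfl, h1⟩, h2, h3⟩
  obtain ⟨μ, hμ, hmin⟩ := exists_min_of_ne_zero (p ::ₘ p' ::ₘ K) (by simp)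
  have hμp : μ ≤ p := hmin p (by simp)
  have hμp' : μ ≤ p' := hmin p' (by simp)
  have hμK : ∀ k ∈ K, μ ≤ k := fun k hk => hmin k (by simp [hk])
  have hμ3 : 3 ≤ μ := by
    simp only [Multiset.mem_cons] at hμ
    rcases hμ with rfl | rfl | hμ
    exacts [hp, hp', hK μ hμ]
  have hmod := dumbbell_mod_two (by omega) (by omega) (by omega) (by omega) h
  have hP : X ^ 4 ∣ ((-1) ^ r' * X ^ (2 * r') * (1 - X) ^ 2 : ℤ[X]) := by
    rw [mul_assoc]
    exact Dvd.dvd.mul_left (Dvd.dvd.mul_right (pow_dvd_pow _ (by omega)) _) _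
  have hcount : (if p = μ then 1 else 0) + (if q = μ then 1 else 0) =
      (if p' = μ then 1 else 0) + (if q' = μ then 1 else 0) + K.count μ := by
    obtain ⟨Q', hd', -⟩ := dumbbellVal_expand (by omega : 1 ≤ μ) hμp' (by omega : μ ≤ q') hr'
    obtain ⟨E, hE, hEd⟩ := path_difference (le_refl μ)
      (eq_or_le_of_binom2_mul_eq (r := r) (r' := r') (by omega) (by omega)
        (dvd_mul_sub_one (dvd_binom2_sub_one hμp) (dvd_binom2_sub_one (by omega : μ ≤ q)))
        (dvd_mul_sub_one (dvd_mul_sub_one (dvd_binom2_sub_one hμp')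
          (dvd_binom2_sub_one (by omega : μ ≤ q'))) (dvd_prod_binom2_sub_one hμK))
        (by linear_combination hmod))
    obtain ⟨D, -, h3, -⟩ := dumbbell_compare hμ3 hμp (by omega : μ ≤ q) hr hμK hP hd' hE h
    have c0 := coeff_eq_zero_of_dvd h3 (show 0 < 3 by norm_num)
    rw [(coeff_compare _ _ _ _ _).1, (coeff_cubic_mul _).1, coeff_loops hμp (by omega),
      coeff_loops hμp' (by omega), coeff_lengthPoly hμK,
      coeff_eq_zero_of_dvd hEd (show 0 < 2 * μ - μ by omega)] at c0
    simp only [add_zero] at c0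
    rw [← Nat.cast_inj (R := ℤ)]
    push_cast
    linarith
  have hpμ : p = μ := by
    by_contra hne
    rw [if_neg hne, if_neg (show q ≠ μ by omega)] at hcount
    simp only [Multiset.mem_cons, Ne.symm hne, false_or] at hμ
    rcases hμ with h3 | h3
    · rw [if_pos h3.symm] at hcount
      omega
    · have := Multiset.count_pos.mpr h3
      omega
  subst hpμ
  by_contra hne
  rw [if_pos rfl, if_neg (Ne.symm hne), if_neg (show q' ≠ p by omega)] at hcount
  -- The loops of length `p` are matched by isolated cycles only. These factors cancel modulo two,
  -- and the comparison of the paths becomes sharper by one order.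
  obtain ⟨K', hKeq, hK'⟩ : ∃ K' : Multiset ℕ, K = p ::ₘ (if q = p then {p} else 0) + K' ∧
      ∀ k ∈ K', p + 1 ≤ k := by
    have hfe := Multiset.filter_eq K p
    refine ⟨K.filter fun k => ¬ k = p, ?_, ?_⟩
    · conv_lhs => rw [← Multiset.filter_add_not (fun k => k = p) K]
      congr 1
      rw [Multiset.filter_eq', show K.count p = 1 + if q = p then 1 else 0 by omega]
      split_ifs <;> rfl
    · intro k hk
      rw [Multiset.mem_filter] at hk
      have := hμK k hk.1
      omega
  refine dumbbell_shortest_loops_ne_cycles hμ3 hpq hr (by omega) (by omega) hr' hμK (by omega) ?_ h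
  have hD : (X : (ZMod 2)[X]) ^ (p + 1) ∣ binom2 p' * binom2 q' * (K'.map binom2).prod - 1 :=
    dvd_mul_sub_one (dvd_mul_sub_one (dvd_binom2_sub_one (by omega))
      (dvd_binom2_sub_one (by omega))) (dvd_prod_binom2_sub_one hK')
  have hb := binom2_ne_zero (by omega : 1 ≤ p)
  rw [hKeq] at hmod
  split_ifs at hmod with hqp
  · subst hqp
    simp only [Multiset.cons_add, Multiset.map_cons, Multiset.prod_cons, Multiset.map_add,
      Multiset.prod_add, Multiset.map_singleton, Multiset.prod_singleton] at hmod
    exact eq_or_le_of_binom2_mul_eq (U := 1) (by omega) (by omega) (by simp) hD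
      (mul_left_cancel₀ (mul_ne_zero hb hb) (by linear_combination hmod))
  · simp only [Multiset.cons_add, zero_add, Multiset.map_cons, Multiset.prod_cons]
      at hmod
    exact eq_or_le_of_binom2_mul_eq (by omega) (by omega)
      (dvd_binom2_sub_one (by omega : p + 1 ≤ q)) hD
      (mul_left_cancel₀ hb (by linear_combination hmod))

end Dumbbells

/-! ### Dumbbells and theta graphs -/

section Theta

/-- Modulo two and below the girth, only the four paths are visible. -/
theorem dvd_path_sum_of_theta2 {a b c r ν : ℕ} {U V : (ZMod 2)[X]} (hbc : b ≤ c) (hab : a ≤ b)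
    (hν : ν ≤ a + b) (hU : X ^ ν ∣ U - 1) (hV : X ^ ν ∣ V - 1)
    (h : binom2 r * U = theta2 a b c * V) :
    X ^ ν ∣ (X ^ r + X ^ (a + 1) + X ^ (b + 1) + X ^ (c + 1) : (ZMod 2)[X]) := by
  have : (X ^ r + X ^ (a + 1) + X ^ (b + 1) + X ^ (c + 1) : (ZMod 2)[X]) =
      theta2 a b c * (V - 1) - binom2 r * (U - 1) + (X ^ (a + b) + X ^ (a + c) + X ^ (b + c)
        + X ^ (a + b + c + 1)) := by
    have h2 := two_eq_zero_poly
    have h3 : binom2 r = 1 + X ^ r := rfl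
    have h4 : theta2 a b c = 1 + X ^ (a + 1) + X ^ (b + 1) + X ^ (c + 1) + X ^ (a + b) + X ^ (a + c)
      + X ^ (b + c) + X ^ (a + b + c + 1) := rfl
    linear_combination h + h3 + h4 +
      (1 + X ^ (a + 1) + X ^ (b + 1) + X ^ (c + 1) + X ^ r - binom2 r) *
      h2
  rw [this]
  refine dvd_add (dvd_sub (Dvd.dvd.mul_left hV _) (Dvd.dvd.mul_left hU _)) ?_
  exact dvd_add (dvd_add (dvd_add (pow_dvd_pow _ (by omega)) (pow_dvd_pow _ (by omega)))
    (pow_dvd_pow _ (by omega))) (pow_dvd_pow _ (by omega))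

/-- The path of the dumbbell and the three paths of the theta graph cancel to high order, except
for a contribution of a theta graph with cycles of length exactly `ν`. -/
theorem path_theta_difference {a b c r ν : ℕ} (hν : 3 ≤ ν) (hab : a ≤ b) (hbc : b ≤ c)
    (hνab : ν ≤ a + b)
    (h : X ^ ν ∣ (X ^ r + X ^ (a + 1) + X ^ (b + 1) + X ^ (c + 1) : (ZMod 2)[X])) :
    ∃ P : ℤ[X], (-1) ^ r * X ^ (2 * r) + X ^ 2 *
      ((-1) ^ a * X ^ (2 * a) + (-1) ^ b * X ^ (2 * b) + (-1) ^ c * X ^ (2 * c)) = X ^ (ν + 2) * P ∧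
      P.coeff 0 ≤ 2 * (if a + b = ν then 1 else 0) := by
  have hco : ∀ i < ν, ((if i = r then 1 else 0) + (if i = a + 1 then 1 else 0) +
      (if i = b + 1 then 1 else 0) + (if i = c + 1 then 1 else 0) : ZMod 2) = 0 := by
    intro i hi
    rw [← sub_zero (X ^ r + _ + _ + _)] at h
    have := coeff_eq_of_dvd_sub h hi
    simpa only [coeff_add, coeff_X_pow, coeff_zero] using this
  have hterm : ∀ k e : ℕ, ν + 2 ≤ k → ((-1) ^ e * X ^ k : ℤ[X]) =
      X ^ (ν + 2) * ((-1) ^ e * X ^ (k - (ν + 2))) := by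
    intro k e hk
    obtain ⟨d, rfl⟩ := Nat.exists_eq_add_of_le hk
    rw [Nat.add_sub_cancel_left]
    ring
  have hcf : ∀ k e : ℕ, ((-1) ^ e * X ^ k : ℤ[X]).coeff 0 = (-1) ^ e * if k = 0 then 1 else 0 := by
    intro k e
    rw [mul_coeff_zero, coeff_zero_neg_one_pow, coeff_X_pow]
    simp only [eq_comm]
  have hsg : ∀ e : ℕ, (-1 : ℤ) ^ e ≤ 1 := fun e => by
    rcases neg_one_pow_eq_or ℤ e with h | h <;> simp [h]
  by_cases hra : r = a + 1
  · subst hra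
    refine ⟨(-1) ^ b * X ^ (2 * b + 2 - (ν + 2)) + (-1) ^ c * X ^ (2 * c + 2 - (ν + 2)), ?_, ?_⟩
    · linear_combination hterm (2 * b + 2) b (by omega) + hterm (2 * c + 2) c (by omega)
    · rw [coeff_add, hcf, hcf]
      have := hsg b
      have := hsg c
      split_ifs <;> omega
  by_cases hsmall : ν ≤ a + 1
  · have hr : ν ≤ r := by
      by_contra hr
      have := hco r (by omega)
      simp [show r ≠ b + 1 by omega, show r ≠ c + 1 by omega, hra] at this
    refine ⟨(-1) ^ r * X ^ (2 * r - (ν + 2)) + (-1) ^ a * X ^ (2 * a + 2 - (ν + 2)) +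
      (-1) ^ b * X ^ (2 * b + 2 - (ν + 2)) + (-1) ^ c * X ^ (2 * c + 2 - (ν + 2)), ?_, ?_⟩
    · linear_combination hterm (2 * r) r (by omega) + hterm (2 * a + 2) a (by omega) +
        hterm (2 * b + 2) b (by omega) + hterm (2 * c + 2) c (by omega)
    · rw [coeff_add, coeff_add, coeff_add, hcf, hcf, hcf, hcf, if_neg (by omega), if_neg (by omega),
        if_neg (by omega), if_neg (by omega)]
      simp only [mul_zero, add_zero]
      positivity
  · have h1 := hco (a + 1) (by omega)
    have hba : b = a := by
      by_contra hne
      simp [show ¬ a + 1 = r by omega, show ¬ a = b by omega, show ¬ a = c by omega] at h1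
    subst hba
    have hcb : b < c := by
      rcases hbc.lt_or_eq with h2 | rfl
      · exact h2
      · simp [show ¬ b + 1 = r by omega] at h1
        exact absurd h1 (by decide)
    have hr : b + 1 < r := by
      by_contra hr
      have := hco r (by omega)
      simp [show r ≠ b + 1 by omega, show r ≠ c + 1 by omega] at this
    refine ⟨(-1) ^ r * X ^ (2 * r - (ν + 2)) + (-1) ^ b * X ^ (2 * b + 2 - (ν + 2)) +
      (-1) ^ b * X ^ (2 * b + 2 - (ν + 2)) + (-1) ^ c * X ^ (2 * c + 2 - (ν + 2)), ?_, ?_⟩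
    · linear_combination hterm (2 * r) r (by omega) + 2 * hterm (2 * b + 2) b (by omega) +
        hterm (2 * c + 2) c (by omega)
    · rw [coeff_add, coeff_add, coeff_add, hcf, hcf, hcf, if_neg (by omega),
        if_neg (show ¬ 2 * c + 2 - (ν + 2) = 0 by omega)]
      have := hsg b
      split_ifs <;> omega

/-- The path terms in the form in which `dumbbell_compare` needs them. -/
theorem exists_path_term {ν μ a b c r : ℕ} {P : ℤ[X]} (hμ : μ ≤ ν + 2)
    (h : (-1) ^ r * X ^ (2 * r) + X ^ 2 *
      ((-1) ^ a * X ^ (2 * a) + (-1) ^ b * X ^ (2 * b) + (-1) ^ c * X ^ (2 * c)) =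
        X ^ (ν + 2) * P) :
    (-1) ^ r * X ^ (2 * r) * (1 - X) ^ 2 - -(X ^ 2 * (1 - X) ^ 2 *
      ((-1) ^ a * X ^ (2 * a) + (-1) ^ b * X ^ (2 * b) + (-1) ^ c * X ^ (2 * c))) =
      X ^ μ * (X ^ (ν + 2 - μ) * ((1 - X) ^ 2 * P)) := by
  obtain ⟨d, hd⟩ := Nat.exists_eq_add_of_le hμ
  rw [hd, Nat.add_sub_cancel_left]
  rw [hd] at h
  linear_combination (1 - X) ^ 2 * h

/-- `dumbbell_compare` for a theta graph, which has no product of path and cycle contributions of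
low order; its cycles have the lengths `a + b`, `a + c` and `b + c`. -/
theorem theta_compare {μ ν p q r a b c : ℕ} {K : Multiset ℕ} (hμ : 3 ≤ μ) (hp : μ ≤ p) (hq : μ ≤ q)
    (hr : 2 ≤ r) (hK : ∀ k ∈ K, μ ≤ k) (ha : 1 ≤ a) (hab : a ≤ b) (hbc : b ≤ c) (hμab : μ ≤ a + b)
    {P : ℤ[X]} (hν : μ ≤ ν + 2) (hP : (-1) ^ r * X ^ (2 * r) + X ^ 2 *
      ((-1) ^ a * X ^ (2 * a) + (-1) ^ b * X ^ (2 * b) + (-1) ^ c * X ^ (2 * c)) = X ^ (ν + 2) * P)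
    (h : dumbbellVal (X : ℤ[X]) p q r = thetaVal X a b c * (K.map (cycleVal X)).prod) :
    ∃ D : ℤ[X], D.coeff 0 ≤ 0 ∧
      (let F := 2 * ((1 - X + 2 * X ^ 2) * (1 + X ^ 2) * (X ^ (p - μ) + X ^ (q - μ)) -
          (1 + X ^ 2) ^ 2 * (X ^ (a + b - μ) + X ^ (a + c - μ) + X ^ (b + c - μ))
        - (1 - X + 2 * X ^ 2) ^ 2 * lengthPoly μ K) + X ^ (ν + 2 - μ) * ((1 - X) ^ 2 * P)
        + X ^ 3 * (2 * D)
      X ^ 3 ∣ F ∧ (p = μ → μ < a + b → K.count μ = 1 + (if q = μ then 1 else 0) → X ^ 4 ∣ F)) := by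
  obtain ⟨Q, hQ⟩ := thetaVal_expand hab hbc
  obtain ⟨a, rfl⟩ := Nat.exists_eq_add_of_le' ha
  obtain ⟨D, hD, h3, h4⟩ := dumbbell_compare (W := 0) (Q := X ^ (2 * (a + 1 + b - μ)) * Q)
    (h := (1 + X ^ 2) ^ 2 * (X ^ (a + 1 + b - μ) + X ^ (a + 1 + c - μ) + X ^ (b + c - μ)))
    hμ hp hq hr hK
    (P := -(X ^ 2 * (1 - X) ^ 2 * ((-1) ^ (a + 1) * X ^ (2 * (a + 1)) + (-1) ^ b * X ^ (2 * b) +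
      (-1) ^ c * X ^ (2 * c))))
    (by
      obtain ⟨b, rfl⟩ := Nat.exists_eq_add_of_le' (ha.trans hab)
      obtain ⟨c, rfl⟩ := Nat.exists_eq_add_of_le' ((ha.trans hab).trans hbc)
      refine Dvd.intro (-((1 - X) ^ 2 * ((-1) ^ (a + 1) * X ^ (2 * a) +
        (-1) ^ (b + 1) * X ^ (2 * b) + (-1) ^ (c + 1) * X ^ (2 * c)))) ?_
      ring)
    (by
      obtain ⟨d, hd⟩ := Nat.exists_eq_add_of_le hμab
      obtain ⟨e, rfl⟩ := Nat.exists_eq_add_of_le hbc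
      rw [hQ, hd, show a + 1 + (b + e) = μ + (d + e) by omega,
        show b + (b + e) = μ + (b + (b + e) - μ) by omega, Nat.add_sub_cancel_left,
        Nat.add_sub_cancel_left, Nat.add_sub_cancel_left]
      ring) (exists_path_term hν hP) h
  rw [sub_zero] at h3 h4
  refine ⟨D, ?_, h3, fun hpμ hlt hc => h4 ?_⟩
  · rw [hD, neg_nonpos]
    positivity
  · have e1 : ((1 + X ^ 2) ^ 2 * (X ^ (a + 1 + b - μ) + X ^ (a + 1 + c - μ) + X ^ (b + c - μ)) :
        ℤ[X]).coeff 0 = 0 := by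
      rw [coeff_zero_eq_eval_zero]
      simp [show a + 1 + b - μ ≠ 0 by omega, show a + 1 + c - μ ≠ 0 by omega,
        show b + c - μ ≠ 0 by omega]
    have e2 : (X ^ (2 * (a + 1 + b - μ)) * Q).coeff 0 = 0 := by
      rw [coeff_zero_eq_eval_zero]
      simp [show a + 1 + b - μ ≠ 0 by omega]
    rw [e1, e2, hc, if_pos hpμ]
    split_ifs <;> push_cast <;> ring

theorem coeff_theta_cycles {μ a b c : ℕ} (hab : a ≤ b) (hbc : b ≤ c) (hμ : μ ≤ a + b) (i : ℕ) :
    (X ^ (a + b - μ) + X ^ (a + c - μ) + X ^ (b + c - μ) : ℤ[X]).coeff i =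
      (if a + b = μ + i then 1 else 0) + (if a + c = μ + i then 1 else 0)
        + (if b + c = μ + i then 1 else 0) := by
  simp only [coeff_add, coeff_X_pow, show (i = a + b - μ) = (a + b = μ + i) by
    apply propext; omega, show (i = a + c - μ) = (a + c = μ + i) by
    apply propext; omega, show (i = b + c - μ) = (b + c = μ + i) by apply propext; omega]

/-- If all cycles of a theta graph are longer than the shortest loops of a dumbbell, these loops
are not matched by isolated cycles. -/
theorem theta_shortest_loops_ne_cycles {μ q r a b c : ℕ} {K : Multiset ℕ} (hμ : 3 ≤ μ) (hq : μ ≤ q)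
    (hr : 2 ≤ r) (hK : ∀ k ∈ K, μ ≤ k) (ha : 1 ≤ a) (hab : a ≤ b) (hbc : b ≤ c) (hμab : μ < a + b)
    (hc : K.count μ = 1 + if q = μ then 1 else 0)
    (hdvd : X ^ (μ + 1) ∣ (X ^ r + X ^ (a + 1) + X ^ (b + 1) + X ^ (c + 1) : (ZMod 2)[X]))
    (h : dumbbellVal (X : ℤ[X]) μ q r = thetaVal X a b c * (K.map (cycleVal X)).prod) : False := by
  obtain ⟨P, hP, hP0⟩ := path_theta_difference (by omega) hab hbc hμab hdvd
  obtain ⟨D, hD, -, h4⟩ := theta_compare hμ le_rfl hq hr hK ha hab hbc hμab.le (by omega) hP h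
  have h4 := h4 rfl hμab hc
  rw [show μ + 1 + 2 - μ = 3 by omega] at h4
  obtain ⟨c0, c1, c2, c3⟩ := coeff_compare (X ^ (μ - μ) + X ^ (q - μ))
    ((1 + X ^ 2) ^ 2 * (X ^ (a + b - μ) + X ^ (a + c - μ) + X ^ (b + c - μ))) (lengthPoly μ K)
    (X ^ 3 * ((1 - X) ^ 2 * P)) D
  obtain ⟨a0, a1, a2, a3⟩ := coeff_even_mul (X ^ (a + b - μ) + X ^ (a + c - μ) + X ^ (b + c - μ))
  have hE : ∀ i < 3, (X ^ 3 * ((1 - X) ^ 2 * P)).coeff i = 0 := fun i hi =>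
    coeff_eq_zero_of_dvd (Dvd.intro _ rfl) hi
  have hE3 : (X ^ 3 * ((1 - X) ^ 2 * P)).coeff 3 = P.coeff 0 := by
    rw [coeff_X_pow_mul', if_pos le_rfl, mul_coeff_zero]
    simp [coeff_zero_eq_eval_zero]
  rw [hE 0 (by norm_num), coeff_eq_zero_of_dvd h4 (by norm_num), a0] at c0
  rw [hE 1 (by norm_num), coeff_eq_zero_of_dvd h4 (by norm_num), a1] at c1
  rw [hE 2 (by norm_num), coeff_eq_zero_of_dvd h4 (by norm_num), a2] at c2
  rw [hE3, coeff_eq_zero_of_dvd h4 (by norm_num), a3] at c3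
  simp only [coeff_loops le_rfl hq, coeff_theta_cycles hab hbc hμab.le, coeff_lengthPoly hK,
    add_zero, hc, hμab.ne', show a + c ≠ μ by omega, show b + c ≠ μ by omega, if_true, if_false,
    left_eq_add, one_ne_zero, OfNat.ofNat_ne_zero, zero_add, sub_zero, mul_zero] at c0 c1 c2 c3
  push_cast at c1 c2 c3
  have hq23 : (if q = μ + 2 then (1 : ℤ) else 0) + (if q = μ + 3 then 1 else 0) ≤ 1 := by
    split_ifs <;> omega
  have hq0 : (0 : ℤ) ≤ if q = μ then 1 else 0 := by positivity
  have h1 : ∀ i j : ℕ, (0 : ℤ) ≤ if i = j then 1 else 0 := fun i j => by positivity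
  have := h1 (a + c) (μ + 1)
  have := h1 (b + c) (μ + 1)
  have := h1 (a + b) (μ + 1)
  have := h1 (a + b) (μ + 2)
  have := h1 (a + c) (μ + 2)
  have := h1 (b + c) (μ + 2)
  have := h1 (a + b) (μ + 3)
  have := h1 (a + c) (μ + 3)
  have := h1 (b + c) (μ + 3)
  -- As for dumbbells the sum of the equations has no solution; a positive `P.coeff 0` requires
  -- `a + b = μ + 1`, and then this cycle of the theta graph compensates for it.
  linarith

/-- The theta graph with paths of lengths `a`, `a`, `2 * a` has a zero at `1`, the dumbbell with
loops of lengths `2 * a` and `2 * a + 1` has not. -/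
theorem dumbbell_ne_theta_consecutive {a r : ℕ} (ha : Even a) {R : ℤ[X]}
    (h : dumbbellVal (X : ℤ[X]) (2 * a) (2 * a + 1) r = thetaVal X a a (2 * a) * R) : False := by
  have := congrArg (eval 1) h
  simp [dumbbellVal, thetaVal, loopVal, loopVal', ha.neg_one_pow, pow_succ] at this

/-- A dumbbell with two loops of equal length `2 * a` shares the factor of a cycle of length
`2 * a` with the theta graph with two paths of length `a`; the remaining factors differ. -/
theorem dumbbell_ne_theta_twin {a c r : ℕ} {K : Multiset ℕ} (ha : Even a) (ha2 : 2 ≤ a)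
    (hac : a < c) (hr : c + 1 ≤ r) (hK : ∀ k ∈ K, 1 ≤ k)
    (h : dumbbellVal (X : ℤ[X]) (2 * a) (2 * a) r =
      thetaVal X a a c * (cycleVal X (2 * a) * (K.map (cycleVal X)).prod)) : False := by
  obtain ⟨τ, hτ, hmin⟩ := exists_min_of_ne_zero ((a + c) ::ₘ K) (by simp)
  have hτac : τ ≤ a + c := hmin _ (by simp)
  have hτK : ∀ k ∈ K, τ ≤ k := fun k hk => hmin k (by simp [hk])
  have hτ1 : 1 ≤ τ := by
    simp only [Multiset.mem_cons] at hτ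
    rcases hτ with rfl | hτ
    exacts [by omega, hK τ hτ]
  obtain ⟨ρ, hC, -⟩ := prod_cycleVal_expand hτ1 hτK
  have hκ := coeff_lengthPoly hτK 0
  rw [coeff_zero_eq_eval_zero, add_zero] at hκ
  set C := (K.map (cycleVal (X : ℤ[X]))).prod
  set κ := lengthPoly τ K
  set G : ℤ[X] := 1 - X + 2 * X ^ 2 + (1 + X) * X ^ (2 * a) with hG
  set H : ℤ[X] := -(1 - X) + (2 + X + X ^ 2) * X ^ (2 * a - 1) with hH
  have hcyc : cycleVal (X : ℤ[X]) (2 * a) ≠ 0 := by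
    intro h0
    have := congrArg (eval 0) h0
    simp [cycleVal, show a ≠ 0 by omega] at this
  -- After cancellation of the factor of the cycle, both sides are `G ^ 2` up to order `τ`, except
  -- for positive contributions on the right.
  have h1 : G ^ 2 + (-1) ^ r * X ^ (2 * r) * H ^ 2 = (G ^ 2 + (-1) ^ (c + 1) * X ^ (2 * (c + 1)) *
      H ^ 2 + 4 * (1 + X ^ 2) ^ 2 * X ^ (a + c) * (1 - X ^ (2 * a))) * C := by
    apply mul_left_cancel₀ hcyc
    have e1 : cycleVal (X : ℤ[X]) (2 * a) * (G ^ 2 + (-1) ^ r * X ^ (2 * r) * H ^ 2) =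
        dumbbellVal X (2 * a) (2 * a) r := by
      obtain ⟨n, rfl⟩ := Nat.exists_eq_add_of_le' (show 1 ≤ a by omega)
      simp only [hG, hH, dumbbellVal, loopVal, loopVal', cycleVal, pow_mul (-1 : ℤ[X]) 2,
        neg_one_sq, one_pow, show 2 * (n + 1) - 1 = 2 * n + 1 by omega,
        show 2 * (2 * (n + 1)) - 1 = 4 * n + 3 by omega]
      ring
    have e2 : thetaVal (X : ℤ[X]) a a c = G ^ 2 + (-1) ^ (c + 1) * X ^ (2 * (c + 1)) *
      H ^ 2 + 4 * (1 + X ^ 2) ^ 2 * X ^ (a + c) * (1 - X ^ (2 * a)) := by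
      obtain ⟨n, rfl⟩ := Nat.exists_eq_add_of_le' (show 1 ≤ a by omega)
      simp only [hG, hH, thetaVal, ha.neg_one_pow, show 2 * (n + 1) - 1 = 2 * n + 1 by omega]
      ring
    rw [e1, h, e2]
    ring
  obtain ⟨u, hu⟩ := Nat.exists_eq_add_of_lt (show τ < 2 * r by omega)
  obtain ⟨v, hv⟩ := Nat.exists_eq_add_of_lt (show τ < 2 * (c + 1) by omega)
  obtain ⟨e, he⟩ := Nat.exists_eq_add_of_le hτac
  rw [hu, hv, he] at h1
  have h2 : X ^ τ * ((-1) ^ r * X ^ (u + 1) * H ^ 2 - ((-1) ^ (c + 1) * X ^ (v + 1) * H ^ 2 +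
      4 * (1 + X ^ 2) ^ 2 * X ^ e * (1 - X ^ (2 * a))) * C - G ^ 2 * (2 * κ + X ^ τ * ρ)) = 0 := by
    have h3 : G ^ 2 * C = G ^ 2 * (1 + 2 * X ^ τ * κ + X ^ (2 * τ) * ρ) := by rw [hC]
    linear_combination h1 + h3
  have h3 := congrArg (eval 0) ((mul_eq_zero.mp h2).resolve_left (pow_ne_zero _ X_ne_zero))
  have hC0 : C.eval 0 = 1 := by
    rw [hC]
    simp [show τ ≠ 0 by omega]
  have hG0 : G.eval 0 = 1 := by simp [hG, show a ≠ 0 by omega]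
  simp [hC0, hG0, hκ, show τ ≠ 0 by omega, show a ≠ 0 by omega] at h3
  have hpos : 0 < 4 * (0 : ℤ) ^ e + 2 * K.count τ := by
    simp only [Multiset.mem_cons] at hτ
    rcases hτ with h4 | h4
    · obtain rfl : e = 0 := by omega
      positivity
    · have := Multiset.count_pos.mpr h4
      positivity
  linarith

theorem theta2_eq_of_fst_eq_one (b c : ℕ) : theta2 1 b c = binom2 2 * binom2 (b + c) := by
  simp only [theta2, binom2]
  linear_combination (X ^ (b + 1) + X ^ (c + 1)) * two_eq_zero_poly

theorem theta2_self (a c : ℕ) : theta2 a a c = binom2 (c + 1) * binom2 (2 * a) := by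
  simp only [theta2, binom2]
  linear_combination (X ^ (a + 1) + X ^ (a + c)) * two_eq_zero_poly

theorem coeff_one_of_dvd_sub_one {R : Type*} [CommRing R] {ν i : ℕ} {P : R[X]}
    (h : X ^ ν ∣ P - 1) (hi : i < ν) : P.coeff i = if i = 0 then 1 else 0 := by
  rw [coeff_eq_of_dvd_sub h hi, coeff_one]

theorem not_dvd_binom2_sub_one {k ν : ℕ} (hk : 1 ≤ k) (hν : k < ν) {U V : (ZMod 2)[X]}
    (hU : X ^ ν ∣ U - 1) (hV : X ^ ν ∣ V - 1) : binom2 k * U ≠ V := by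
  intro h
  have h1 : X ^ ν ∣ binom2 k - 1 := by
    have : binom2 k - 1 = (V - 1) - binom2 k * (U - 1) := by rw [← h]; ring
    rw [this]
    exact dvd_sub hV (Dvd.dvd.mul_left hU _)
  have h2 := coeff_one_of_dvd_sub_one h1 hν
  simp [binom2, coeff_one, show k ≠ 0 by omega] at h2

/-- The polynomial of a dumbbell is not the polynomial of a theta graph with isolated cycles. -/
theorem dumbbell_ne_theta {p q r a b c : ℕ} {K : Multiset ℕ} (hp : 3 ≤ p) (hpq : p ≤ q)
    (hr : 2 ≤ r) (ha : 1 ≤ a) (hb : 2 ≤ b) (hab : a ≤ b) (hbc : b ≤ c) (hK : ∀ k ∈ K, 3 ≤ k)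
    (hsum : p + q + r = a + b + c + 1 + K.sum)
    (h : dumbbellVal (X : ℤ[X]) p q r = thetaVal X a b c * (K.map (cycleVal X)).prod) : False := by
  obtain ⟨μ, hμ, hmin⟩ := exists_min_of_ne_zero (p ::ₘ (a + b) ::ₘ K) (by simp)
  have hμp : μ ≤ p := hmin p (by simp)
  have hμab : μ ≤ a + b := hmin _ (by simp)
  have hμK : ∀ k ∈ K, μ ≤ k := fun k hk => hmin k (by simp [hk])
  have hμ3 : 3 ≤ μ := by
    simp only [Multiset.mem_cons] at hμ
    rcases hμ with rfl | rfl | hμ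
    exacts [hp, by omega, hK μ hμ]
  have hmod := theta_mod_two (by omega) (by omega) h
  have hdvd := dvd_path_sum_of_theta2 (r := r) hbc hab hμab
    (dvd_mul_sub_one (dvd_binom2_sub_one hμp) (dvd_binom2_sub_one (by omega : μ ≤ q)))
    (dvd_prod_binom2_sub_one hμK) (by linear_combination hmod)
  obtain ⟨P, hP, -⟩ := path_theta_difference hμ3 hab hbc hμab hdvd
  obtain ⟨D, -, hF, -⟩ := theta_compare hμ3 hμp (by omega : μ ≤ q) hr hμK ha hab hbc hμab
    (by omega) hP h
  obtain ⟨c0, c1, c2, -⟩ := coeff_compare (X ^ (p - μ) + X ^ (q - μ))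
    ((1 + X ^ 2) ^ 2 * (X ^ (a + b - μ) + X ^ (a + c - μ) + X ^ (b + c - μ))) (lengthPoly μ K)
    (X ^ (μ + 2 - μ) * ((1 - X) ^ 2 * P)) D
  obtain ⟨a0, a1, a2, -⟩ := coeff_even_mul (X ^ (a + b - μ) + X ^ (a + c - μ) + X ^ (b + c - μ))
  have hE : ∀ i < 2, (X ^ (μ + 2 - μ) * ((1 - X) ^ 2 * P)).coeff i = 0 := fun i hi =>
    coeff_eq_zero_of_dvd (Dvd.intro _ rfl) (by omega)
  have hE2 : (X ^ (μ + 2 - μ) * ((1 - X) ^ 2 * P)).coeff 2 = P.coeff 0 := by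
    rw [coeff_X_pow_mul', if_pos (by omega), show 2 - (μ + 2 - μ) = 0 by omega, mul_coeff_zero]
    simp [coeff_zero_eq_eval_zero]
  rw [hE 0 (by norm_num), coeff_eq_zero_of_dvd hF (by norm_num), a0] at c0
  rw [hE 1 (by norm_num), coeff_eq_zero_of_dvd hF (by norm_num), a1] at c1
  rw [hE2, coeff_eq_zero_of_dvd hF (by norm_num), a2] at c2
  simp only [coeff_loops hμp (by omega : μ ≤ q), coeff_theta_cycles hab hbc hμab,
    coeff_lengthPoly hμK, add_zero] at c0 c1 c2
  have hcount : (if p = μ then 1 else 0) + (if q = μ then 1 else 0) =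
      (if a + b = μ then 1 else 0) + (if a + c = μ then 1 else 0) + (if b + c = μ then 1 else 0)
        + K.count μ := by
    rw [← Nat.cast_inj (R := ℤ)]
    push_cast
    linarith
  have hpμ : p = μ := by
    by_contra hne
    rw [if_neg hne, if_neg (show q ≠ μ by omega)] at hcount
    simp only [Multiset.mem_cons, Ne.symm hne, false_or] at hμ
    rcases hμ with h3 | h3
    · rw [if_pos h3.symm] at hcount
      omega
    · have := Multiset.count_pos.mpr h3
      omega
  subst hpμ
  have hbp := binom2_ne_zero (by omega : 1 ≤ p)
  by_cases hlt : p < a + b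
  -- The shortest cycles are loops of the dumbbell, matched by isolated cycles only.
  · rw [if_pos rfl, if_neg (show a + b ≠ p by omega), if_neg (show a + c ≠ p by omega),
      if_neg (show b + c ≠ p by omega)] at hcount
    obtain ⟨K', hKeq, hK'⟩ : ∃ K' : Multiset ℕ, K = p ::ₘ (if q = p then {p} else 0) + K' ∧
        ∀ k ∈ K', p + 1 ≤ k := by
      refine ⟨K.filter fun k => ¬ k = p, ?_, ?_⟩
      · conv_lhs => rw [← Multiset.filter_add_not (fun k => k = p) K]
        congr 1
        rw [Multiset.filter_eq', show K.count p = 1 + if q = p then 1 else 0 by omega]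
        split_ifs <;> rfl
      · intro k hk
        rw [Multiset.mem_filter] at hk
        have := hμK k hk.1
        omega
    refine theta_shortest_loops_ne_cycles hμ3 hpq hr hμK ha hab hbc hlt (by omega) ?_ h
    have hD := dvd_prod_binom2_sub_one hK'
    rw [hKeq] at hmod
    split_ifs at hmod with hqp
    · subst hqp
      simp only [Multiset.cons_add, Multiset.map_cons, Multiset.prod_cons, Multiset.map_add,
        Multiset.prod_add, Multiset.map_singleton, Multiset.prod_singleton] at hmod
      exact dvd_path_sum_of_theta2 (U := 1) hbc hab hlt (by simp) hD
        (mul_left_cancel₀ (mul_ne_zero hbp hbp) (by linear_combination hmod))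
    · simp only [Multiset.cons_add, zero_add, Multiset.map_cons, Multiset.prod_cons] at hmod
      exact dvd_path_sum_of_theta2 hbc hab hlt (dvd_binom2_sub_one (by omega : p + 1 ≤ q)) hD
        (mul_left_cancel₀ hbp (by linear_combination hmod))
  obtain rfl : p = a + b := by omega
  have hbc' : ¬ (a = b ∧ b = c) := by
    rintro ⟨rfl, rfl⟩
    simp only [if_true] at hcount
    split_ifs at hcount <;> omega
  have hKsum : ∀ k ∈ K, k ≤ K.sum := fun k hk =>
    Multiset.single_le_sum (fun _ _ => Nat.zero_le _) k hk
  rcases hab.lt_or_eq with hab' | rfl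
  -- A unique shortest path of the theta graph corresponds to the path of the dumbbell, but then the
  -- other paths are not matched modulo two, or the numbers of vertices differ.
  · have hco : ∀ i < a + b, ((if i = r then 1 else 0) + (if i = a + 1 then 1 else 0) +
        (if i = b + 1 then 1 else 0) + (if i = c + 1 then 1 else 0) : ZMod 2) = 0 := by
      intro i hi
      simpa only [coeff_add, coeff_X_pow] using coeff_eq_zero_of_dvd hdvd hi
    have hra : r = a + 1 := by
      by_contra hne
      have := hco (a + 1) (by omega)
      simp [Ne.symm hne, show a ≠ b by omega, show a ≠ c by omega] at this
    subst hra
    rw [if_pos rfl, if_neg (show b + c ≠ a + b by omega)] at hcount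
    rcases hpq.lt_or_eq with hpq' | rfl
    · rw [if_neg (by omega)] at hcount
      have hcb : b < c := by
        by_contra hcb
        rw [if_pos (show a + c = a + b by omega)] at hcount
        omega
      rcases ha.lt_or_eq with ha2 | rfl
      · have := hco (b + 1) (by omega)
        simp [show b ≠ a by omega, show b ≠ c by omega] at this
      · rw [theta2_eq_of_fst_eq_one] at hmod
        have hcK : ∀ k ∈ K, b + 2 ≤ k := by
          intro k hk
          have h1 := hμK k hk
          have h2 : k ≠ 1 + b := by
            rintro rfl
            have := Multiset.count_pos.mpr hk
            omega
          omega
        exact not_dvd_binom2_sub_one (k := 1 + b) (ν := b + 2) (by omega) (by omega)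
          (dvd_binom2_sub_one (by omega : b + 2 ≤ q))
          (dvd_mul_sub_one (dvd_binom2_sub_one (by omega : b + 2 ≤ b + c))
            (dvd_prod_binom2_sub_one hcK))
          (mul_left_cancel₀ (binom2_ne_zero (by omega : 1 ≤ 2)) (by linear_combination hmod))
    · rw [if_pos rfl] at hcount
      have hK0 : K = 0 := by
        by_contra hK0
        obtain ⟨k, hk⟩ := Multiset.exists_mem_of_ne_zero hK0
        have := hKsum k hk
        have := hμK k hk
        omega
      subst hK0
      rw [Multiset.count_zero] at hcount
      rw [Multiset.sum_zero] at hsum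
      split_ifs at hcount <;> omega
  -- Two shortest paths of the theta graph cancel modulo two, so the path of the dumbbell is longer.
  have hac : a < c := by omega
  rw [theta2_self, ← two_mul] at hmod
  have hmod' : binom2 q * binom2 r = binom2 (c + 1) * (K.map binom2).prod :=
    mul_left_cancel₀ (binom2_ne_zero (by omega : 1 ≤ 2 * a)) (by linear_combination hmod)
  have hra : a + 2 ≤ r := by
    by_contra hra
    exact not_dvd_binom2_sub_one (k := r) (ν := r + 1) (by omega) (by omega)
      (dvd_binom2_sub_one (by omega : r + 1 ≤ q))
      (dvd_mul_sub_one (dvd_binom2_sub_one (by omega : r + 1 ≤ c + 1))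
        (dvd_prod_binom2_sub_one fun k hk => by have := hμK k hk; omega))
      (by linear_combination hmod')
  have hP0 : P.coeff 0 = 2 * (-1) ^ a := by
    obtain ⟨d, rfl⟩ := Nat.exists_eq_add_of_le hra
    obtain ⟨e, rfl⟩ := Nat.exists_eq_add_of_lt hac
    have : X ^ (a + a + 2) * (P - ((-1) ^ (a + 2 + d) * X ^ (2 * d + 2) + 2 * (-1) ^ a +
        (-1) ^ (a + e + 1) * X ^ (2 * e + 2))) = 0 := by
      linear_combination -hP
    obtain rfl : P = _ := sub_eq_zero.mp ((mul_eq_zero.mp this).resolve_left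
      (pow_ne_zero _ X_ne_zero))
    simp [coeff_zero_eq_eval_zero]
  rw [hP0] at c2
  simp only [if_true, left_eq_add, one_ne_zero, OfNat.ofNat_ne_zero, if_false, zero_add] at c0 c1 c2
  rw [if_pos rfl, if_neg (show a + c ≠ a + a by omega)] at hcount
  simp only [show a + c ≠ a + a by omega, if_false] at c0 c1 c2
  have hcnt : ∀ i, (0 : ℤ) ≤ K.count (a + a + i) := fun i => by positivity
  have hk1 := hcnt 1
  have hk2 := hcnt 2
  rcases hpq.lt_or_eq with hpq' | rfl
  -- The equations force `q = 2 * a + 1`, a cycle of length `2 * a + 2`, and an even `a`.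
  · rw [if_neg (by omega)] at hcount
    have hK0 : K.count (a + a) = 0 := by omega
    rw [hK0] at c1 c2
    have hq1 : q = a + a + 1 := by
      by_contra hq1
      rw [if_neg hq1] at c1
      split_ifs at c1 <;> omega
    subst hq1
    rw [if_pos rfl] at c1 c2
    rw [if_neg (by omega)] at c2
    have hK1 : K.count (a + a + 1) = 0 := by
      split_ifs at c1 <;> omega
    rw [hK1] at c2
    have haev : Even a := by
      rcases Nat.even_or_odd a with h1 | h1
      · exact h1
      · rw [h1.neg_one_pow] at c2
        split_ifs at c2 <;> omega
    rw [haev.neg_one_pow] at c2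
    have hK2 : K.count (a + a + 2) = 1 := by
      split_ifs at c2 <;> omega
    obtain ⟨K', rfl⟩ := Multiset.exists_cons_of_mem (Multiset.count_pos.mp
      (by omega : 0 < K.count (a + a + 2)))
    have hK' : ∀ k ∈ K', a + a + 2 ≤ k := by
      intro k hk
      have h1 := hμK k (by simp [hk])
      have h2 : k ≠ a + a := by
        rintro rfl
        have := Multiset.count_pos.mpr (Multiset.mem_cons_of_mem (b := a + a + 2) hk)
        omega
      have h3 : k ≠ a + a + 1 := by
        rintro rfl
        have := Multiset.count_pos.mpr (Multiset.mem_cons_of_mem (b := a + a + 2) hk)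
        omega
      omega
    rw [Multiset.map_cons, Multiset.prod_cons] at hmod'
    rw [Multiset.sum_cons] at hsum
    have hca : c = 2 * a := by
      rcases lt_trichotomy c (2 * a) with h1 | h1 | h1
      · exact (not_dvd_binom2_sub_one (k := c + 1) (ν := c + 2) (by omega) (by omega)
          (dvd_mul_sub_one (dvd_binom2_sub_one (by omega : c + 2 ≤ a + a + 2))
            (dvd_prod_binom2_sub_one fun k hk => by have := hK' k hk; omega))
          (dvd_mul_sub_one (dvd_binom2_sub_one (by omega : c + 2 ≤ a + a + 1))
            (dvd_binom2_sub_one (by omega : c + 2 ≤ r))) hmod'.symm).elim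
      · exact h1
      · exact (not_dvd_binom2_sub_one (k := a + a + 1) (ν := a + a + 2) (by omega) (by omega)
          (dvd_binom2_sub_one (by omega : a + a + 2 ≤ r))
          (dvd_mul_sub_one (dvd_binom2_sub_one (by omega : a + a + 2 ≤ c + 1))
            (dvd_mul_sub_one (dvd_binom2_sub_one le_rfl) (dvd_prod_binom2_sub_one hK')))
          hmod').elim
    subst hca
    rw [← two_mul] at h
    exact dumbbell_ne_theta_consecutive haev h
  -- The equations force a cycle of length `2 * a` and an even `a`.
  · rw [if_pos rfl] at hcount
    have hK0 : K.count (a + a) = 1 := by omega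
    rw [hK0] at c1 c2
    simp only [left_eq_add, one_ne_zero, OfNat.ofNat_ne_zero, if_false, if_true] at c1 c2
    have hK1 : K.count (a + a + 1) = 0 := by
      split_ifs at c1 <;> omega
    rw [hK1] at c2
    have haev : Even a := by
      rcases Nat.even_or_odd a with h1 | h1
      · exact h1
      · rw [h1.neg_one_pow] at c2
        split_ifs at c2 <;> omega
    obtain ⟨K', rfl⟩ := Multiset.exists_cons_of_mem (Multiset.count_pos.mp
      (by omega : 0 < K.count (a + a)))
    rw [Multiset.map_cons, Multiset.prod_cons] at h
    rw [Multiset.sum_cons] at hsum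
    rw [← two_mul] at h
    exact dumbbell_ne_theta_twin haev hb hac (by omega)
      (fun k hk => by have := hK k (by simp [hk]); omega) h

end Theta

/-! ### Paths with two chords -/

section Chords

open Matrix

/-- Adjacency in the graph on `0, ..., k` formed by the path through these numbers in their order
and the two chords `0 - j` and `i - k`. It is a dumbbell for `j < i` and a theta graph for
`i < j`. -/
def ChordAdj (k i j s t : ℕ) : Prop :=
  s + 1 = t ∨ t + 1 = s ∨ s = 0 ∧ t = j ∨ s = j ∧ t = 0 ∨ s = i ∧ t = k ∨ s = k ∧ t = i

instance (k i j s t : ℕ) : Decidable (ChordAdj k i j s t) := by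
  unfold ChordAdj
  infer_instance

/-- The vertices of a path with chords `0 - j` and `i - k`, where `j < i`, in the order of
`earMatrix`: the vertices `j` and `i` of degree three, the path between them, and the two loops. -/
def dumbbellVertex (i j : ℕ) {m n l : ℕ} : ((Fin 2 ⊕ Fin m) ⊕ Fin n) ⊕ Fin l → ℕ :=
  Sum.elim (Sum.elim (Sum.elim ![j, i] fun a => j + 1 + a) fun a => a) fun a => i + 1 + a

/-- The vertices of a path with chords `0 - j` and `i - k`, where `i < j`, in the order of
`earMatrix`: the vertices `j` and `i` of degree three, and the three paths between them, where the
first is traversed from `j` to `i`. -/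
def thetaVertex (i j : ℕ) {m n l : ℕ} : ((Fin 2 ⊕ Fin m) ⊕ Fin n) ⊕ Fin l → ℕ :=
  Sum.elim (Sum.elim (Sum.elim ![j, i] fun a => j - 1 - a) fun a => a) fun a => j + 1 + a

/-- The weighted adjacency matrix of a path with disjoint chords is the matrix of a dumbbell in the
order `dumbbellVertex` of the vertices. -/
theorem dumbbellVertex_apply (y : ℝ) (p q r : ℕ)
    (a b : ((Fin 2 ⊕ Fin r) ⊕ Fin (p + 2)) ⊕ Fin (q + 2)) :
    earMatrix (earMatrix (earMatrix (coreMatrix (y - 1)) 0 1 y r) (.inl 0) (.inl 0) y (p + 2))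
      (.inl (.inl 1)) (.inl (.inl 1)) y (q + 2) a b =
      if dumbbellVertex (p + r + 3) (p + 2) a = dumbbellVertex (p + r + 3) (p + 2) b then
        (if dumbbellVertex (p + r + 3) (p + 2) a = p + r + 3 ∨
          dumbbellVertex (p + r + 3) (p + 2) a = p + 2 then y - 1 else y)
      else if ChordAdj (p + q + r + 5) (p + r + 3) (p + 2) (dumbbellVertex (p + r + 3) (p + 2) a)
        (dumbbellVertex (p + r + 3) (p + 2) b) then 1 else 0 := by
  obtain ((a | a) | a) | a := a <;> obtain ((b | b) | b) | b := b
  all_goals try fin_cases a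
  all_goals try fin_cases b
  all_goals simp [earMatrix, coreMatrix, dumbbellVertex, ChordAdj]
  all_goals grind

/-- The weighted adjacency matrix of a path with overlapping chords is the matrix of a theta graph
in the order `thetaVertex` of the vertices. The assumptions exclude double edges. -/
theorem thetaVertex_apply (y : ℝ) (m n l : ℕ) (h : 1 ≤ m + n) (h' : 1 ≤ m + l) (h'' : 1 ≤ n + l)
    (a b : ((Fin 2 ⊕ Fin m) ⊕ Fin n) ⊕ Fin l) :
    earMatrix (earMatrix (earMatrix (coreMatrix (y - 1)) 0 1 y m) (.inl 0) (.inl 1) y n)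
      (.inl (.inl 0)) (.inl (.inl 1)) y l a b =
      if thetaVertex n (m + n + 1) a = thetaVertex n (m + n + 1) b then
        (if thetaVertex n (m + n + 1) a = n ∨
          thetaVertex n (m + n + 1) a = m + n + 1 then y - 1 else y)
      else if ChordAdj (m + n + l + 1) n (m + n + 1) (thetaVertex n (m + n + 1) a)
        (thetaVertex n (m + n + 1) b) then 1 else 0 := by
  obtain ((a | a) | a) | a := a <;> obtain ((b | b) | b) | b := b
  all_goals try fin_cases a
  all_goals try fin_cases b
  all_goals simp [earMatrix, coreMatrix, thetaVertex, ChordAdj]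
  all_goals grind

/-- The chords `0 - k` and `0 - k` coincide and close the path to a cycle. -/
theorem cycleVertex_apply (y : ℝ) (m : ℕ) (a b : Unit ⊕ Fin (m + 2)) :
    earMatrix (diagonal fun _ : Unit => y) () () y (m + 2) a b =
      if (Sum.elim (fun _ => 0) (fun a => a.val + 1) a : ℕ) =
        Sum.elim (fun _ => 0) (fun a => a.val + 1) b then y
      else if ChordAdj (m + 2) 0 (m + 2) (Sum.elim (fun _ => 0) (fun a => a.val + 1) a)
        (Sum.elim (fun _ => 0) (fun a => a.val + 1) b) then 1 else 0 := by
  obtain a | a := a <;> obtain b | b := b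
  all_goals simp [earMatrix, ChordAdj]

theorem exists_dumbbellVertex {p q r t : ℕ} (h : t ≤ p + q + r + 5) :
    ∃ a : ((Fin 2 ⊕ Fin r) ⊕ Fin (p + 2)) ⊕ Fin (q + 2),
      dumbbellVertex (p + r + 3) (p + 2) a = t := by
  by_cases h1 : t < p + 2
  · exact ⟨.inl (.inr ⟨t, h1⟩), rfl⟩
  by_cases h2 : t = p + 2
  · exact ⟨.inl (.inl (.inl 0)), by simp [dumbbellVertex, h2]⟩
  by_cases h3 : t < p + r + 3
  · exact ⟨.inl (.inl (.inr ⟨t - (p + 3), by omega⟩)), by simp [dumbbellVertex]; omega⟩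
  by_cases h4 : t = p + r + 3
  · exact ⟨.inl (.inl (.inl 1)), by simp [dumbbellVertex, h4]⟩
  · exact ⟨.inr ⟨t - (p + r + 4), by omega⟩, by simp [dumbbellVertex]; omega⟩

theorem exists_thetaVertex {m n l t : ℕ} (h : t ≤ m + n + l + 1) :
    ∃ a : ((Fin 2 ⊕ Fin m) ⊕ Fin n) ⊕ Fin l, thetaVertex n (m + n + 1) a = t := by
  by_cases h1 : t < n
  · exact ⟨.inl (.inr ⟨t, h1⟩), rfl⟩
  by_cases h2 : t = n
  · exact ⟨.inl (.inl (.inl 1)), by simp [thetaVertex, h2]⟩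
  by_cases h3 : t < m + n + 1
  · exact ⟨.inl (.inl (.inr ⟨m + n - t, by omega⟩)), by simp [thetaVertex]; omega⟩
  by_cases h4 : t = m + n + 1
  · exact ⟨.inl (.inl (.inl 0)), by simp [thetaVertex, h4]⟩
  · exact ⟨.inr ⟨t - (m + n + 2), by omega⟩, by simp [thetaVertex]; omega⟩

theorem dumbbellVertex_injective (p q r : ℕ) :
    Function.Injective (dumbbellVertex (p + r + 3) (p + 2) :
    ((Fin 2 ⊕ Fin r) ⊕ Fin (p + 2)) ⊕ Fin (q + 2) → ℕ) := by
  intro a b h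
  obtain ((a | a) | a) | a := a <;> obtain ((b | b) | b) | b := b
  all_goals try fin_cases a
  all_goals try fin_cases b
  all_goals simp [dumbbellVertex] at h ⊢
  all_goals grind

theorem dumbbellVertex_le (p q r : ℕ) (a : ((Fin 2 ⊕ Fin r) ⊕ Fin (p + 2)) ⊕ Fin (q + 2)) :
    dumbbellVertex (p + r + 3) (p + 2) a ≤ p + q + r + 5 := by
  obtain ((a | a) | a) | a := a
  all_goals try fin_cases a
  all_goals simp [dumbbellVertex]
  all_goals omega

theorem thetaVertex_injective (m n l : ℕ) :
    Function.Injective (thetaVertex n (m + n + 1) :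
    ((Fin 2 ⊕ Fin m) ⊕ Fin n) ⊕ Fin l → ℕ) := by
  intro a b h
  obtain ((a | a) | a) | a := a <;> obtain ((b | b) | b) | b := b
  all_goals try fin_cases a
  all_goals try fin_cases b
  all_goals simp [thetaVertex] at h ⊢
  all_goals grind

theorem thetaVertex_le (m n l : ℕ) (a : ((Fin 2 ⊕ Fin m) ⊕ Fin n) ⊕ Fin l) :
    thetaVertex n (m + n + 1) a ≤ m + n + l + 1 := by
  obtain ((a | a) | a) | a := a
  all_goals try fin_cases a
  all_goals simp [thetaVertex]
  all_goals omega

end Chords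

/-! ### Longest paths -/

section LongestPath

variable {V : Type*} {G : SimpleGraph V}

/-- The vertices `p 0, ..., p k` form a path in `G`. -/
structure IsPathOn (G : SimpleGraph V) (k : ℕ) (p : ℕ → V) : Prop where
  adj : ∀ s < k, G.Adj (p s) (p (s + 1))
  inj : ∀ s ≤ k, ∀ t ≤ k, p s = p t → s = t

/-- The vertices `p 0, ..., p k` induce in `G` the path through them with the chords `0 - j` and
`i - k`, and they have no other neighbors. -/
structure IsChordPath (G : SimpleGraph V) (k i j : ℕ) (p : ℕ → V) : Prop where
  inj : ∀ s ≤ k, ∀ t ≤ k, p s = p t → s = t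
  adj_iff : ∀ s ≤ k, ∀ v, G.Adj (p s) v ↔ ∃ t ≤ k, ChordAdj k i j s t ∧ p t = v

theorem IsChordPath.adj_iff_chordAdj {k i j s t : ℕ} {p : ℕ → V} (h : IsChordPath G k i j p)
    (hs : s ≤ k) (ht : t ≤ k) : G.Adj (p s) (p t) ↔ ChordAdj k i j s t := by
  rw [h.adj_iff s hs]
  constructor
  · rintro ⟨t', ht', h1, h2⟩
    rwa [← h.inj _ ht' _ ht h2]
  · exact fun h1 => ⟨t, ht, h1, rfl⟩

theorem IsPathOn.reverse {k : ℕ} {p : ℕ → V} (h : IsPathOn G k p) :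
    IsPathOn G k fun s => p (k - s) where
  adj s hs := by
    have := (h.adj (k - (s + 1)) (by omega)).symm
    rwa [show k - (s + 1) + 1 = k - s by omega] at this
  inj s hs t ht hst := by
    have := h.inj _ (by omega) _ (by omega) hst
    omega

theorem IsPathOn.cons {k : ℕ} {p : ℕ → V} (h : IsPathOn G k p) {u : V} (hu : G.Adj (p 0) u)
    (hn : ∀ s ≤ k, p s ≠ u) : IsPathOn G (k + 1) fun s => Nat.casesOn s u p where
  adj s hs := by
    rcases s with - | s
    · exact hu.symm
    · exact h.adj s (by omega)
  inj s hs t ht hst := by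
    rcases s with - | s <;> rcases t with - | t
    · rfl
    · exact (hn t (by omega) hst.symm).elim
    · exact (hn s (by omega) hst).elim
    · rw [h.inj s (by omega) t (by omega) hst]

/-- If its ends are adjacent, a path can be started at any of its vertices. -/
theorem IsPathOn.rotate {k : ℕ} {p : ℕ → V} (h : IsPathOn G k p) (h0 : G.Adj (p 0) (p k)) (c : ℕ) :
    IsPathOn G k fun s => p ((s + c) % (k + 1)) where
  adj s hs := by
    have h1 : (s + c) % (k + 1) < k + 1 := Nat.mod_lt _ (by omega)
    have h2 : (s + 1 + c) % (k + 1) =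
        if (s + c) % (k + 1) = k then 0 else (s + c) % (k + 1) + 1 := by
      rw [show s + 1 + c = s + c + 1 by omega, Nat.add_mod_eq_ite,
        Nat.mod_eq_of_lt (show 1 < k + 1 by omega)]
      split_ifs <;> omega
    simp only [h2]
    split_ifs with h3
    · rw [h3]
      exact h0.symm
    · exact h.adj _ (by omega)
  inj s hs t ht hst := by
    have h1 := h.inj _ (Nat.lt_succ_iff.mp (Nat.mod_lt _ (by omega))) _
      (Nat.lt_succ_iff.mp (Nat.mod_lt _ (by omega))) hst
    have h2 : s ≡ t [MOD k + 1] := Nat.ModEq.add_right_cancel' c h1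
    exact Nat.ModEq.eq_of_lt_of_lt h2 (by omega) (by omega)

/-- A path of greatest length among those through `x`. -/
structure IsLongestPath (G : SimpleGraph V) (x : V) (k : ℕ) (p : ℕ → V) : Prop
    extends IsPathOn G k p where
  mem : ∃ s ≤ k, p s = x
  le : ∀ l (q : ℕ → V), IsPathOn G l q → (∃ s ≤ l, q s = x) → l ≤ k

theorem exists_isLongestPath [Finite V] (G : SimpleGraph V) (x : V) :
    ∃ k p, IsLongestPath G x k p := by
  have hb : ∀ l (q : ℕ → V), IsPathOn G l q → l ≤ Nat.card V := by
    intro l q hq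
    have : Function.Injective fun s : Fin (l + 1) => q s := fun s t hst =>
      Fin.ext (hq.inj _ (by omega) _ (by omega) hst)
    have := Nat.card_le_card_of_injective _ this
    rw [Nat.card_fin] at this
    omega
  set S : Set ℕ := {l | ∃ q : ℕ → V, IsPathOn G l q ∧ ∃ s ≤ l, q s = x} with hS
  have hne : S.Nonempty := ⟨0, fun _ => x, ⟨by simp, by simp⟩, 0, le_rfl, rfl⟩
  have hbdd : BddAbove S := ⟨Nat.card V, fun l ⟨q, hq, _⟩ => hb l q hq⟩
  obtain ⟨q, hq, hx⟩ := Nat.sSup_mem hne hbdd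
  exact ⟨sSup S, q, hq, hx, fun l q' hq' hx' => le_csSup hbdd ⟨q', hq', hx'⟩⟩

namespace IsLongestPath

variable {x : V} {k : ℕ} {p : ℕ → V}

theorem reverse (h : IsLongestPath G x k p) : IsLongestPath G x k fun s => p (k - s) where
  toIsPathOn := h.toIsPathOn.reverse
  mem := by
    obtain ⟨s, hs, hx⟩ := h.mem
    exact ⟨k - s, by omega, by rw [show k - (k - s) = s by omega, hx]⟩
  le := h.le

theorem exists_of_adj (h : IsLongestPath G x k p) {u : V} (hu : G.Adj (p 0) u) :
    ∃ s, 1 ≤ s ∧ s ≤ k ∧ p s = u := by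
  by_contra! hcon
  obtain ⟨s, hs, hx⟩ := h.mem
  have := h.le _ _ (h.toIsPathOn.cons hu (by
    intro s hs
    rcases s with - | s
    · exact hu.ne
    · exact hcon _ (by omega) hs)) ⟨s + 1, by omega, hx⟩
  omega

theorem exists_chord [Finite V] (h : IsLongestPath G x k p) (hd : 2 ≤ (G.neighborSet (p 0)).ncard) :
    ∃ j, 2 ≤ j ∧ j ≤ k ∧ G.Adj (p 0) (p j) := by
  obtain ⟨u, hu, hu1⟩ := Set.exists_mem_notMem_of_ncard_lt_ncard
    (show ({p 1} : Set V).ncard < (G.neighborSet (p 0)).ncard by rw [Set.ncard_singleton]; omega)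
  obtain ⟨j, hj1, hjk, rfl⟩ := h.exists_of_adj hu
  refine ⟨j, ?_, hjk, hu⟩
  by_contra hj
  obtain rfl : j = 1 := by omega
  exact hu1 rfl

end IsLongestPath

theorem IsPathOn.adj_of_chordAdj {k i j : ℕ} {p : ℕ → V} (h : IsPathOn G k p)
    (h0 : G.Adj (p 0) (p j)) (hk : G.Adj (p i) (p k)) {s t : ℕ} (hs : s ≤ k) (ht : t ≤ k)
    (hst : ChordAdj k i j s t) : G.Adj (p s) (p t) := by
  rcases hst with rfl | rfl | ⟨rfl, rfl⟩ | ⟨rfl, rfl⟩ | ⟨rfl, rfl⟩ | ⟨rfl, rfl⟩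
  exacts [h.adj _ (by omega), (h.adj _ (by omega)).symm, h0, h0.symm, hk, hk.symm]

theorem two_le_ncard_chordAdj {k i j s : ℕ} (hj2 : 2 ≤ j) (hjk : j ≤ k) (hik : i + 2 ≤ k)
    (hs : s ≤ k) : 2 ≤ {t | t ≤ k ∧ ChordAdj k i j s t}.ncard := by
  apply (Set.one_lt_ncard_iff ((Set.finite_Iic k).subset fun t ht => ht.1)).mpr
  rcases Nat.eq_zero_or_pos s with rfl | hs0
  · exact ⟨1, j, ⟨by omega, by simp [ChordAdj]⟩, ⟨hjk, by simp [ChordAdj]⟩, by omega⟩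
  rcases hs.eq_or_lt with rfl | hsk
  · exact ⟨s - 1, i, ⟨by omega, Or.inr (Or.inl (by omega))⟩, ⟨by omega, by simp [ChordAdj]⟩,
      by omega⟩
  · exact ⟨s - 1, s + 1, ⟨by omega, Or.inr (Or.inl (by omega))⟩, ⟨by omega, Or.inl rfl⟩, by omega⟩

theorem three_le_ncard_chordAdj {k i j s : ℕ} (hj2 : 2 ≤ j) (hjk : j ≤ k) (hik : i + 2 ≤ k)
    (hij : i ≠ j) (hne : ¬ (i = 0 ∧ j = k)) (hs : s = i ∨ s = j) :
    3 ≤ {t | t ≤ k ∧ ChordAdj k i j s t}.ncard := by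
  apply (Set.two_lt_ncard_iff ((Set.finite_Iic k).subset fun t ht => ht.1)).mpr
  rcases hs with rfl | rfl
  · rcases Nat.eq_zero_or_pos s with rfl | hs0
    · exact ⟨1, j, k, ⟨by omega, by simp [ChordAdj]⟩, ⟨hjk, by simp [ChordAdj]⟩,
        ⟨le_rfl, by simp [ChordAdj]⟩, by omega, by omega, by omega⟩
    · exact ⟨s - 1, s + 1, k, ⟨by omega, Or.inr (Or.inl (by omega))⟩, ⟨by omega, Or.inl rfl⟩,
        ⟨le_rfl, by simp [ChordAdj]⟩, by omega, by omega, by omega⟩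
  · rcases hjk.eq_or_lt with rfl | hsk
    · exact ⟨s - 1, 0, i, ⟨by omega, Or.inr (Or.inl (by omega))⟩, ⟨by omega, by simp [ChordAdj]⟩,
        ⟨by omega, by simp [ChordAdj]⟩, by omega, by omega, by omega⟩
    · exact ⟨s - 1, s + 1, 0, ⟨by omega, Or.inr (Or.inl (by omega))⟩, ⟨by omega, Or.inl rfl⟩,
        ⟨by omega, by simp [ChordAdj]⟩, by omega, by omega, by omega⟩

theorem IsPathOn.ncard_chordAdj_le [Finite V] {k i j s : ℕ} {p : ℕ → V} (h : IsPathOn G k p)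
    (h0 : G.Adj (p 0) (p j)) (hk : G.Adj (p i) (p k)) (hs : s ≤ k) :
    {t | t ≤ k ∧ ChordAdj k i j s t}.ncard ≤ (G.neighborSet (p s)).ncard := by
  rw [← Set.InjOn.ncard_image (f := p) (fun a ha b hb hab => h.inj a ha.1 b hb.1 hab)]
  refine Set.ncard_le_ncard ?_ (Set.toFinite _)
  rintro _ ⟨t, ht, rfl⟩
  exact h.adj_of_chordAdj h0 hk hs ht.1 ht.2

/-- A path with two chords has no further edges when these would exceed the degrees. -/
theorem IsPathOn.isChordPath [Finite V] {k i j : ℕ} {p : ℕ → V} (h : IsPathOn G k p)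
    (h0 : G.Adj (p 0) (p j)) (hk : G.Adj (p i) (p k))
    (hd : ∀ s ≤ k, (G.neighborSet (p s)).ncard ≤ {t | t ≤ k ∧ ChordAdj k i j s t}.ncard) :
    IsChordPath G k i j p where
  inj := h.inj
  adj_iff s hs v := by
    have hsub : p '' {t | t ≤ k ∧ ChordAdj k i j s t} ⊆ G.neighborSet (p s) := by
      rintro _ ⟨t, ht, rfl⟩
      exact h.adj_of_chordAdj h0 hk hs ht.1 ht.2
    have heq := Set.eq_of_subset_of_ncard_le hsub (by
      rw [Set.InjOn.ncard_image (fun a ha b hb hab => h.inj a ha.1 b hb.1 hab)]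
      exact hd s hs)
    rw [← SimpleGraph.mem_neighborSet, ← heq]
    simp only [Set.mem_image, Set.mem_ofPred_eq, and_assoc]

/-- In a graph of degrees two, a longest path closes up to a cycle, here with two equal chords. -/
theorem exists_cycle_of_regular [Finite V] (x : V) (hd : ∀ v, (G.neighborSet v).ncard = 2) :
    ∃ k p, 2 ≤ k ∧ IsChordPath G k 0 k p := by
  obtain ⟨k, p, h⟩ := exists_isLongestPath G x
  obtain ⟨j, hj2, hjk, h0⟩ := h.exists_chord (hd _).ge
  obtain rfl : j = k := by
    by_contra hne
    have : 2 < (G.neighborSet (p j)).ncard := by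
      refine (Set.two_lt_ncard_iff (Set.toFinite _)).mpr ⟨p (j - 1), p (j + 1), p 0, ?_,
        h.adj j (by omega),
        h0.symm, fun h1 => ?_, fun h1 => ?_, fun h1 => ?_⟩
      · have := h.adj (j - 1) (by omega)
        rw [show j - 1 + 1 = j by omega] at this
        exact this.symm
      · have := h.inj _ (by omega) _ (by omega) h1
        omega
      · have := h.inj _ (by omega) _ (by omega) h1
        omega
      · have := h.inj _ (by omega) _ (by omega) h1
        omega
    rw [hd] at this
    omega
  refine ⟨j, p, hj2, h.isChordPath h0 h0 fun s hs => ?_⟩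
  rw [hd]
  exact two_le_ncard_chordAdj hj2 le_rfl (by omega) hs

/-- The conditions on the chords of a path with chords `0 - j` and `i - k` under which the
chords are not edges of the path, have no common end and do not coincide. -/
structure ChordCondition (k i j : ℕ) : Prop where
  two_le : 2 ≤ j
  le : j ≤ k
  add_two_le : i + 2 ≤ k
  ne : i ≠ j
  not_cycle : ¬ (i = 0 ∧ j = k)

/-- Both ends of a longest path have neighbors on the path besides their successors. If the path
closes up to a cycle, it can be rotated such that its last vertex has a third neighbor. -/
theorem IsLongestPath.exists_chords [Finite V] {x : V} {k : ℕ} {p : ℕ → V}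
    (h : IsLongestPath G x k p) (hd : ∀ v, 2 ≤ (G.neighborSet v).ncard)
    (hd3 : ∀ v, (G.neighborSet v).ncard ≤ 3) (hx : (G.neighborSet x).ncard = 3) :
    ∃ i j p, IsPathOn G k p ∧ ChordCondition k i j ∧ G.Adj (p 0) (p j) ∧ G.Adj (p i) (p k) := by
  by_cases hcyc : G.Adj (p 0) (p k)
  · obtain ⟨t, ht, hpt⟩ := h.mem
    have hk2 : 2 ≤ k := by
      obtain ⟨j, hj2, hjk, -⟩ := h.exists_chord (hd _)
      omega
    -- The cycle is cut open behind `x`, so that `x` becomes the last vertex of a longest path.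
    have h' := h.toIsPathOn.rotate hcyc (t + 1)
    set q : ℕ → V := fun s => p ((s + (t + 1)) % (k + 1)) with hq
    have hqk : q k = x := by
      rw [← hpt, hq]
      simp only
      rw [show k + (t + 1) = t + (k + 1) by omega, Nat.add_mod_right, Nat.mod_eq_of_lt (by omega)]
    have hl : IsLongestPath G x k q := ⟨h', ⟨k, le_rfl, hqk⟩, h.le⟩
    have hq0 : G.Adj (q 0) (q k) := by
      rw [hqk, ← hpt]
      rcases ht.eq_or_lt with rfl | ht
      · simpa [hq] using hcyc
      · have := (h.adj t ht).symm
        simpa [hq, Nat.mod_eq_of_lt (show t + 1 < k + 1 by omega)] using this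
    obtain ⟨u, hu, hu'⟩ := Set.exists_mem_notMem_of_ncard_lt_ncard
      (show ({q 0, q (k - 1)} : Set V).ncard < (G.neighborSet x).ncard by
        rw [hx]
        exact lt_of_le_of_lt (Set.ncard_insert_le _ _) (by simp))
    obtain ⟨s, hs1, hsk, rfl⟩ := hl.reverse.exists_of_adj (u := u) (by simpa [hqk] using hu)
    have hs2 : s ≠ 1 := by
      rintro rfl
      exact hu' (by simp)
    have hsk' : s ≠ k := by
      rintro rfl
      exact hu' (by simp)
    refine ⟨k - s, k, q, h', ⟨by omega, le_rfl, by omega, by omega, by omega⟩, hq0, ?_⟩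
    rw [hqk]
    exact hu.symm
  · obtain ⟨j, hj2, hjk, h0⟩ := h.exists_chord (hd _)
    obtain ⟨i', hi2, hik, hk⟩ := h.reverse.exists_chord (hd _)
    simp only [Nat.sub_zero] at hk
    have hjk' : j ≠ k := by
      rintro rfl
      exact hcyc h0
    have hik' : i' ≠ k := by
      rintro rfl
      exact hcyc (by simpa using hk.symm)
    refine ⟨k - i', j, p, h.toIsPathOn, ⟨hj2, hjk, by omega, ?_, by omega⟩, h0, hk.symm⟩
    -- A common end of both chords would have the four neighbors `j - 1`, `j + 1`, `0` and `k`.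
    rintro rfl
    have h1 : p '' {k - i' - 1, k - i' + 1, 0, k} ⊆ G.neighborSet (p (k - i')) := by
      rintro _ ⟨t, ht, rfl⟩
      simp only [Set.mem_insert_iff, Set.mem_singleton_iff] at ht
      rcases ht with rfl | rfl | rfl | rfl
      · have := h.adj (k - i' - 1) (by omega)
        rw [show k - i' - 1 + 1 = k - i' by omega] at this
        exact this.symm
      · exact h.adj _ (by omega)
      · exact h0.symm
      · exact hk.symm
    have h2 := Set.ncard_le_ncard h1
    rw [Set.InjOn.ncard_image (by
      intro a ha b hb hab
      simp only [Set.mem_insert_iff, Set.mem_singleton_iff] at ha hb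
      exact h.inj a (by omega) b (by omega) hab)] at h2
    rw [Set.ncard_insert_of_notMem (by simp; omega), Set.ncard_insert_of_notMem (by simp; omega),
      Set.ncard_pair (by omega)] at h2
    have := hd3 (p (k - i'))
    omega

/-- A graph with two vertices of degree three and all others of degree two contains a component
which is a path with two chords. -/
theorem exists_isChordPath [Finite V] {x x' : V}
    (hd : ∀ v, (G.neighborSet v).ncard = 2 ∨ (G.neighborSet v).ncard = 3 ∧ (v = x ∨ v = x'))
    (hx : (G.neighborSet x).ncard = 3) :
    ∃ k i j p, ChordCondition k i j ∧ IsChordPath G k i j p ∧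
      (∀ s ≤ k, (G.neighborSet (p s)).ncard = if s = i ∨ s = j then 3 else 2) ∧
      ∀ v, (∀ s ≤ k, p s ≠ v) → (G.neighborSet v).ncard = 2 := by
  obtain ⟨k, p, h⟩ := exists_isLongestPath G x
  obtain ⟨i, j, p, hp, hc, h0, hk⟩ := h.exists_chords (fun v => by rcases hd v with h | h <;> omega)
    (fun v => by rcases hd v with h | h <;> omega) hx
  have key : ∀ s, s = i ∨ s = j → (G.neighborSet (p s)).ncard = 3 ∧ (p s = x ∨ p s = x') := by
    intro s hs
    refine (hd (p s)).resolve_left fun h2 => ?_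
    have h3 := hp.ncard_chordAdj_le h0 hk (s := s) (by have := hc.le; have := hc.add_two_le; omega)
    have := three_le_ncard_chordAdj hc.two_le hc.le hc.add_two_le hc.ne hc.not_cycle hs
    omega
  have hpij : p i ≠ p j := fun h1 => hc.ne (hp.inj _ (by have := hc.add_two_le; omega) _ hc.le h1)
  have hmem : ∀ v, v = x ∨ v = x' → v = p i ∨ v = p j := by
    have h1 := (key i (Or.inl rfl)).2
    have h2 := (key j (Or.inr rfl)).2
    grind
  have hdeg : ∀ s ≤ k, (G.neighborSet (p s)).ncard = if s = i ∨ s = j then 3 else 2 := by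
    intro s hs
    split_ifs with h1
    · exact (key s h1).1
    · refine (hd (p s)).resolve_right fun h2 => h1 ?_
      rcases hmem _ h2.2 with h3 | h3
      · exact Or.inl (hp.inj _ hs _ (by have := hc.add_two_le; omega) h3)
      · exact Or.inr (hp.inj _ hs _ hc.le h3)
  refine ⟨k, i, j, p, hc, hp.isChordPath h0 hk fun s hs => ?_, hdeg, fun v hv => ?_⟩
  · rw [hdeg s hs]
    split_ifs with h1
    · exact three_le_ncard_chordAdj hc.two_le hc.le hc.add_two_le hc.ne hc.not_cycle h1
    · exact two_le_ncard_chordAdj hc.two_le hc.le hc.add_two_le hs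
  · refine (hd v).resolve_right fun h2 => ?_
    rcases hmem _ h2.2 with h3 | h3
    · exact hv i (by have := hc.add_two_le; omega) h3.symm
    · exact hv j hc.le h3.symm

end LongestPath

/-! ### Permanents of graphs -/

section GraphPermanents

open Matrix

universe u

open Classical in
/-- The matrix `x - D(G) + A(G)` for `x = y + 2`, where vertices of degree two have weight `y`. -/
noncomputable def weightMatrix {V : Type u} (G : SimpleGraph V) (y : ℝ) : Matrix V V ℝ :=
  Matrix.of fun u v =>
    if u = v then y + 2 - (G.neighborSet u).ncard else if G.Adj u v then 1 else 0

variable {V : Type u} {G : SimpleGraph V}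

theorem ncard_neighborSet_induce {s : Set V} {v : s} (h : ∀ u, G.Adj v u → u ∈ s) :
    ((G.induce s).neighborSet v).ncard = (G.neighborSet v).ncard := by
  rw [← Set.InjOn.ncard_image (f := Subtype.val) Subtype.val_injective.injOn]
  congr 1
  ext u
  constructor
  · rintro ⟨u, hu, rfl⟩
    exact hu
  · intro hu
    exact ⟨⟨u, h u hu⟩, hu, rfl⟩

/-- The permanent of a graph factors over a set of vertices which is closed under adjacency. -/
theorem permanent_weightMatrix_of_closed [Fintype V] [DecidableEq V] {α : Type*} [Fintype α]
    [DecidableEq α] {g : α → V} (hg : Function.Injective g)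
    (hc : ∀ a v, G.Adj (g a) v → v ∈ Set.range g) [Fintype ↥(Set.range g)ᶜ]
    [DecidableEq ↥(Set.range g)ᶜ] (y : ℝ) :
    (weightMatrix G y).permanent = ((weightMatrix G y).submatrix g g).permanent *
      (weightMatrix (G.induce (Set.range g)ᶜ) y).permanent := by
  classical
  let e : α ⊕ ↥(Set.range g)ᶜ ≃ V := ((Equiv.ofInjective g hg).sumCongr (Equiv.refl _)).trans
    (Equiv.Set.sumCompl (Set.range g))
  have hel : ∀ a, e (.inl a) = g a := fun a => rfl
  have her : ∀ v, e (.inr v) = v := fun v => rfl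
  have hcard : ∀ v : ↥(Set.range g)ᶜ, ((G.induce (Set.range g)ᶜ).neighborSet v).ncard =
      (G.neighborSet v).ncard := fun v => ncard_neighborSet_induce (by
    rintro u hu ⟨a, rfl⟩
    exact v.2 (hc a v hu.symm))
  rw [← permanent_submatrix_equiv e, ← permanent_fromBlocks_zero]
  congr 1
  ext a b
  rcases a with a | a <;> rcases b with b | b
  · rfl
  · have h1 : g a ≠ b := fun h => b.2 ⟨a, h⟩
    have h2 : ¬ G.Adj (g a) b := fun h => b.2 (hc a b h)
    simp [weightMatrix, hel, her, h1, h2]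
  · have h1 : (a : V) ≠ g b := fun h => a.2 ⟨b, h.symm⟩
    have h2 : ¬ G.Adj a (g b) := fun h => a.2 (hc b a h.symm)
    simp [weightMatrix, hel, her, h1, h2]
  · simp [weightMatrix, her, hcard, Subtype.ext_iff]

theorem IsChordPath.weightMatrix_apply {k i j : ℕ} {p : ℕ → V} (h : IsChordPath G k i j p) (y : ℝ)
    {s t : ℕ} (hs : s ≤ k) (ht : t ≤ k) : weightMatrix G y (p s) (p t) =
      if s = t then y + 2 - (G.neighborSet (p s)).ncard
      else if ChordAdj k i j s t then 1 else 0 := by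
  have h1 : p s = p t ↔ s = t := ⟨h.inj s hs t ht, fun h => by rw [h]⟩
  simp only [weightMatrix, of_apply, h1, h.adj_iff_chordAdj hs ht]

/-- The permanent of a graph factors over a path with chords, whose vertices `e` lists in any order,
and the remaining graph `H`. -/
theorem IsChordPath.permanent [Fintype V] [DecidableEq V] {α : Type*} [Fintype α]
    [DecidableEq α] {k i j : ℕ} {p : ℕ → V} (h : IsChordPath G k i j p) {e : α → ℕ}
    (he : Function.Injective e) (hek : ∀ a, e a ≤ k) (hes : ∀ t ≤ k, ∃ a, e a = t) :
    ∃ (W : Type u) (_ : Fintype W) (_ : DecidableEq W) (H : SimpleGraph W),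
      Fintype.card V = Fintype.card α + Fintype.card W ∧
      ((∀ v, (∀ s ≤ k, p s ≠ v) → (G.neighborSet v).ncard = 2) →
        ∀ v, (H.neighborSet v).ncard = 2) ∧
      ∀ y, (weightMatrix G y).permanent = (Matrix.of fun a b =>
        if e a = e b then y + 2 - (G.neighborSet (p (e a))).ncard
        else if ChordAdj k i j (e a) (e b) then 1 else 0).permanent *
          (weightMatrix H y).permanent := by
  classical
  have hg : Function.Injective (p ∘ e) := fun a b hab => he (h.inj _ (hek a) _ (hek b) hab)
  have hc : ∀ a v, G.Adj ((p ∘ e) a) v → v ∈ Set.range (p ∘ e) := by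
    intro a v hv
    obtain ⟨t, ht, -, rfl⟩ := (h.adj_iff _ (hek a) v).mp hv
    obtain ⟨b, rfl⟩ := hes t ht
    exact ⟨b, rfl⟩
  refine ⟨↥(Set.range (p ∘ e))ᶜ, inferInstance, inferInstance, G.induce (Set.range (p ∘ e))ᶜ,
    ?_, ?_, ?_⟩
  · rw [← Set.card_range_of_injective hg]
    rw [← Fintype.card_sum]
    exact (Fintype.card_congr (Equiv.Set.sumCompl (Set.range (p ∘ e)))).symm
  · intro hd v
    rw [ncard_neighborSet_induce]
    · apply hd
      intro s hs hsv
      obtain ⟨a, rfl⟩ := hes s hs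
      exact v.2 ⟨a, hsv⟩
    · rintro u hu ⟨a, rfl⟩
      exact v.2 (hc a v hu.symm)
  · intro y
    rw [permanent_weightMatrix_of_closed hg hc]
    congr 2
    ext a b
    exact h.weightMatrix_apply y (hek a) (hek b)

/-- A graph of degrees two is a disjoint union of cycles, here in the form of its permanent. -/
theorem permanent_weightMatrix_of_regular (n : ℕ) : ∀ (V : Type u) [Fintype V] [DecidableEq V]
    (G : SimpleGraph V), Fintype.card V = n → (∀ v, (G.neighborSet v).ncard = 2) →
    ∃ K : Multiset ℕ, (∀ k ∈ K, 3 ≤ k) ∧ K.sum = n ∧ ∀ w : ℝ, w ≠ 0 →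
      w ^ n * (weightMatrix G (1 / w - w)).permanent = (K.map (cycleVal w)).prod := by
  induction n using Nat.strong_induction_on with
  | _ n ih =>
    intro V _ _ G hn hd
    rcases isEmpty_or_nonempty V with hV | ⟨⟨x⟩⟩
    · refine ⟨0, by simp, by rw [← hn]; simp, fun w hw => ?_⟩
      rw [← hn]
      simp [permanent_isEmpty]
    obtain ⟨k, p, hk, h⟩ := exists_cycle_of_regular x hd
    obtain ⟨m, rfl⟩ := Nat.exists_eq_add_of_le' hk
    obtain ⟨W, _, _, H, h1, h2, h3⟩ := h.permanent
      (e := (Sum.elim (fun _ => 0) (fun a => a.val + 1) : Unit ⊕ Fin (m + 2) → ℕ))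
      (by
        rintro (a | a) (b | b) hab
        · rfl
        · simp at hab
        · simp at hab
        · exact congrArg Sum.inr (Fin.ext (by simpa using hab)))
      (by
        rintro (a | a)
        · simp
        · simp
          omega)
      (by
        intro t ht
        rcases t with - | t
        · exact ⟨.inl (), rfl⟩
        · exact ⟨.inr ⟨t, by omega⟩, rfl⟩)
    simp only [Fintype.card_sum, Fintype.card_unit, Fintype.card_fin] at h1
    obtain ⟨K, hK, hsum, hper⟩ := ih (Fintype.card W) (by omega) W H rfl (h2 fun v _ => hd v)
    refine ⟨(m + 3) ::ₘ K, ?_, ?_, fun w hw => ?_⟩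
    · simp only [Multiset.mem_cons, forall_eq_or_imp]
      exact ⟨by omega, hK⟩
    · rw [Multiset.sum_cons, hsum]
      omega
    · rw [Multiset.map_cons, Multiset.prod_cons, ← hper w hw, ← permanent_cycle w hw, h3,
        ← hn, h1, show 1 + (m + 2) + Fintype.card W = m + 3 + Fintype.card W by omega, pow_add]
      have : earMatrix (diagonal fun _ : Unit => 1 / w - w) () () (1 / w - w) (m + 2) =
          Matrix.of fun a b => if (Sum.elim (fun _ => 0) (fun a => a.val + 1) a : ℕ) =
            Sum.elim (fun _ => 0) (fun a => a.val + 1) b then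
            1 / w - w + 2 -
              ((G.neighborSet (p (Sum.elim (fun _ => 0) (fun a => a.val + 1) a))).ncard : ℝ)
          else if ChordAdj (m + 2) 0 (m + 2) (Sum.elim (fun _ => 0) (fun a => a.val + 1) a)
            (Sum.elim (fun _ => 0) (fun a => a.val + 1) b) then 1 else 0 := by
        ext a b
        rw [cycleVertex_apply, of_apply, hd]
        congr 1
        push_cast
        ring
      rw [this]
      ring

theorem IsChordPath.permanent_dumbbell [Fintype V] [DecidableEq V] {p q r : ℕ} {x : ℕ → V}
    (h : IsChordPath G (p + q + r + 5) (p + r + 3) (p + 2) x)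
    (hd : ∀ s ≤ p + q + r + 5, (G.neighborSet (x s)).ncard =
      if s = p + r + 3 ∨ s = p + 2 then 3 else 2)
    (hd2 : ∀ v, (∀ s ≤ p + q + r + 5, x s ≠ v) → (G.neighborSet v).ncard = 2) :
    ∃ K : Multiset ℕ, (∀ k ∈ K, 3 ≤ k) ∧ p + q + r + 6 + K.sum = Fintype.card V ∧
      ∀ w : ℝ, w ≠ 0 → w ^ Fintype.card V * (1 + w ^ 2) ^ 3 *
        (weightMatrix G (1 / w - w)).permanent =
          dumbbellVal w (p + 3) (q + 3) (r + 2) * (K.map (cycleVal w)).prod := by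
  obtain ⟨W, _, _, H, h1, h2, h3⟩ := h.permanent (dumbbellVertex_injective p q r)
    (dumbbellVertex_le p q r) fun t => exists_dumbbellVertex
  obtain ⟨K, hK, hsum, hper⟩ := permanent_weightMatrix_of_regular _ W H rfl (h2 hd2)
  simp only [Fintype.card_sum, Fintype.card_fin] at h1
  refine ⟨K, hK, by omega, fun w hw => ?_⟩
  rw [← hper w hw, ← _root_.permanent_dumbbell w hw, h3, h1,
    show 2 + r + (p + 2) + (q + 2) + Fintype.card W = p + q + r + 6 + Fintype.card W by omega,
    pow_add]
  rw [congrArg Matrix.permanent (show _ = earMatrix (earMatrix (earMatrix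
    (coreMatrix (1 / w - w - 1)) 0 1 (1 / w - w) r) (.inl 0) (.inl 0) (1 / w - w) (p + 2))
    (.inl (.inl 1)) (.inl (.inl 1)) (1 / w - w) (q + 2) by
      ext a b
      rw [dumbbellVertex_apply, of_apply, hd _ (dumbbellVertex_le p q r a)]
      congr 1
      split_ifs <;> push_cast <;> ring)]
  ring

theorem IsChordPath.permanent_theta [Fintype V] [DecidableEq V] {m n l : ℕ} {x : ℕ → V}
    (hmn : 1 ≤ m + n) (hml : 1 ≤ m + l) (hnl : 1 ≤ n + l)
    (h : IsChordPath G (m + n + l + 1) n (m + n + 1) x)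
    (hd : ∀ s ≤ m + n + l + 1, (G.neighborSet (x s)).ncard =
      if s = n ∨ s = m + n + 1 then 3 else 2)
    (hd2 : ∀ v, (∀ s ≤ m + n + l + 1, x s ≠ v) → (G.neighborSet v).ncard = 2) :
    ∃ K : Multiset ℕ, (∀ k ∈ K, 3 ≤ k) ∧ m + n + l + 2 + K.sum = Fintype.card V ∧
      ∀ w : ℝ, w ≠ 0 → w ^ Fintype.card V * (1 + w ^ 2) ^ 3 *
        (weightMatrix G (1 / w - w)).permanent =
          thetaVal w (m + 1) (n + 1) (l + 1) * (K.map (cycleVal w)).prod := by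
  obtain ⟨W, _, _, H, h1, h2, h3⟩ := h.permanent (thetaVertex_injective m n l)
    (thetaVertex_le m n l) fun t => exists_thetaVertex
  obtain ⟨K, hK, hsum, hper⟩ := permanent_weightMatrix_of_regular _ W H rfl (h2 hd2)
  simp only [Fintype.card_sum, Fintype.card_fin] at h1
  refine ⟨K, hK, by omega, fun w hw => ?_⟩
  rw [← hper w hw, ← _root_.permanent_theta w hw, h3, h1,
    show 2 + m + n + l + Fintype.card W = m + n + l + 2 + Fintype.card W by omega,
    pow_add]
  rw [congrArg Matrix.permanent (show _ = earMatrix (earMatrix (earMatrix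
    (coreMatrix (1 / w - w - 1)) 0 1 (1 / w - w) m) (.inl 0) (.inl 1) (1 / w - w) n) (.inl (.inl 0)) (.inl (.inl 1)) (1 / w - w) l by
      ext a b
      rw [thetaVertex_apply _ _ _ _ hmn hml hnl, of_apply, hd _ (thetaVertex_le m n l a)]
      congr 1
      split_ifs <;> push_cast <;> ring)]
  ring

theorem neighborSet_ncard_eq_degree {V : Type*} [Fintype V] (G : SimpleGraph V) [DecidableRel G.Adj]
    (v : V) : (G.neighborSet v).ncard = G.degree v := by
  rw [← SimpleGraph.card_neighborSet_eq_degree, Set.ncard_eq_toFinset_card']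
  simp

theorem eval₂_lapPermPoly_eq_permanent [Fintype V] [DecidableEq V] (G : SimpleGraph V)
    [DecidableRel G.Adj] (y : ℝ) :
    (lapPermPoly G).eval₂ (Int.castRingHom ℝ) (y + 2) = (weightMatrix G y).permanent := by
  rw [eval₂_lapPermPoly]
  congr 1
  ext u v
  have h := neighborSet_ncard_eq_degree G u
  rcases eq_or_ne u v with rfl | huv
  · simp [weightMatrix, h]
  · simp [weightMatrix, huv, SimpleGraph.adjMatrix_apply]

end GraphPermanents

/-! ### The graph `d(p, q, r)` -/

section Bicyclic

open Matrix

theorem IsChordPath.reverse {V : Type*} {G : SimpleGraph V} {k i j : ℕ} {p : ℕ → V}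
    (h : IsChordPath G k i j p) (hi : i ≤ k) (hj : j ≤ k) :
    IsChordPath G k (k - j) (k - i) fun s => p (k - s) where
  inj s hs t ht hst := by
    have := h.inj _ (by omega) _ (by omega) hst
    omega
  adj_iff s hs v := by
    have hc : ∀ t ≤ k, ChordAdj k (k - j) (k - i) s t ↔ ChordAdj k i j (k - s) (k - t) := by
      intro t ht
      unfold ChordAdj
      omega
    rw [h.adj_iff _ (by omega)]
    constructor
    · rintro ⟨t, ht, h1, rfl⟩
      refine ⟨k - t, by omega, (hc _ (by omega)).mpr ?_, ?_⟩ <;> rw [show k - (k - t) = t by omega]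
      exact h1
    · rintro ⟨t, ht, h1, rfl⟩
      exact ⟨k - t, by omega, (hc t ht).mp h1, rfl⟩

theorem IsChordPath.exists_equiv {V : Type*} [Fintype V] {G : SimpleGraph V} {k i j : ℕ}
    {p : ℕ → V} (h : IsChordPath G k i j p) (hV : Fintype.card V = k + 1) :
    ∃ e : Fin (k + 1) ≃ V, ∀ s, e s = p s :=
  ⟨Equiv.ofBijective (fun s : Fin (k + 1) => p s)
    ((Fintype.bijective_iff_injective_and_card _).mpr
      ⟨fun s t hst => Fin.ext (h.inj _ (by omega) _ (by omega) hst), by simp [hV]⟩), fun _ => rfl⟩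

theorem IsChordPath.nonempty_iso {V W : Type*} [Fintype V] [Fintype W] {G : SimpleGraph V}
    {H : SimpleGraph W} {k i j : ℕ} {p : ℕ → V} {q : ℕ → W} (h : IsChordPath G k i j p)
    (h' : IsChordPath H k i j q) (hV : Fintype.card V = k + 1) (hW : Fintype.card W = k + 1) :
    Nonempty (G ≃g H) := by
  obtain ⟨e, he⟩ := h.exists_equiv hV
  obtain ⟨e', he'⟩ := h'.exists_equiv hW
  refine ⟨⟨e.symm.trans e', ?_⟩⟩
  intro u v
  obtain ⟨s, rfl⟩ := e.surjective u
  obtain ⟨t, rfl⟩ := e.surjective v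
  rw [Equiv.trans_apply, Equiv.trans_apply, e.symm_apply_apply, e.symm_apply_apply, he, he, he',
    he', h.adj_iff_chordAdj (by omega) (by omega), h'.adj_iff_chordAdj (by omega) (by omega)]

theorem IsChordPath.ncard_neighborSet {V : Type*} {G : SimpleGraph V} {k i j : ℕ} {p : ℕ → V}
    (h : IsChordPath G k i j p) {s : ℕ} (hs : s ≤ k) :
    (G.neighborSet (p s)).ncard = {t | t ≤ k ∧ ChordAdj k i j s t}.ncard := by
  rw [← Set.InjOn.ncard_image (f := p) (fun a ha b hb hab => h.inj a ha.1 b hb.1 hab)]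
  congr 1
  ext v
  rw [SimpleGraph.mem_neighborSet, h.adj_iff s hs]
  simp only [Set.mem_image, Set.mem_ofPred_eq, and_assoc]

theorem ncard_chordAdj_dumbbell {k i j s : ℕ} (hj : 2 ≤ j) (hji : j < i) (hik : i + 2 ≤ k)
    (hs : s ≤ k) : {t | t ≤ k ∧ ChordAdj k i j s t}.ncard = if s = i ∨ s = j then 3 else 2 := by
  by_cases h0 : s = 0
  · rw [show {t | t ≤ k ∧ ChordAdj k i j s t} = {1, j} by
      ext t
      simp [ChordAdj]
      omega, Set.ncard_pair (by omega), if_neg (by omega)]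
  by_cases hsj : s = j
  · rw [show {t | t ≤ k ∧ ChordAdj k i j s t} = {0, j - 1, j + 1} by
      ext t
      simp [ChordAdj]
      omega, Set.ncard_insert_of_notMem (by simp; omega), Set.ncard_pair (by omega),
      if_pos (Or.inr hsj)]
  by_cases hsi : s = i
  · rw [show {t | t ≤ k ∧ ChordAdj k i j s t} = {k, i - 1, i + 1} by
      ext t
      simp [ChordAdj]
      omega, Set.ncard_insert_of_notMem (by simp; omega), Set.ncard_pair (by omega),
      if_pos (Or.inl hsi)]
  by_cases hsk : s = k
  · rw [show {t | t ≤ k ∧ ChordAdj k i j s t} = {i, k - 1} by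
      ext t
      simp [ChordAdj]
      omega, Set.ncard_pair (by omega), if_neg (by omega)]
  · rw [show {t | t ≤ k ∧ ChordAdj k i j s t} = {s - 1, s + 1} by
      ext t
      simp [ChordAdj]
      omega, Set.ncard_pair (by omega), if_neg (by omega)]

theorem cycleGraph_adj_iff {n : ℕ} (hn : 2 ≤ n) (u v : Fin n) : (SimpleGraph.cycleGraph n).Adj u v ↔
    u.val + 1 = v ∨ v.val + 1 = u ∨ u.val = 0 ∧ v.val + 1 = n ∨ v.val = 0 ∧ u.val + 1 = n := by
  rw [SimpleGraph.cycleGraph_adj', Fin.sub_def, Fin.sub_def]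
  have hu := u.isLt
  have hv := v.isLt
  simp only
  have key : ∀ a b : ℕ, a < n → b < n → (n - b + a) % n = if b ≤ a then a - b else n - b + a := by
    intro a b ha hb
    split_ifs with hab
    · rw [show n - b + a = a - b + n by omega, Nat.add_mod_right, Nat.mod_eq_of_lt (by omega)]
    · exact Nat.mod_eq_of_lt (by omega)
  rw [key _ _ hu hv, key _ _ hv hu]
  split_ifs <;> omega

theorem exists_map_blockEmb_adj {m c a b : ℕ} (F : SimpleGraph (Fin m)) (P : ℕ → ℕ → Prop)
    (hF : ∀ u v, F.Adj u v ↔ P u.val v.val) : (F.map (blockEmb c m)).Adj a b ↔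
      c ≤ a ∧ a < c + m ∧ c ≤ b ∧ b < c + m ∧ P (a - c) (b - c) := by
  rw [SimpleGraph.map_adj]
  constructor
  · rintro ⟨u, v, h, rfl, rfl⟩
    have hu := u.isLt
    have hv := v.isLt
    simp only [blockEmb, Function.Embedding.trans_apply, Fin.valEmbedding_apply,
      addLeftEmbedding_apply, Nat.add_sub_cancel_left]
    exact ⟨by omega, by omega, by omega, by omega, (hF u v).mp h⟩
  · rintro ⟨h1, h2, h3, h4, h5⟩
    refine ⟨⟨a - c, by omega⟩, ⟨b - c, by omega⟩, (hF _ _).mpr h5, ?_, ?_⟩ <;>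
      simp only [blockEmb, Function.Embedding.trans_apply, Fin.valEmbedding_apply,
        addLeftEmbedding_apply] <;> omega

theorem bicyclicD_adj {p q r : ℕ} (u v : Fin (p + 3 + (q + 3) + (r + 2) - 2)) :
    (bicyclicD (p + 3) (q + 3) (r + 2)).Adj u v ↔
      ChordAdj (p + q + r + 5) (p + r + 3) (p + 2) u v := by
  have hu := u.isLt
  have hv := v.isLt
  rw [bicyclicD, SimpleGraph.comap_adj, SimpleGraph.sup_adj, SimpleGraph.sup_adj,
    exists_map_blockEmb_adj _ (fun a b => a + 1 = b ∨ b + 1 = a ∨ a = 0 ∧ b + 1 = p + 3 ∨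
      b = 0 ∧ a + 1 = p + 3) (fun a b => cycleGraph_adj_iff (by omega) a b),
    exists_map_blockEmb_adj _ (fun a b => a + 1 = b ∨ b + 1 = a)
      (fun a b => SimpleGraph.pathGraph_adj),
    exists_map_blockEmb_adj _ (fun a b => a + 1 = b ∨ b + 1 = a ∨ a = 0 ∧ b + 1 = q + 3 ∨
      b = 0 ∧ a + 1 = q + 3) (fun a b => cycleGraph_adj_iff (by omega) a b)]
  unfold ChordAdj
  omega

theorem exists_isChordPath_bicyclicD (p q r : ℕ) :
    ∃ x, IsChordPath (bicyclicD (p + 3) (q + 3) (r + 2)) (p + q + r + 5) (p + r + 3) (p + 2) x ∧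
      ∀ v : Fin (p + 3 + (q + 3) + (r + 2) - 2), x v = v := by
  refine ⟨fun s => if h : s < p + 3 + (q + 3) + (r + 2) - 2 then ⟨s, h⟩ else ⟨0, by omega⟩,
    ⟨?_, ?_⟩, fun v => by simp⟩
  · intro s hs t ht hst
    rw [dif_pos (by omega), dif_pos (by omega)] at hst
    exact congrArg Fin.val hst
  · intro s hs v
    rw [dif_pos (by omega), bicyclicD_adj]
    constructor
    · intro h
      exact ⟨v, by omega, h, by simp⟩
    · rintro ⟨t, ht, h, rfl⟩
      rwa [dif_pos (by omega)]

theorem ncard_neighborSet_bicyclicD {p q r : ℕ} (v : Fin (p + 3 + (q + 3) + (r + 2) - 2)) :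
    ((bicyclicD (p + 3) (q + 3) (r + 2)).neighborSet v).ncard =
      if v.val = p + r + 3 ∨ v.val = p + 2 then 3 else 2 := by
  obtain ⟨x, hx, hxv⟩ := exists_isChordPath_bicyclicD p q r
  have hv := v.isLt
  have h := hx.ncard_neighborSet (s := v) (by omega)
  rwa [hxv, ncard_chordAdj_dumbbell (by omega) (by omega) (by omega) (by omega)] at h

/-- The moments force two values three and all other values two: `(d - 2) * (d - 3)` is nonnegative
for integers `d`, and its sum vanishes. -/
theorem exists_degrees_of_moments {V : Type*} [Fintype V] (d : V → ℤ)
    (h1 : ∑ v, (d v - 2) = 2) (h2 : ∑ v, (d v - 2) ^ 2 = 2) :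
    ∃ x x', d x = 3 ∧ ∀ v, d v = 2 ∨ d v = 3 ∧ (v = x ∨ v = x') := by
  classical
  have hnn : ∀ v ∈ Finset.univ, 0 ≤ (d v - 2) * (d v - 3) := by
    intro v _
    rcases le_or_gt (d v) 2 with h | h
    · nlinarith
    · exact mul_nonneg (by omega) (by omega)
  have hsum : ∑ v, (d v - 2) * (d v - 3) = 0 := by
    rw [Finset.sum_congr rfl fun v _ => show (d v - 2) * (d v - 3) = (d v - 2) ^ 2 - (d v - 2) by
      ring, Finset.sum_sub_distrib, h1, h2, sub_self]
  have hd : ∀ v, d v = 2 ∨ d v = 3 := by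
    intro v
    have := (Finset.sum_eq_zero_iff_of_nonneg hnn).mp hsum v (Finset.mem_univ v)
    rcases mul_eq_zero.mp this with h | h
    · exact Or.inl (by omega)
    · exact Or.inr (by omega)
  have hcard : (Finset.univ.filter fun v => d v = 3).card = 2 := by
    have : ∀ v, d v - 2 = if d v = 3 then 1 else 0 := by
      intro v
      rcases hd v with h | h <;> simp [h]
    rw [Finset.sum_congr rfl fun v _ => this v, Finset.sum_boole] at h1
    exact_mod_cast h1
  obtain ⟨x, x', -, hxx⟩ := Finset.card_eq_two.mp hcard
  have hmem : ∀ v, d v = 3 ↔ v = x ∨ v = x' := by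
    intro v
    have : v ∈ (Finset.univ.filter fun v => d v = 3) ↔ v ∈ ({x, x'} : Finset V) := by rw [hxx]
    simpa using this
  exact ⟨x, x', (hmem x).mpr (Or.inl rfl), fun v => (hd v).imp_right fun h => ⟨h, (hmem v).mp h⟩⟩

theorem thetaVal_swap_left {R : Type*} [CommRing R] (w : R) (a b c : ℕ) :
    thetaVal w a b c = thetaVal w b a c := by
  simp only [thetaVal, add_comm b a]
  ring

theorem thetaVal_swap_right {R : Type*} [CommRing R] (w : R) (a b c : ℕ) :
    thetaVal w a b c = thetaVal w a c b := by
  simp only [thetaVal, add_comm c b]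
  ring

theorem dumbbell_ne_theta_of_unsorted {p q r a b c : ℕ} {K : Multiset ℕ} (hp : 3 ≤ p) (hq : 3 ≤ q)
    (hr : 2 ≤ r) (ha : 1 ≤ a) (hb : 1 ≤ b) (hc : 1 ≤ c) (hab : 3 ≤ a + b) (hac : 3 ≤ a + c)
    (hbc : 3 ≤ b + c) (hK : ∀ k ∈ K, 3 ≤ k) (hsum : p + q + r = a + b + c + 1 + K.sum)
    (h : dumbbellVal (X : ℤ[X]) p q r = thetaVal X a b c * (K.map (cycleVal X)).prod) : False := by
  wlog hpq : p ≤ q generalizing p q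
  · exact this hq hp (by omega) (by rw [dumbbellVal_swap, h]) (by omega)
  wlog h1 : a ≤ b ∧ a ≤ c generalizing a b c
  · rcases le_or_gt b c with h2 | h2
    · exact this hb ha hc (by omega) hbc hac (by omega) (by rw [h, thetaVal_swap_left]) (by omega)
    · exact this hc ha hb (by omega) (by omega) hab (by omega)
        (by rw [h, thetaVal_swap_right, thetaVal_swap_left]) (by omega)
  wlog h2 : b ≤ c generalizing b c
  · exact this hc hb hac hab (by omega) (by omega) (by rw [h, thetaVal_swap_right]) h1.symm
      (by omega)
  exact dumbbell_ne_theta hp hpq hr ha (by omega) h1.1 h2 hK hsum h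

end Bicyclic

/-! ### Determination by the Laplacian permanental polynomial -/

theorem theorem1p1 (p q r : ℕ) (hp : 3 ≤ p) (hq : 3 ≤ q) (hr : 2 ≤ r)
    [DecidableRel (bicyclicD p q r).Adj]
    {V : Type*} [Fintype V] [DecidableEq V] (G : SimpleGraph V) [DecidableRel G.Adj]
    (h : lapPermPoly G = lapPermPoly (bicyclicD p q r)) :
    Nonempty (G ≃g bicyclicD p q r) := by
  obtain ⟨p, rfl⟩ := Nat.exists_eq_add_of_le' hp
  obtain ⟨q, rfl⟩ := Nat.exists_eq_add_of_le' hq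
  obtain ⟨r, rfl⟩ := Nat.exists_eq_add_of_le' hr
  obtain ⟨hcard, hdeg1, hdeg2⟩ := moments_eq_of_lapPermPoly_eq G _ h
  have hcardD : Fintype.card (Fin (p + 3 + (q + 3) + (r + 2) - 2)) = p + q + r + 6 := by
    rw [Fintype.card_fin]
    omega
  have hdD : ∀ v, ((bicyclicD (p + 3) (q + 3) (r + 2)).degree v : ℤ) =
       2 + if v.val = p + r + 3 ∨ v.val = p + 2 then 1 else 0 := by
    intro v
    rw [← neighborSet_ncard_eq_degree, ncard_neighborSet_bicyclicD]
    split_ifs <;> rfl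
  have hsumD : ∑ v : Fin (p + 3 + (q + 3) + (r + 2) - 2),
      (if v.val = p + r + 3 ∨ v.val = p + 2 then 1 else 0 : ℤ) = 2 := by
    rw [Finset.sum_boole, show (Finset.univ.filter fun v : Fin (p + 3 + (q + 3) + (r + 2) - 2) =>
      v.val = p + r + 3 ∨ v.val = p + 2) = {⟨p + r + 3, by omega⟩, ⟨p + 2, by omega⟩} by
        ext v
        simp [Fin.ext_iff], Finset.card_pair (by simp [Fin.ext_iff]; omega)]
    rfl
  obtain ⟨x, x', hx, hxx⟩ := exists_degrees_of_moments (fun v => (G.degree v : ℤ))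
    (by
      rw [Finset.sum_sub_distrib, hdeg1, Finset.sum_congr rfl fun v _ => hdD v,
        Finset.sum_add_distrib, hsumD]
      simp only [Finset.sum_const, Finset.card_univ, hcard]
      ring)
    (by
      rw [Finset.sum_congr rfl fun v _ => show ((G.degree v : ℤ) - 2) ^ 2 =
        (G.degree v : ℤ) ^ 2 - 4 * (G.degree v : ℤ) + 4 by ring, Finset.sum_add_distrib,
        Finset.sum_sub_distrib, ← Finset.mul_sum, hdeg1, hdeg2, Finset.mul_sum,
        ← Finset.sum_sub_distrib, Finset.sum_const, Finset.card_univ, hcard, ← Finset.card_univ,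
        ← Finset.sum_const, ← Finset.sum_add_distrib]
      refine Eq.trans (Finset.sum_congr rfl fun v _ => ?_) hsumD
      rw [hdD]
      split_ifs <;> norm_num)
  obtain ⟨k, i, j, y, hc, hy, hd, hd2⟩ := exists_isChordPath (G := G) (x := x) (x' := x')
    (fun v => by
      rw [neighborSet_ncard_eq_degree]
      exact_mod_cast hxx v)
    (by
      rw [neighborSet_ncard_eq_degree]
      exact_mod_cast hx)
  obtain ⟨z, hz, hzv⟩ := exists_isChordPath_bicyclicD p q r
  obtain ⟨L, hL, hLsum, hLper⟩ := hz.permanent_dumbbell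
    (fun s hs => by rw [hz.ncard_neighborSet hs, ncard_chordAdj_dumbbell (by omega) (by omega)
      (by omega) hs])
    (fun v hv => (hv v (by omega) (hzv v)).elim)
  have hL0 : L = 0 := by
    rw [Multiset.eq_zero_iff_forall_notMem]
    intro k hk
    have h1 := hL k hk
    have h2 : k ≤ L.sum := Multiset.single_le_sum (fun _ _ => Nat.zero_le _) k hk
    omega
  subst hL0
  have hper : ∀ w : ℝ, w ≠ 0 → w ^ Fintype.card V * (1 + w ^ 2) ^ 3 *
      (weightMatrix G (1 / w - w)).permanent = dumbbellVal w (p + 3) (q + 3) (r + 2) := by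
    intro w hw
    rw [← mul_one (dumbbellVal w (p + 3) (q + 3) (r + 2))]
    rw [← eval₂_lapPermPoly_eq_permanent, h, eval₂_lapPermPoly_eq_permanent, hcard, hLper w hw]
    simp
  have h2j := hc.two_le
  have hjk := hc.le
  have hik := hc.add_two_le
  have hncyc := hc.not_cycle
  rcases lt_or_gt_of_ne hc.ne with hij | hij
  -- Overlapping chords: a theta graph.
  · obtain ⟨m, rfl⟩ := Nat.exists_eq_add_of_lt hij
    obtain ⟨l, rfl⟩ := Nat.exists_eq_add_of_le hjk
    rw [show i + m + 1 + l = m + i + l + 1 by omega] at hy hd hd2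
    rw [show i + m + 1 = m + i + 1 by omega] at hy hd
    obtain ⟨K, hK, hKsum, hKper⟩ := hy.permanent_theta (by omega) (by omega) (by omega) hd hd2
    refine (dumbbell_ne_theta_of_unsorted (p := p + 3) (q := q + 3) (r := r + 2) (a := m + 1)
      (b := i + 1) (c := l + 1) (K := K) (by omega) (by omega) (by omega) (by omega) (by omega)
      (by omega) (by omega) (by omega) (by omega) hK (by omega) ?_).elim
    apply eq_of_eval₂_eq
    intro t ht
    rw [← coe_eval₂RingHom, map_mul, map_dumbbellVal, map_thetaVal, map_prod_cycleVal,
      coe_eval₂RingHom, eval₂_X, ← hper t ht, hKper t ht]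
  -- Disjoint chords: a dumbbell, which may be traversed in either direction.
  · obtain ⟨j, rfl⟩ := Nat.exists_eq_add_of_le' h2j
    obtain ⟨r', rfl⟩ := Nat.exists_eq_add_of_lt hij
    obtain ⟨q', rfl⟩ := Nat.exists_eq_add_of_le hik
    rw [show j + 2 + r' + 1 + 2 + q' = j + q' + r' + 5 by omega] at hy hd hd2
    rw [show j + 2 + r' + 1 = j + r' + 3 by omega] at hy hd
    obtain ⟨K, hK, hKsum, hKper⟩ := hy.permanent_dumbbell hd hd2
    obtain ⟨hpq, hrr, rfl⟩ := dumbbell_unique (p := p + 3) (q := q + 3) (r := r + 2) (p' := j + 3)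
      (q' := q' + 3) (r' := r' + 2) (K := K) (by omega) (by omega) (by omega) (by omega) (by omega)
      (by omega) hK (by omega) (by
        apply eq_of_eval₂_eq
        intro t ht
        rw [← coe_eval₂RingHom, map_mul, map_dumbbellVal, map_dumbbellVal, map_prod_cycleVal,
          coe_eval₂RingHom, eval₂_X, ← hper t ht, hKper t ht])
    obtain rfl : r = r' := by omega
    rw [Multiset.sum_zero] at hKsum
    rcases hpq with ⟨h1, h2⟩ | ⟨h1, h2⟩
    · obtain rfl : p = j := by omega
      obtain rfl : q = q' := by omega
      exact hy.nonempty_iso hz (by omega) (by omega)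
    · obtain rfl : p = q' := by omega
      obtain rfl : q = j := by omega
      have hy' := hy.reverse (by omega) (by omega)
      rw [show q + p + r + 5 - (q + 2) = p + r + 3 by omega,
        show q + p + r + 5 - (q + r + 3) = p + 2 by omega,
        show q + p + r + 5 = p + q + r + 5 by omega] at hy'
      exact hy'.nonempty_iso hz (by omega) (by omega)
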